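/- **Model.** Fix integers $M,K,S,N\ge 0$, a codebook $\mathbf D\in\mathbb C^{M\times N}$, a quantization error $\rho\in[0,1)$ with gain matrix $\mathbf Q=(1-\rho)\mathbf I_S$, a noise power $\sigma^2>0$, maximum powers $P_k^{\max}\in\mathbb R$ and target rates $\gamma_k>0$ ($k=1,\dots,K$). The variable is $\mathbf x=(\mathbf p,\mathbf C,\mathbf V,\mathbf W)$ with $\mathbf p\in\mathbb R^K$, $\mathbf C=(c_{ij})\in\mathbb R^{N\times S}$, $\mathbf V\in\mathbb C^{S\times S}$, $\mathbf W=[\mathbf w_1,\dots,\mathbf w_K]\in\mathbb C^{S\times K}$, regarded as an element of a real Euclidean space (real and imaginary parts are coordinates; inner product $\Re(\mathbf a^H\mathbf b)$; gradients are the corresponding real gradients). Put $\mathbf U=\mathbf D\mathbf C$ and $\mathbf P=\mathrm{diag}(\mathbf p)$. For a channel matrix $\mathbf H=[\mathbf h_1,\dots,\mathbf h_K]\in\mathbb C^{M\times K}$ let $\mathbf R_q=\mathbf Q(\mathbf I-\mathbf Q)\,\mathrm{Diag}(\mathbf U^H\mathbf H\mathbf P\mathbf H^H\mathbf U+\sigma^2\mathbf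 U^H\mathbf U)$, $$r_k(\mathbf x;\mathbf H)=\log\Bigl(1+\tfrac{p_k|\mathbf w_k^H\mathbf V^H\mathbf Q\mathbf U^H\mathbf h_k|^2}{I_k(\mathbf x;\mathbf H)}\Bigr),$$ $$I_k(\mathbf x;\mathbf H)=\sum_{i\ne k}p_i|\mathbf w_k^H\mathbf V^H\mathbf Q\mathbf U^H\mathbf h_i|^2+\sigma^2\|\mathbf w_k^H\mathbf V^H\mathbf Q\mathbf U^H\|^2+\mathbf w_k^H\mathbf V^H\mathbf R_q\mathbf V\mathbf w_k .$$ Let $\nu$ be the law of the channel; assume that all entries of $\mathbf H\sim\nu$ have finite absolute moments of every order. Put $\bar r_k(\mathbf x)=\mathbb E_{\mathbf H\sim\nu}[r_k(\mathbf x;\mathbf H)]$ and $f_k=\gamma_k-\bar r_k$. The relaxed transmit-power-minimization problem is $$\min_{\mathbf x\in\chi}\ \sum_{k}p_k\quad\text{s.t. } f_k(\mathbf x)\le 0\ \ \forall k,\qquad(\ast)$$ $$\chi=\Bigl\{\mathbf x:\ 0\le p_k\le P_k^{\max},\ \sum_i c_{ij}=1\ \forall j,\ \sum_j c_{ij}\le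 1\ \forall i,\ c_{ij}\in[0,1]\Bigr\}.$$ A point $\mathbf z$ is *stationary* for $(\ast)$ if $\mathbf z\in\chi$, $f_k(\mathbf z)\le0$ for all $k$, the $f_k$ are differentiable at $\mathbf z$, and there are $\lambda_k\ge0$ with $\lambda_kf_k(\mathbf z)=0$ and $\langle\nabla(\sum_kp_k)+\sum_k\lambda_k\nabla f_k(\mathbf z),\,\mathbf y-\mathbf z\rangle\ge0$ for all $\mathbf y\in\chi$. (Differentiability and gradients of $f_k$ are relative to $\{\mathbf p\ge0\}$, i.e. one-sided in vanishing powers.) **Algorithm (RSSCA).** Let $\mathbf H^0,\mathbf H^1,\dots$ be independent with law $\nu$; let $\tau_k>0$ and $\alpha^l,\beta^l\in(0,1]$. Start from a deterministic $\mathbf x^0\in\chi$ and $\boldsymbol\kappa_k^{-1}=\mathbf 0$. For $l=0,1,2,\dots$ set $\hat r_k^l=\frac1{l+1}\sum_{i=0}^l r_k(\mathbf x^l;\mathbf H^i)$, $\boldsymbol\kappa_k^l=(1-\beta^l)\boldsymbol\kappa_k^{l-1}+\beta^l\,\nabla_{\mathbf x}\bigl(\gamma_k-r_k(\cdot;\mathbf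 H^l)\bigr)(\mathbf x^l)$ and $$\hat f_k^l(\mathbf x)=\gamma_k-\hat r_k^l+\Re[(\boldsymbol\kappa_k^l)^H(\mathbf x-\mathbf x^l)]+\tau_k\|\mathbf x-\mathbf x^l\|^2 .$$ Let $(\hat{\mathbf x},\hat\xi)$ minimize $\xi$ over $\mathbf x\in\chi$, $\xi\in\mathbb R$ subject to $\hat f_k^l(\mathbf x)\le\xi$ for all $k$. If $\hat\xi\le0$, let $\bar{\mathbf x}^l$ be a minimizer of $\sum_kp_k$ over $\mathbf x\in\chi$ subject to $\hat f_k^l(\mathbf x)\le0$ for all $k$; otherwise let $\bar{\mathbf x}^l=\hat{\mathbf x}$. Put $\mathbf x^{l+1}=(1-\alpha^l)\mathbf x^l+\alpha^l\bar{\mathbf x}^l$. Minimizers are chosen so that $\mathbf x^{l+1}$ is a measurable function of $\mathbf H^0,\dots,\mathbf H^l$. **Theorem.** Assume $\alpha^l\to0$, $\sum_l\alpha^l=\infty$, $\sum_l(\alpha^l)^2<\infty$; $\beta^l\to0$, $\sum_l\beta^l=\infty$, $\sum_l(\beta^l)^2<\infty$; and $\alpha^l/\beta^l\to0$. Then almost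 surely the following holds. Suppose that the iterates stay in a compact subset of the set where the rates are well defined, i.e. where $I_k(\mathbf x;\mathbf 0)>0$ for all $k$ (this subset may depend on the realization), and that the Slater condition is satisfied: for the limit $\mathbf z$ of any convergent subsequence of the iterates there is $\mathbf y\in\chi$ with $\tilde f_k(\mathbf y)<0$ for all $k$, where $$\tilde f_k(\mathbf y)=\gamma_k-\bar r_k(\mathbf z)+\Re[\nabla^Hf_k(\mathbf z)(\mathbf y-\mathbf z)]+\tau_k\|\mathbf y-\mathbf z\|^2 .$$ Then for every subsequence $\mathbf x^{l_j}$ converging to a limit point $\mathbf x^\star$, the point $\mathbf x^\star$ is a stationary point of $(\ast)$. -/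

import Mathlib

open Filter Topology MeasureTheory ProbabilityTheory
open scoped Matrix

noncomputable section

namespace RSSCA

/-- A channel realization: `h m k` is the coefficient from user `k` to receive antenna `m`, so that
the `k`-th column is the channel vector of user `k`. -/
abbrev Channel (M K : ℕ) : Type := Fin M → Fin K → ℂ

/-- Real coordinates of the optimization variable `(p, C, V, W)`: transmit powers, entries of the
(relaxed) selection matrix, and real (`0`) and imaginary (`1`) parts of the entries of the baseband
combiner `V` and of the receive beamformers `W`. -/
abbrev Coord (K S N : ℕ) : Type :=
  Fin K ⊕ (Fin N × Fin S) ⊕ ((Fin S × Fin S) × Fin 2) ⊕ ((Fin S × Fin K) × Fin 2)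

/-- The space of optimization variables. Its real inner product of `κ` and `x` is `Re (κᴴ x)` for
the stacked complex vectors, and real gradients are the gradients with respect to `(p, c, v, w)`. -/
abbrev Var (K S N : ℕ) : Type := EuclideanSpace ℝ (Coord K S N)

variable {M K S N : ℕ}

/-- Transmit power of user `k`. -/
def power (x : Var K S N) (k : Fin K) : ℝ := x (Sum.inl k)

/-- Relaxed codeword selection variable `c_{ij}`. -/
def sel (x : Var K S N) (i : Fin N) (j : Fin S) : ℝ := x (Sum.inr (Sum.inl (i, j)))

/-- The selection matrix `C`. -/
def selMatrix (x : Var K S N) : Matrix (Fin N) (Fin S) ℂ :=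
  Matrix.of fun i j => (sel x i j : ℂ)

/-- The baseband combiner `V`. -/
def baseband (x : Var K S N) : Matrix (Fin S) (Fin S) ℂ :=
  Matrix.of fun s t =>
    ⟨x (Sum.inr (Sum.inr (Sum.inl ((s, t), 0)))), x (Sum.inr (Sum.inr (Sum.inl ((s, t), 1))))⟩

/-- The receive beamformer `w_k`. -/
def beam (x : Var K S N) (k : Fin K) : Fin S → ℂ :=
  fun s =>
    ⟨x (Sum.inr (Sum.inr (Sum.inr ((s, k), 0)))), x (Sum.inr (Sum.inr (Sum.inr ((s, k), 1))))⟩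

/-- The objective `∑ p_k`. -/
def totalPower (x : Var K S N) : ℝ := ∑ k, power x k

/-- The set of variables with nonnegative powers, on which the rates have a physical meaning. -/
def physical (K S N : ℕ) : Set (Var K S N) := {x | ∀ k, 0 ≤ power x k}

/-- Parameters of the uplink system. -/
structure Uplink (M K S N : ℕ) where
  /-- the codebook `D` -/
  codebook : Matrix (Fin M) (Fin N) ℂ
  /-- the normalized quantization error `ρ` -/
  quantError : ℝ
  /-- the noise power `σ²` -/
  noiseVar : ℝ
  /-- the maximum transmit powers -/
  maxPower : Fin K → ℝ
  /-- the target rates -/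
  targetRate : Fin K → ℝ
  quantError_nonneg : 0 ≤ quantError
  quantError_lt_one : quantError < 1
  noiseVar_pos : 0 < noiseVar
  targetRate_pos : ∀ k, 0 < targetRate k

namespace Uplink

variable (sys : Uplink M K S N)

/-- The RF combiner `U = D C`. -/
def rfCombiner (x : Var K S N) : Matrix (Fin M) (Fin S) ℂ := sys.codebook * selMatrix x

/-- The quantization gain matrix `Q = (1 - ρ) I`. -/
def gainMatrix : Matrix (Fin S) (Fin S) ℂ :=
  Matrix.diagonal fun _ => ((1 - sys.quantError : ℝ) : ℂ)

/-- The covariance `R_q = Q (I - Q) Diag(Uᴴ H P Hᴴ U + σ² Uᴴ U)` of the quantization noise. -/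
def quantCov (x : Var K S N) (h : Channel M K) : Matrix (Fin S) (Fin S) ℂ :=
  let U := sys.rfCombiner x
  let H : Matrix (Fin M) (Fin K) ℂ := Matrix.of h
  let P : Matrix (Fin K) (Fin K) ℂ := Matrix.diagonal fun k => (power x k : ℂ)
  sys.gainMatrix * (1 - sys.gainMatrix) *
    Matrix.diagonal (Matrix.diag (Uᴴ * H * P * Hᴴ * U + (sys.noiseVar : ℂ) • (Uᴴ * U)))

/-- The row vector `w_kᴴ Vᴴ`. -/
def digitalRow (x : Var K S N) (k : Fin K) : Fin S → ℂ := star (beam x k) ᵥ* (baseband x)ᴴ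

/-- The row vector `w_kᴴ Vᴴ Q Uᴴ`. -/
def combinerRow (x : Var K S N) (k : Fin K) : Fin M → ℂ :=
  digitalRow x k ᵥ* (sys.gainMatrix * (sys.rfCombiner x)ᴴ)

/-- `|w_kᴴ Vᴴ Q Uᴴ h_i|²`. -/
def linkGain (x : Var K S N) (h : Channel M K) (k i : Fin K) : ℝ :=
  ‖sys.combinerRow x k ⬝ᵥ (fun m => h m i)‖ ^ 2

/-- Interference, thermal noise and quantization noise of user `k`: the denominator of the SINR. -/
def impairment (k : Fin K) (x : Var K S N) (h : Channel M K) : ℝ :=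
  (∑ i ∈ Finset.univ.erase k, power x i * sys.linkGain x h k i)
    + sys.noiseVar * (∑ m, ‖sys.combinerRow x k m‖ ^ 2)
    + (digitalRow x k ⬝ᵥ (sys.quantCov x h *ᵥ (baseband x *ᵥ beam x k))).re

/-- The SINR of user `k`. -/
def sinr (k : Fin K) (x : Var K S N) (h : Channel M K) : ℝ :=
  power x k * sys.linkGain x h k k / sys.impairment k x h

/-- The instantaneous rate of user `k`. -/
def rate (k : Fin K) (x : Var K S N) (h : Channel M K) : ℝ := Real.log (1 + sys.sinr k x h)

/-- The average rate of user `k` when the channel has law `ν`. -/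
def avgRate (ν : Measure (Channel M K)) (k : Fin K) (x : Var K S N) : ℝ :=
  ∫ h, sys.rate k x h ∂ν

/-- The constraint function `f_k = γ_k - r̄_k`. -/
def constr (ν : Measure (Channel M K)) (k : Fin K) (x : Var K S N) : ℝ :=
  sys.targetRate k - sys.avgRate ν k x

/-- The gradient of `f_k`, one-sided in those powers that vanish. -/
def constrGrad (ν : Measure (Channel M K)) (k : Fin K) (x : Var K S N) : Var K S N :=
  gradientWithin (sys.constr ν k) (physical K S N) x

/-- The constraint set `χ`, with the binary constraints relaxed to the interval `[0, 1]`. -/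
def chi : Set (Var K S N) :=
  {x | (∀ k, 0 ≤ power x k ∧ power x k ≤ sys.maxPower k) ∧
    (∀ j, ∑ i, sel x i j = 1) ∧ (∀ i, ∑ j, sel x i j ≤ 1) ∧
    ∀ i j, 0 ≤ sel x i j ∧ sel x i j ≤ 1}

/-- The variables at which every user's combiner output contains noise of positive power. Elsewhere
the combiner output of some user vanishes identically and its SINR is `0 / 0`. -/
def regular : Set (Var K S N) := {x | ∀ k, 0 < sys.impairment k x 0}

/-! ### The algorithm

`h` is the sequence of channel samples and `x` the sequence of iterates. -/

/-- The sample average `r̂_k^l` of the rate at `x^l`, over the samples obtained so far. -/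
def sampleRate (h : ℕ → Channel M K) (x : ℕ → Var K S N) (k : Fin K) (l : ℕ) : ℝ :=
  (∑ i ∈ Finset.range (l + 1), sys.rate k (x l) (h i)) / ((l : ℝ) + 1)

/-- The gradient at `x^l` of the instantaneous constraint function `γ_k - r_k(·; H^l)`. -/
def sampleGrad (h : ℕ → Channel M K) (x : ℕ → Var K S N) (k : Fin K) (l : ℕ) : Var K S N :=
  gradient (fun y => sys.targetRate k - sys.rate k y (h l)) (x l)

/-- The recursive gradient approximation `κ_k^l`, started from `κ_k^{-1} = 0`. -/
def gradEst (β : ℕ → ℝ) (h : ℕ → Channel M K) (x : ℕ → Var K S N) (k : Fin K) : ℕ → Var K S N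
  | 0 => (1 - β 0) • (0 : Var K S N) + β 0 • sys.sampleGrad h x k 0
  | l + 1 => (1 - β (l + 1)) • gradEst β h x k l + β (l + 1) • sys.sampleGrad h x k (l + 1)

/-- The surrogate function `f̂_k^l`. -/
def surrogate (τ : Fin K → ℝ) (β : ℕ → ℝ) (h : ℕ → Channel M K) (x : ℕ → Var K S N)
    (l : ℕ) (k : Fin K) (y : Var K S N) : ℝ :=
  sys.targetRate k - sys.sampleRate h x k l + inner ℝ (sys.gradEst β h x k l) (y - x l)
    + τ k * ‖y - x l‖ ^ 2

/-- `y` solves: minimize `∑ p_k` over `χ` subject to `g_k ≤ 0` for all `k`. -/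
def SolvesObjective (g : Fin K → Var K S N → ℝ) (y : Var K S N) : Prop :=
  y ∈ sys.chi ∧ (∀ k, g k y ≤ 0) ∧
    ∀ z ∈ sys.chi, (∀ k, g k z ≤ 0) → totalPower y ≤ totalPower z

/-- `(y, ξ)` solves: minimize `ξ` over `χ × ℝ` subject to `g_k ≤ ξ` for all `k`. -/
def SolvesFeasibility (g : Fin K → Var K S N → ℝ) (y : Var K S N) (ξ : ℝ) : Prop :=
  y ∈ sys.chi ∧ (∀ k, g k y ≤ ξ) ∧ ∀ z ∈ sys.chi, ∀ ζ : ℝ, (∀ k, g k z ≤ ζ) → ξ ≤ ζ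

/-- `x` is a sequence of iterates of the algorithm for the channel samples `h`. -/
structure IsRun (τ : Fin K → ℝ) (α β : ℕ → ℝ) (h : ℕ → Channel M K) (x : ℕ → Var K S N) :
    Prop where
  init : x 0 ∈ sys.chi
  step : ∀ l, ∃ (xhat : Var K S N) (ξ : ℝ) (xbar : Var K S N),
    sys.SolvesFeasibility (sys.surrogate τ β h x l) xhat ξ ∧
    (ξ ≤ 0 → sys.SolvesObjective (sys.surrogate τ β h x l) xbar) ∧
    (0 < ξ → xbar = xhat) ∧
    x (l + 1) = (1 - α l) • x l + α l • xbar

/-- The limiting surrogate function `f̃_k` at the point `z`. -/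
def limitSurrogate (ν : Measure (Channel M K)) (τ : Fin K → ℝ) (z : Var K S N)
    (k : Fin K) (y : Var K S N) : ℝ :=
  sys.targetRate k - sys.avgRate ν k z + inner ℝ (sys.constrGrad ν k z) (y - z)
    + τ k * ‖y - z‖ ^ 2

/-- The Slater condition at `z`: the limiting surrogate constraints at `z` can be satisfied
strictly. -/
def SlaterAt (ν : Measure (Channel M K)) (τ : Fin K → ℝ) (z : Var K S N) : Prop :=
  ∃ y ∈ sys.chi, ∀ k, sys.limitSurrogate ν τ z k y < 0

/-- `z` is a stationary (Karush-Kuhn-Tucker) point of: minimize `∑ p_k` over `χ` subject to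
`f_k ≤ 0` for all `k`. -/
structure IsStationary (ν : Measure (Channel M K)) (z : Var K S N) : Prop where
  mem_chi : z ∈ sys.chi
  feasible : ∀ k, sys.constr ν k z ≤ 0
  differentiable : ∀ k, DifferentiableWithinAt ℝ (sys.constr ν k) (physical K S N) z
  multipliers : ∃ lam : Fin K → ℝ, (∀ k, 0 ≤ lam k) ∧ (∀ k, lam k * sys.constr ν k z = 0) ∧
    ∀ y ∈ sys.chi,
      0 ≤ inner ℝ (gradient totalPower z + ∑ k, lam k • sys.constrGrad ν k z) (y - z)

end Uplink

end RSSCA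

end

/-! Three obstacles shape the argument: the objective is linear, the surrogate values are averages
over samples on which the current iterate itself depends, and the step sizes are only square
summable. The proof separates chance from optimization.

Probability. For nonnegative powers each rate is a difference of logarithms of two polynomials in
the variables. Both are a constant plus a quadratic form in the channel, and both are smallest at
the zero channel. On a compact set of regular points, the values, gradients, Lipschitz constants and
Taylor remainders are therefore dominated by `B * (1 + ‖h‖) ^ 4`, which has all moments. High
moments and polynomial nets give uniform convergence of sample averages at the rate `(l + 1) ^
(-3/8)` (`IsSampling.ae_uniform_rate`). Martingale convergence controls the noise of the recursive
gradients and of each new sample. `TypicalPath` collects these almost sure facts, and from then on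
one realization is fixed.

Optimization. By compactness, the Slater condition at limit points holds along the run with a
uniform margin, so eventually the surrogate problems are feasible and have bounded multipliers. If
the multipliers are not small, strong convexity of the surrogates makes the objective decrease, up
to the Lagrange terms, by `c * ‖xbar - x‖ ^ 2`. If they are small, `xbar` needs little power,
whereas the iterates cannot: they are asymptotically feasible for positive target rates. An exact
penalty absorbs the Lagrange terms. It is applied to the sample average and not to the mean, because
a deviation of order `l ^ (-1/2)` weighted by `α l` need not be summable. The sample average instead
changes, on arrival of a sample, by a martingale increment and a summable drift. The penalty is
smoothed at width `(l + 1) ^ (-3/4)`, so that the increment enters with a slope known beforehand and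
a summable second order remainder. Gradient errors enter only squared. The outcome is
`SurrogateRun.summable_step_mul_sq`: the sum of `α l * ‖xbar l - x l‖ ^ 2` is finite.

Conclusion. If a limit point `z` did not solve its limiting surrogate problem, `xbar - x` would be
bounded away from zero near `z`. The finite sum then leaves too little total step to escape from
`z`, while the divergent step sum forbids staying. So `z` solves the limiting problem. Since the
limiting surrogate agrees with `f_k` at `z` to first order, the multipliers of that convex problem
are multipliers for the original one. -/

noncomputable section

/-! ### Smooth functions that are quadratic in a parameter -/

section QuadraticParameter

variable {E F W : Type*} [NormedAddCommGroup E] [NormedSpace ℝ E]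
  [NormedAddCommGroup F] [NormedSpace ℝ F]
  [NormedAddCommGroup W] [NormedSpace ℝ W]

/-- `Q (x, ·)` is a constant plus a function that is homogeneous of degree two. -/
def QuadraticIn (Q : E → F → W) : Prop :=
  ∀ x h (t : ℝ), Q x (t • h) = (1 - t ^ 2) • Q x 0 + t ^ 2 • Q x h

/-- The derivative of `Q (·, h)`. -/
def partialDeriv (Q : E → F → W) (x : E) (h : F) : E →L[ℝ] W := fderiv ℝ (fun y => Q y h) x

/-- Scaling a large parameter to the unit sphere reduces the bound to a maximum over a compact set.
The factor 2 covers the two terms of the scaling identity. -/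
theorem QuadraticIn.exists_bound [FiniteDimensional ℝ E] [FiniteDimensional ℝ F]
    {Q : E → F → W} (hq : QuadraticIn Q)
    (hc : Continuous (Function.uncurry Q)) (R : ℝ) :
    ∃ B : ℝ, 0 ≤ B ∧ ∀ x h, ‖x‖ ≤ R → ‖Q x h‖ ≤ B * (1 + ‖h‖) ^ 2 := by
  have hK : IsCompact (Metric.closedBall (0 : E) R ×ˢ Metric.closedBall (0 : F) 1) :=
    (isCompact_closedBall _ _).prod (isCompact_closedBall _ _)
  obtain ⟨m, hm, hb⟩ : ∃ m : ℝ, 0 ≤ m ∧ ∀ x h, ‖x‖ ≤ R → ‖h‖ ≤ 1 → ‖Q x h‖ ≤ m := by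
    obtain ⟨B, hB⟩ := hK.exists_bound_of_continuousOn hc.continuousOn
    exact ⟨max B 0, le_max_right _ _, fun x h hx hh =>
      (hB (x, h) ⟨by simpa using hx, by simpa using hh⟩).trans (le_max_left _ _)⟩
  refine ⟨2 * m, by positivity, fun x h hx => ?_⟩
  rcases le_total ‖h‖ 1 with hh | hh
  · have := hb x h hx hh
    have hp : (1 : ℝ) ≤ (1 + ‖h‖) ^ 2 := one_le_pow₀ (by linarith [norm_nonneg h])
    have := mul_le_mul_of_nonneg_left hp (by positivity : 0 ≤ 2 * m)
    linarith
  · have hpos : 0 < ‖h‖ := by linarith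
    have hh' : h = ‖h‖ • (‖h‖⁻¹ • h) := by rw [smul_smul, mul_inv_cancel₀ hpos.ne', one_smul]
    have hunit : ‖(‖h‖⁻¹ • h)‖ ≤ 1 := by
      rw [norm_smul, norm_inv, norm_norm, inv_mul_cancel₀ hpos.ne']
    have e := hq x (‖h‖⁻¹ • h) ‖h‖
    rw [← hh'] at e
    rw [e]
    refine (norm_add_le _ _).trans ?_
    rw [norm_smul, norm_smul]
    have h0 := hb x 0 hx (by simp)
    have h1 := hb x _ hx hunit
    have e1 : ‖(1 - ‖h‖ ^ 2 : ℝ)‖ ≤ ‖h‖ ^ 2 := by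
      rw [Real.norm_eq_abs, abs_le]; constructor <;> nlinarith
    have e2 : ‖(‖h‖ ^ 2 : ℝ)‖ = ‖h‖ ^ 2 := by simp
    rw [e2]
    have := mul_le_mul e1 h0 (norm_nonneg _) (by positivity)
    have := mul_le_mul_of_nonneg_left h1 (by positivity : 0 ≤ ‖h‖ ^ 2)
    nlinarith

/-- The scaling identity is linear in `Q`, so it survives differentiation in the first variable. All
derivatives therefore obey the same quadratic bound. -/
theorem QuadraticIn.partialDeriv {Q : E → F → W} (hq : QuadraticIn Q)
    (hd : ∀ h, Differentiable ℝ fun y => Q y h) : QuadraticIn (partialDeriv Q) := by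
  intro x h t
  unfold _root_.partialDeriv
  rw [show (fun y => Q y (t • h)) = fun y => (1 - t ^ 2) • Q y 0 + t ^ 2 • Q y h from
    funext fun y => hq y h t]
  exact ((((hd 0) x).hasFDerivAt.const_smul _).add (((hd h) x).hasFDerivAt.const_smul _)).fderiv

theorem contDiff_partialDeriv {Q : E → F → W} {m n : WithTop ℕ∞}
    (hQ : ContDiff ℝ m (Function.uncurry Q)) (hmn : n + 1 ≤ m) :
    ContDiff ℝ n (Function.uncurry (partialDeriv Q)) := by
  have : ContDiff ℝ m (Function.uncurry fun (z : E × F) (y : E) => Q y z.2) :=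
    hQ.comp (contDiff_snd.prodMk (contDiff_snd.comp contDiff_fst))
  exact this.fderiv contDiff_fst hmn

theorem ContDiff.differentiable_left {Q : E → F → W} {m : WithTop ℕ∞}
    (hQ : ContDiff ℝ m (Function.uncurry Q)) (hm : m ≠ 0) (h : F) :
    Differentiable ℝ fun y => Q y h :=
  (hQ.comp (contDiff_id.prodMk contDiff_const) : ContDiff ℝ m fun y => Q y h).differentiable hm

omit [NormedAddCommGroup F] [NormedSpace ℝ F] in
theorem hasFDerivAt_partialDeriv {Q : E → F → W} {h : F} (hd : Differentiable ℝ fun y => Q y h)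
    (x : E) : HasFDerivAt (fun y => Q y h) (partialDeriv Q x h) x :=
  (hd x).hasFDerivAt

/-- A smooth function that is quadratic in the parameter satisfies, on balls, value, Lipschitz and
first order Taylor estimates with constants that are quadratic in the parameter. -/
theorem QuadraticIn.exists_estimates [FiniteDimensional ℝ E] [FiniteDimensional ℝ F]
    {Q : E → F → ℝ} (hq : QuadraticIn Q)
    (hQ : ContDiff ℝ 2 (Function.uncurry Q)) (R : ℝ) :
    ∃ B : ℝ, 0 ≤ B ∧ ∀ h, ∀ x y, ‖x‖ ≤ R → ‖y‖ ≤ R →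
      |Q x h| ≤ B * (1 + ‖h‖) ^ 2 ∧ ‖_root_.partialDeriv Q x h‖ ≤ B * (1 + ‖h‖) ^ 2 ∧
      |Q y h - Q x h| ≤ B * (1 + ‖h‖) ^ 2 * ‖y - x‖ ∧
      ‖_root_.partialDeriv Q y h - _root_.partialDeriv Q x h‖ ≤ B * (1 + ‖h‖) ^ 2 * ‖y - x‖ ∧
      |Q y h - Q x h - _root_.partialDeriv Q x h (y - x)| ≤ B * (1 + ‖h‖) ^ 2 * ‖y - x‖ ^ 2 := by
  have hd := hQ.differentiable_left (by norm_num)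
  have hQ1 : ContDiff ℝ 1 (Function.uncurry (_root_.partialDeriv Q)) :=
    contDiff_partialDeriv hQ (by norm_num)
  have hd1 := hQ1.differentiable_left (by norm_num)
  have hQ2 : ContDiff ℝ 0 (Function.uncurry (_root_.partialDeriv (_root_.partialDeriv Q))) :=
    contDiff_partialDeriv hQ1 (by norm_num)
  have q1 := hq.partialDeriv hd
  have q2 := q1.partialDeriv hd1
  obtain ⟨B0, hB0, h0⟩ := hq.exists_bound hQ.continuous R
  obtain ⟨B1, hB1, h1⟩ := q1.exists_bound hQ1.continuous R
  obtain ⟨B2, hB2, h2⟩ := q2.exists_bound hQ2.continuous R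
  have aux : ∀ h : F, ∀ x y : E, ‖x‖ ≤ R → ‖y‖ ≤ R →
      ‖_root_.partialDeriv Q y h - _root_.partialDeriv Q x h‖ ≤ B2 * (1 + ‖h‖) ^ 2 * ‖y - x‖ := by
    intro h x y hx hy
    exact (convex_closedBall (0 : E) R).norm_image_sub_le_of_norm_hasFDerivWithin_le
      (f := fun y => _root_.partialDeriv Q y h)
      (fun z _ => (hasFDerivAt_partialDeriv (hd1 h) z).hasFDerivWithinAt)
      (fun z hz => h2 z h (by simpa using hz)) (by simpa using hx) (by simpa using hy)
  refine ⟨B0 + B1 + B2, by positivity, fun h x y hx hy => ?_⟩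
  have hp : (0 : ℝ) ≤ (1 + ‖h‖) ^ 2 := by positivity
  have le0 : B0 * (1 + ‖h‖) ^ 2 ≤ (B0 + B1 + B2) * (1 + ‖h‖) ^ 2 := by gcongr; linarith
  have le1 : B1 * (1 + ‖h‖) ^ 2 ≤ (B0 + B1 + B2) * (1 + ‖h‖) ^ 2 := by gcongr; linarith
  have le2 : B2 * (1 + ‖h‖) ^ 2 ≤ (B0 + B1 + B2) * (1 + ‖h‖) ^ 2 := by gcongr; linarith
  refine ⟨(h0 x h hx).trans le0, (h1 x h hx).trans le1, ?_, ?_, ?_⟩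
  · refine le_trans ?_ (mul_le_mul_of_nonneg_right le1 (norm_nonneg _))
    exact (convex_closedBall (0 : E) R).norm_image_sub_le_of_norm_hasFDerivWithin_le
      (f := fun y => Q y h)
      (fun z _ => (hasFDerivAt_partialDeriv (hd h) z).hasFDerivWithinAt)
      (fun z hz => h1 z h (by simpa using hz)) (by simpa using hx) (by simpa using hy)
  · exact (aux h x y hx hy).trans (mul_le_mul_of_nonneg_right le2 (norm_nonneg _))
  · refine le_trans ?_ (mul_le_mul_of_nonneg_right le2 (by positivity))
    -- On the part of the ball within distance `‖y - x‖` of `x`, the derivative differs from that at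
    -- `x` by at most a multiple of `‖y - x‖`. The mean value inequality on this smaller convex set
    -- gives the quadratic remainder.
    have hconv : Convex ℝ (Metric.closedBall (0 : E) R ∩ Metric.closedBall x ‖y - x‖) :=
      (convex_closedBall _ _).inter (convex_closedBall _ _)
    have := hconv.norm_image_sub_le_of_norm_hasFDerivWithin_le' (f := fun y => Q y h)
      (φ := _root_.partialDeriv Q x h) (C := B2 * (1 + ‖h‖) ^ 2 * ‖y - x‖)
      (x := x) (y := y)
      (fun z _ => (hasFDerivAt_partialDeriv (hd h) z).hasFDerivWithinAt)
      (fun z hz => (aux h x z hx (by simpa using hz.1)).trans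
        (mul_le_mul_of_nonneg_left (by simpa [dist_eq_norm] using hz.2) (by positivity)))
      ⟨by simpa using hx, by simp⟩ ⟨by simpa using hy, by simp [dist_eq_norm]⟩
    rw [Real.norm_eq_abs] at this
    rw [pow_two ‖y - x‖, ← mul_assoc]
    exact this


/-- Logarithms of such functions inherit these estimates where the function is bounded below. -/
theorem QuadraticIn.exists_log_estimates [FiniteDimensional ℝ E] [FiniteDimensional ℝ F]
    {Q : E → F → ℝ} (hq : QuadraticIn Q)
    (hQ : ContDiff ℝ 2 (Function.uncurry Q)) (R : ℝ) {c : ℝ} (hc : 0 < c) :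
    ∃ A : ℝ, 0 ≤ A ∧ ∀ h, ∀ x y, ‖x‖ ≤ R → ‖y‖ ≤ R → c ≤ Q x h → c ≤ Q y h →
      |Real.log (Q x h)| ≤ A * (1 + ‖h‖) ^ 4 ∧
      ‖(Q x h)⁻¹ • _root_.partialDeriv Q x h‖ ≤ A * (1 + ‖h‖) ^ 4 ∧
      ‖(Q y h)⁻¹ • _root_.partialDeriv Q y h - (Q x h)⁻¹ • _root_.partialDeriv Q x h‖
        ≤ A * (1 + ‖h‖) ^ 4 * ‖y - x‖ ∧
      |Real.log (Q y h) - Real.log (Q x h) - ((Q x h)⁻¹ • _root_.partialDeriv Q x h) (y - x)|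
        ≤ A * (1 + ‖h‖) ^ 4 * ‖y - x‖ ^ 2 := by
  obtain ⟨B, hB, hest⟩ := hq.exists_estimates hQ R
  refine ⟨B + c⁻¹ + B * c⁻¹ + B ^ 2 * c⁻¹ ^ 2, by positivity, fun h x y hx hy hcx hcy => ?_⟩
  obtain ⟨e1, e2, e3, e4, e5⟩ := hest h x y hx hy
  set p : ℝ := (1 + ‖h‖) ^ 2 with hp
  have hp4 : (1 + ‖h‖) ^ 4 = p ^ 2 := by rw [hp]; ring
  rw [hp4]
  have hp1 : 1 ≤ p := one_le_pow₀ (by linarith [norm_nonneg h])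
  have hpp : p ≤ p ^ 2 := by nlinarith
  have hp2 : 1 ≤ p ^ 2 := by nlinarith
  have hi : 0 < c⁻¹ := inv_pos.2 hc
  have hx0 : 0 < Q x h := hc.trans_le hcx
  have hy0 : 0 < Q y h := hc.trans_le hcy
  have hix : (Q x h)⁻¹ ≤ c⁻¹ := inv_anti₀ hc hcx
  have hiy : (Q y h)⁻¹ ≤ c⁻¹ := inv_anti₀ hc hcy
  have hix0 : 0 < (Q x h)⁻¹ := inv_pos.2 hx0
  have hiy0 : 0 < (Q y h)⁻¹ := inv_pos.2 hy0
  have k1 : B * p ≤ B * p ^ 2 := by gcongr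
  have k2 : c⁻¹ ≤ c⁻¹ * p ^ 2 := le_mul_of_one_le_right hi.le hp2
  have k3 : B * p * c⁻¹ ≤ B * c⁻¹ * p ^ 2 := by
    rw [mul_right_comm]; gcongr
  have pos1 : 0 ≤ B * p ^ 2 := by positivity
  have pos2 : 0 ≤ c⁻¹ * p ^ 2 := by positivity
  have pos3 : 0 ≤ B * c⁻¹ * p ^ 2 := by positivity
  have pos4 : 0 ≤ B ^ 2 * c⁻¹ ^ 2 * p ^ 2 := by positivity
  have tot : (B + c⁻¹ + B * c⁻¹ + B ^ 2 * c⁻¹ ^ 2) * p ^ 2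
      = B * p ^ 2 + c⁻¹ * p ^ 2 + B * c⁻¹ * p ^ 2 + B ^ 2 * c⁻¹ ^ 2 * p ^ 2 := by ring
  have hn := norm_nonneg (y - x)
  refine ⟨?_, ?_, ?_, ?_⟩
  · rw [abs_le]
    have u1 := Real.log_le_sub_one_of_pos hx0
    have u2 := Real.one_sub_inv_le_log_of_pos hx0
    have u3 := le_abs_self (Q x h)
    constructor <;> linarith
  · rw [norm_smul, Real.norm_of_nonneg hix0.le]
    have := mul_le_mul hix e2 (norm_nonneg _) hi.le
    linarith
  -- The quotient rule in difference form: one term for the change of the derivative and one for the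
  -- change of the reciprocal. The second contains two factors quadratic in the parameter, hence the
  -- fourth power.
  · have split : (Q y h)⁻¹ • _root_.partialDeriv Q y h - (Q x h)⁻¹ • _root_.partialDeriv Q x h
        = (Q y h)⁻¹ • (_root_.partialDeriv Q y h - _root_.partialDeriv Q x h)
          + (-((Q x h)⁻¹ * (Q y h)⁻¹ * (Q y h - Q x h))) • _root_.partialDeriv Q x h := by
      have : (Q y h)⁻¹ = (Q x h)⁻¹ + (-((Q x h)⁻¹ * (Q y h)⁻¹ * (Q y h - Q x h))) := by
        field_simp; ring
      rw [smul_sub, sub_add, ← sub_smul]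
      congr 2
      linarith
    rw [split]
    refine (norm_add_le _ _).trans ?_
    rw [norm_smul, norm_smul, norm_neg, norm_mul, norm_mul, Real.norm_of_nonneg hiy0.le,
      Real.norm_of_nonneg hix0.le, Real.norm_eq_abs]
    have t1 : (Q y h)⁻¹ * ‖_root_.partialDeriv Q y h - _root_.partialDeriv Q x h‖
        ≤ c⁻¹ * (B * p * ‖y - x‖) := mul_le_mul hiy e4 (norm_nonneg _) hi.le
    have t2 : (Q x h)⁻¹ * (Q y h)⁻¹ * |Q y h - Q x h| * ‖_root_.partialDeriv Q x h‖
        ≤ c⁻¹ * c⁻¹ * (B * p * ‖y - x‖) * (B * p) := by gcongr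
    have t3 := mul_le_mul_of_nonneg_right k3 hn
    have tot2 : (B + c⁻¹ + B * c⁻¹ + B ^ 2 * c⁻¹ ^ 2) * p ^ 2 * ‖y - x‖
        = B * p ^ 2 * ‖y - x‖ + c⁻¹ * p ^ 2 * ‖y - x‖ + B * c⁻¹ * p ^ 2 * ‖y - x‖
          + c⁻¹ * c⁻¹ * (B * p * ‖y - x‖) * (B * p) := by ring
    have t4 : c⁻¹ * (B * p * ‖y - x‖) = B * p * c⁻¹ * ‖y - x‖ := by ring
    rw [tot2]
    have := mul_nonneg pos1 hn
    have := mul_nonneg pos2 hn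
    linarith
  -- With `u = Q y h / Q x h`, the logarithm lies between `1 - u⁻¹` and `u - 1`. These have the same
  -- first order term and differ by a multiple of `(Q y h - Q x h) ^ 2`.
  · have hlog : Real.log (Q y h) - Real.log (Q x h) = Real.log (Q y h / Q x h) :=
      (Real.log_div hy0.ne' hx0.ne').symm
    have hr : 0 < Q y h / Q x h := div_pos hy0 hx0
    have u1 := Real.log_le_sub_one_of_pos hr
    have u2 := Real.one_sub_inv_le_log_of_pos hr
    have v1 : Q y h / Q x h - 1 = (Q x h)⁻¹ * (Q y h - Q x h) := by field_simp
    have v2 : 1 - (Q y h / Q x h)⁻¹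
        = (Q x h)⁻¹ * (Q y h - Q x h) - (Q x h)⁻¹ * (Q y h)⁻¹ * (Q y h - Q x h) ^ 2 := by
      field_simp; ring
    rw [v1] at u1
    rw [v2] at u2
    have s1 : (Q y h - Q x h) ^ 2 ≤ (B * p * ‖y - x‖) ^ 2 := by
      rw [← sq_abs]; gcongr
    have s2 : (Q x h)⁻¹ * (Q y h)⁻¹ * (Q y h - Q x h) ^ 2
        ≤ c⁻¹ * c⁻¹ * (B * p * ‖y - x‖) ^ 2 := by gcongr
    have s3 : |(Q x h)⁻¹ * (Q y h - Q x h - _root_.partialDeriv Q x h (y - x))|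
        ≤ c⁻¹ * (B * p * ‖y - x‖ ^ 2) := by
      rw [abs_mul, abs_of_pos hix0]; gcongr
    have s4 := mul_le_mul_of_nonneg_right k3 (sq_nonneg ‖y - x‖)
    rw [abs_le] at s3
    have hsm : ((Q x h)⁻¹ • _root_.partialDeriv Q x h) (y - x)
        = (Q x h)⁻¹ * _root_.partialDeriv Q x h (y - x) := rfl
    have tot2 : (B + c⁻¹ + B * c⁻¹ + B ^ 2 * c⁻¹ ^ 2) * p ^ 2 * ‖y - x‖ ^ 2
        = B * p ^ 2 * ‖y - x‖ ^ 2 + c⁻¹ * p ^ 2 * ‖y - x‖ ^ 2 + B * c⁻¹ * p ^ 2 * ‖y - x‖ ^ 2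
          + c⁻¹ * c⁻¹ * (B * p * ‖y - x‖) ^ 2 := by ring
    have s5 : c⁻¹ * (B * p * ‖y - x‖ ^ 2) = B * p * c⁻¹ * ‖y - x‖ ^ 2 := by ring
    have s6 : (Q x h)⁻¹ * (Q y h - Q x h - _root_.partialDeriv Q x h (y - x))
        = (Q x h)⁻¹ * (Q y h - Q x h) - (Q x h)⁻¹ * _root_.partialDeriv Q x h (y - x) :=
      mul_sub _ _ _
    rw [s6] at s3
    rw [hsm, hlog, tot2, abs_le]
    have hn2 := sq_nonneg ‖y - x‖
    have := mul_nonneg pos1 hn2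
    have := mul_nonneg pos2 hn2
    have : 0 ≤ (Q x h)⁻¹ * (Q y h)⁻¹ * (Q y h - Q x h) ^ 2 := by positivity
    constructor <;> linarith

end QuadraticParameter

/-- On `X`, the sample functions `ψ (·, h)` have the gradients `g (·, h)`, and the values, the
gradients, their Lipschitz constants and the Taylor remainders are bounded by `L h`. -/
structure RegularSample {E F : Type*} [NormedAddCommGroup E] [InnerProductSpace ℝ E]
    [MeasurableSpace E] [MeasurableSpace F] (X : Set E) (ψ : E → F → ℝ) (g : E → F → E)
    (L : F → ℝ) : Prop where
  measurable_fun : Measurable (Function.uncurry ψ)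
  measurable_grad : Measurable (Function.uncurry g)
  abs_le : ∀ x ∈ X, ∀ h, |ψ x h| ≤ L h
  norm_grad_le : ∀ x ∈ X, ∀ h, ‖g x h‖ ≤ L h
  grad_lipschitz : ∀ x ∈ X, ∀ y ∈ X, ∀ h, ‖g y h - g x h‖ ≤ L h * ‖y - x‖
  taylor : ∀ x ∈ X, ∀ y ∈ X, ∀ h, |ψ y h - ψ x h - inner ℝ (g x h) (y - x)| ≤ L h * ‖y - x‖ ^ 2

/-! ### Logarithms of quotients. -/

section LogRatio

variable {E F : Type*} [NormedAddCommGroup E] [InnerProductSpace ℝ E] [FiniteDimensional ℝ E]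
  [NormedAddCommGroup F] [NormedSpace ℝ F]

/-- The gradient of `log (Q₂ / Q₁)` with respect to the first argument. -/
def logRatioGrad (Q₁ Q₂ : E → F → ℝ) (x : E) (h : F) : E :=
  (InnerProductSpace.toDual ℝ E).symm
    ((Q₂ x h)⁻¹ • partialDeriv Q₂ x h - (Q₁ x h)⁻¹ • partialDeriv Q₁ x h)

theorem hasGradientAt_logRatio {Q₁ Q₂ : E → F → ℝ} (hd₁ : ContDiff ℝ 2 (Function.uncurry Q₁))
    (hd₂ : ContDiff ℝ 2 (Function.uncurry Q₂)) (γ : ℝ) {x : E} {h : F} (h₁ : Q₁ x h ≠ 0)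
    (h₂ : Q₂ x h ≠ 0) :
    HasGradientAt (fun y => γ - (Real.log (Q₁ y h) - Real.log (Q₂ y h)))
      (logRatioGrad Q₁ Q₂ x h) x := by
  rw [hasGradientAt_iff_hasFDerivAt, logRatioGrad, LinearIsometryEquiv.apply_symm_apply]
  have a₁ := (hasFDerivAt_partialDeriv (hd₁.differentiable_left (by norm_num) h) x).log h₁
  have a₂ := (hasFDerivAt_partialDeriv (hd₂.differentiable_left (by norm_num) h) x).log h₂
  have := (a₁.sub a₂).const_sub γ
  rwa [neg_sub] at this

theorem exists_regularSample_logRatio [FiniteDimensional ℝ F] [MeasurableSpace E] [BorelSpace E]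
    [MeasurableSpace F] [BorelSpace F] {Q₁ Q₂ : E → F → ℝ}
    (hq₁ : QuadraticIn Q₁) (hd₁ : ContDiff ℝ 2 (Function.uncurry Q₁)) (hq₂ : QuadraticIn Q₂)
    (hd₂ : ContDiff ℝ 2 (Function.uncurry Q₂)) (γ R : ℝ) {c : ℝ} (hc : 0 < c) {X : Set E}
    (hX : ∀ x ∈ X, ‖x‖ ≤ R) (hX₁ : ∀ x ∈ X, ∀ h, c ≤ Q₁ x h) (hX₂ : ∀ x ∈ X, ∀ h, c ≤ Q₂ x h) :
    ∃ B : ℝ, 0 ≤ B ∧ RegularSample X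
      (fun x h => γ - (Real.log (Q₁ x h) - Real.log (Q₂ x h))) (logRatioGrad Q₁ Q₂)
      (fun h => B * (1 + ‖h‖) ^ 4) := by
  obtain ⟨A₁, hA₁, e₁⟩ := hq₁.exists_log_estimates hd₁ R hc
  obtain ⟨A₂, hA₂, e₂⟩ := hq₂.exists_log_estimates hd₂ R hc
  have hp : ∀ h : F, 1 ≤ (1 + ‖h‖) ^ 4 := fun h => one_le_pow₀ (by linarith [norm_nonneg h])
  have hB : ∀ h : F, (|γ| + A₁ + A₂) * (1 + ‖h‖) ^ 4
      = |γ| * (1 + ‖h‖) ^ 4 + A₁ * (1 + ‖h‖) ^ 4 + A₂ * (1 + ‖h‖) ^ 4 := fun h => by ring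
  have hγ : ∀ h : F, |γ| ≤ |γ| * (1 + ‖h‖) ^ 4 := fun h =>
    le_mul_of_one_le_right (abs_nonneg _) (hp h)
  refine ⟨|γ| + A₁ + A₂, by positivity, ?_, ?_, ?_, ?_, ?_, ?_⟩
  · exact measurable_const.sub ((Real.measurable_log.comp hd₁.continuous.measurable).sub
      (Real.measurable_log.comp hd₂.continuous.measurable))
  · refine ((InnerProductSpace.toDual ℝ E).symm.continuous.measurable).comp (Measurable.sub ?_ ?_)
    · exact (hd₂.continuous.measurable.inv).smul
        (contDiff_partialDeriv hd₂ (n := 1) (by norm_num)).continuous.measurable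
    · exact (hd₁.continuous.measurable.inv).smul
        (contDiff_partialDeriv hd₁ (n := 1) (by norm_num)).continuous.measurable
  · intro x hx h
    have a := (e₁ h x x (hX x hx) (hX x hx) (hX₁ x hx h) (hX₁ x hx h)).1
    have b := (e₂ h x x (hX x hx) (hX x hx) (hX₂ x hx h) (hX₂ x hx h)).1
    have hh := hγ h
    rw [hB]
    rw [abs_le] at a b ⊢
    have := abs_le.1 (le_refl |γ|)
    constructor <;> linarith
  · intro x hx h
    have a := (e₁ h x x (hX x hx) (hX x hx) (hX₁ x hx h) (hX₁ x hx h)).2.1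
    have b := (e₂ h x x (hX x hx) (hX x hx) (hX₂ x hx h) (hX₂ x hx h)).2.1
    have hh := hγ h
    rw [hB, logRatioGrad, LinearIsometryEquiv.norm_map]
    refine (norm_sub_le _ _).trans ?_
    linarith [abs_nonneg γ]
  · intro x hx y hy h
    have a := (e₁ h x y (hX x hx) (hX y hy) (hX₁ x hx h) (hX₁ y hy h)).2.2.1
    have b := (e₂ h x y (hX x hx) (hX y hy) (hX₂ x hx h) (hX₂ y hy h)).2.2.1
    have hh := mul_nonneg ((abs_nonneg γ).trans (hγ h)) (norm_nonneg (y - x))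
    rw [hB, logRatioGrad, logRatioGrad, ← map_sub, LinearIsometryEquiv.norm_map,
      sub_sub_sub_comm]
    refine (norm_sub_le _ _).trans ?_
    linarith
  · intro x hx y hy h
    have a := (e₁ h x y (hX x hx) (hX y hy) (hX₁ x hx h) (hX₁ y hy h)).2.2.2
    have b := (e₂ h x y (hX x hx) (hX y hy) (hX₂ x hx h) (hX₂ y hy h)).2.2.2
    have hh := mul_nonneg ((abs_nonneg γ).trans (hγ h)) (sq_nonneg ‖y - x‖)
    rw [hB, logRatioGrad, InnerProductSpace.toDual_symm_apply, sub_apply]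
    rw [abs_le] at a b ⊢
    constructor <;> linarith

end LogRatio

namespace RSSCA
variable {M K S N : ℕ}

/-! ### Smoothness and positivity of the impairment -/

namespace Uplink
variable (sys : Uplink M K S N)

/-- The squared modulus of the `s`-th entry of `V w_k`. -/
def digitalGain (k : Fin K) (x : Var K S N) (s : Fin S) : ℝ := ‖digitalRow x k s‖ ^ 2

/-- The squared modulus of the `s`-th entry of `Uᴴ h_i`. -/
def rfGain (x : Var K S N) (h : Channel M K) (i : Fin K) (s : Fin S) : ℝ :=
  ‖∑ m, (starRingEnd ℂ) (sys.rfCombiner x m s) * h m i‖ ^ 2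

/-- The part of the impairment that does not depend on the channel. -/
def noisePart (k : Fin K) (x : Var K S N) : ℝ :=
  sys.noiseVar * (∑ m, ‖sys.combinerRow x k m‖ ^ 2)
    + ∑ s, (1 - sys.quantError) * sys.quantError * digitalGain k x s
        * (sys.noiseVar * ∑ m, ‖sys.rfCombiner x m s‖ ^ 2)

/-- The part of the impairment that is quadratic in the channel. -/
def channelPart (k : Fin K) (x : Var K S N) (h : Channel M K) : ℝ :=
  (∑ i ∈ Finset.univ.erase k, power x i * sys.linkGain x h k i)
    + ∑ s, (1 - sys.quantError) * sys.quantError * digitalGain k x s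
        * ∑ i, power x i * sys.rfGain x h i s

theorem digitalRow_eq (x : Var K S N) (k : Fin K) :
    digitalRow x k = star (baseband x *ᵥ beam x k) := by
  rw [digitalRow, Matrix.star_mulVec]

/-- The gain matrix is scalar, so the covariance is a real diagonal matrix, and its entries are
nonnegative for nonnegative powers. This makes both the sign and the quadratic dependence on the
channel visible. -/
theorem quantCov_eq (x : Var K S N) (h : Channel M K) :
    sys.quantCov x h = Matrix.diagonal fun s =>
      (((1 - sys.quantError) * sys.quantError * ((∑ i, power x i * sys.rfGain x h i s)
        + sys.noiseVar * ∑ m, ‖sys.rfCombiner x m s‖ ^ 2) : ℝ) : ℂ) := by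
  have hd : ∀ s, Matrix.diag ((sys.rfCombiner x)ᴴ * (Matrix.of h : Matrix (Fin M) (Fin K) ℂ)
      * (Matrix.diagonal fun k => (power x k : ℂ)) * (Matrix.of h : Matrix (Fin M) (Fin K) ℂ)ᴴ
      * sys.rfCombiner x + (sys.noiseVar : ℂ) • ((sys.rfCombiner x)ᴴ * sys.rfCombiner x)) s
      = (((∑ i, power x i * sys.rfGain x h i s)
        + sys.noiseVar * ∑ m, ‖sys.rfCombiner x m s‖ ^ 2 : ℝ) : ℂ) := by
    intro s
    set A : Matrix (Fin S) (Fin K) ℂ :=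
      (sys.rfCombiner x)ᴴ * (Matrix.of h : Matrix (Fin M) (Fin K) ℂ) with hA
    have e : (Matrix.of h : Matrix (Fin M) (Fin K) ℂ)ᴴ * sys.rfCombiner x = Aᴴ := by
      rw [hA, Matrix.conjTranspose_mul, Matrix.conjTranspose_conjTranspose]
    rw [Matrix.mul_assoc (A * _), e, Matrix.diag_apply, Matrix.add_apply, Matrix.smul_apply,
      Matrix.mul_apply, Matrix.mul_apply, smul_eq_mul]
    push_cast
    congr 1
    · refine Finset.sum_congr rfl fun i _ => ?_
      rw [Matrix.mul_diagonal, Matrix.conjTranspose_apply, rfGain]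
      have : A s i = ∑ m, (starRingEnd ℂ) (sys.rfCombiner x m s) * h m i := by
        rw [hA, Matrix.mul_apply]; rfl
      rw [this, Complex.ofReal_pow, ← Complex.mul_conj']
      simp only [RCLike.star_def]
      ring
    · congr 1
      refine Finset.sum_congr rfl fun m _ => ?_
      rw [Matrix.conjTranspose_apply, ← Complex.conj_mul']
      rfl
  unfold quantCov gainMatrix
  simp only
  rw [← Matrix.diagonal_one, Matrix.diagonal_sub, Matrix.diagonal_mul_diagonal,
    Matrix.diagonal_mul_diagonal]
  congr 1
  funext s
  rw [hd]
  push_cast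
  ring

theorem impairment_eq (k : Fin K) (x : Var K S N) (h : Channel M K) :
    sys.impairment k x h = sys.noisePart k x + sys.channelPart k x h := by
  have hq : (digitalRow x k ⬝ᵥ (sys.quantCov x h *ᵥ (baseband x *ᵥ beam x k))).re
      = ∑ s, (1 - sys.quantError) * sys.quantError * digitalGain k x s
          * ((∑ i, power x i * sys.rfGain x h i s)
        + sys.noiseVar * ∑ m, ‖sys.rfCombiner x m s‖ ^ 2) := by
    have hv : baseband x *ᵥ beam x k = star (digitalRow x k) := by
      rw [digitalRow_eq, star_star]
    rw [quantCov_eq, hv, dotProduct, Complex.re_sum]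
    refine Finset.sum_congr rfl fun s _ => ?_
    rw [Matrix.mulVec_diagonal, Pi.star_apply, mul_left_comm, Complex.re_ofReal_mul,
      RCLike.star_def, Complex.mul_conj', ← Complex.ofReal_pow, Complex.ofReal_re, digitalGain]
    ring
  rw [impairment, hq, noisePart, channelPart]
  simp only [mul_add, Finset.sum_add_distrib]
  ring

theorem channelPart_smul (k : Fin K) (x : Var K S N) (h : Channel M K) (t : ℝ) :
    sys.channelPart k x (t • h) = t ^ 2 * sys.channelPart k x h := by
  have e1 : ∀ i, sys.linkGain x (t • h) k i = t ^ 2 * sys.linkGain x h k i := fun i => by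
    have : (fun m => (t • h) m i) = t • fun m => h m i := rfl
    rw [linkGain, linkGain, this, dotProduct_smul, norm_smul, mul_pow, Real.norm_eq_abs, sq_abs]
  have e2 : ∀ i s, sys.rfGain x (t • h) i s = t ^ 2 * sys.rfGain x h i s := fun i s => by
    have : ∀ m, (starRingEnd ℂ) (sys.rfCombiner x m s) * (t • h) m i
        = t • ((starRingEnd ℂ) (sys.rfCombiner x m s) * h m i) := fun m => by
      rw [Pi.smul_apply, Pi.smul_apply, mul_smul_comm]
    rw [rfGain, rfGain, Finset.sum_congr rfl fun m _ => this m, ← Finset.smul_sum, norm_smul,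
      mul_pow, Real.norm_eq_abs, sq_abs]
  rw [channelPart, channelPart, mul_add, Finset.mul_sum, Finset.mul_sum]
  congr 1
  · exact Finset.sum_congr rfl fun i _ => by rw [e1]; ring
  · refine Finset.sum_congr rfl fun s _ => ?_
    rw [Finset.sum_congr rfl fun i _ => by rw [e2, mul_left_comm], ← Finset.mul_sum]
    ring

theorem linkGain_smul (x : Var K S N) (h : Channel M K) (t : ℝ) (k i : Fin K) :
    sys.linkGain x (t • h) k i = t ^ 2 * sys.linkGain x h k i := by
  have : (fun m => (t • h) m i) = t • fun m => h m i := rfl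
  rw [linkGain, linkGain, this, dotProduct_smul, norm_smul, mul_pow, Real.norm_eq_abs, sq_abs]

/-- The power of the signal, the interference and the noise of user `k`. -/
def receivedPower (k : Fin K) (x : Var K S N) (h : Channel M K) : ℝ :=
  sys.impairment k x h + power x k * sys.linkGain x h k k

theorem quadraticIn_impairment (k : Fin K) : QuadraticIn (sys.impairment k) := by
  intro x h t
  have h0 : sys.channelPart k x 0 = 0 := by
    simpa using sys.channelPart_smul k x 0 0
  simp only [impairment_eq, channelPart_smul, h0, smul_eq_mul]
  ring

theorem quadraticIn_receivedPower (k : Fin K) : QuadraticIn (sys.receivedPower k) := by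
  intro x h t
  have h0 : sys.linkGain x 0 k k = 0 := by
    simpa using sys.linkGain_smul x 0 0 k k
  simp only [receivedPower, sys.quadraticIn_impairment k x h t, linkGain_smul, h0, smul_eq_mul]
  ring

/-- For nonnegative powers every channel term is nonnegative, so positivity of the pure noise bounds
the denominator below for all channels at once. Hence no channel makes the logarithms or their
derivatives singular. -/
theorem impairment_zero_le {k : Fin K} {x : Var K S N} (hx : x ∈ physical K S N)
    (h : Channel M K) : sys.impairment k x 0 ≤ sys.impairment k x h := by
  have h0 : sys.channelPart k x 0 = 0 := by
    simpa using sys.channelPart_smul k x 0 0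
  rw [impairment_eq, impairment_eq, h0]
  have hq := sys.quantError_nonneg
  have hq' : 0 ≤ 1 - sys.quantError := by linarith [sys.quantError_lt_one]
  have : 0 ≤ sys.channelPart k x h := by
    refine add_nonneg (Finset.sum_nonneg fun i _ => mul_nonneg (hx i) (sq_nonneg _))
      (Finset.sum_nonneg fun s _ => mul_nonneg (mul_nonneg (mul_nonneg hq' hq) (sq_nonneg _))
        (Finset.sum_nonneg fun i _ => mul_nonneg (hx i) (sq_nonneg _)))
  linarith

theorem impairment_le_receivedPower {k : Fin K} {x : Var K S N} (hx : x ∈ physical K S N)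
    (h : Channel M K) : sys.impairment k x h ≤ sys.receivedPower k x h :=
  le_add_of_nonneg_right (mul_nonneg (hx k) (sq_nonneg _))

theorem contDiff_coord (c : Coord K S N) {n : WithTop ℕ∞} :
    ContDiff ℝ n fun z : Var K S N × Channel M K => z.1 c :=
  (EuclideanSpace.proj (𝕜 := ℝ) c : Var K S N →L[ℝ] ℝ).contDiff.comp contDiff_fst

theorem contDiff_complex_mk {E : Type*} [NormedAddCommGroup E] [NormedSpace ℝ E]
    {n : WithTop ℕ∞} {f g : E → ℝ} (hf : ContDiff ℝ n f) (hg : ContDiff ℝ n g) :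
    ContDiff ℝ n fun z => (⟨f z, g z⟩ : ℂ) := by
  have : (fun z => (⟨f z, g z⟩ : ℂ)) = fun z => (f z : ℂ) + (g z : ℂ) * Complex.I :=
    funext fun z => Complex.mk_eq_add_mul_I _ _
  rw [this]
  exact (Complex.ofRealCLM.contDiff.comp hf).add
    ((Complex.ofRealCLM.contDiff.comp hg).mul contDiff_const)

theorem contDiff_conj {E : Type*} [NormedAddCommGroup E] [NormedSpace ℝ E]
    {n : WithTop ℕ∞} {f : E → ℂ} (hf : ContDiff ℝ n f) :
    ContDiff ℝ n fun z => (starRingEnd ℂ) (f z) :=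
  Complex.conjCLE.contDiff.comp hf

theorem contDiff_rfCombiner (m : Fin M) (s : Fin S) {n : WithTop ℕ∞} :
    ContDiff ℝ n fun z : Var K S N × Channel M K => sys.rfCombiner z.1 m s := by
  simp only [rfCombiner, Matrix.mul_apply]
  exact ContDiff.sum fun i _ => contDiff_const.mul
    (Complex.ofRealCLM.contDiff.comp (contDiff_coord _))

theorem contDiff_digitalRow (k : Fin K) (s : Fin S) {n : WithTop ℕ∞} :
    ContDiff ℝ n fun z : Var K S N × Channel M K => digitalRow z.1 k s := by
  simp only [digitalRow_eq, Pi.star_apply, Matrix.mulVec, dotProduct]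
  refine contDiff_conj (ContDiff.sum fun t _ => ContDiff.mul ?_ ?_)
  · exact contDiff_complex_mk (contDiff_coord _) (contDiff_coord _)
  · exact contDiff_complex_mk (contDiff_coord _) (contDiff_coord _)

theorem contDiff_combinerRow (k : Fin K) (m : Fin M) {n : WithTop ℕ∞} :
    ContDiff ℝ n fun z : Var K S N × Channel M K => sys.combinerRow z.1 k m := by
  simp only [combinerRow, gainMatrix, Matrix.vecMul, dotProduct, Matrix.diagonal_mul,
    Matrix.conjTranspose_apply]
  exact ContDiff.sum fun s _ => (contDiff_digitalRow k s).mul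
    (contDiff_const.mul (contDiff_conj (sys.contDiff_rfCombiner m s)))

theorem contDiff_channel (m : Fin M) (i : Fin K) {n : WithTop ℕ∞} :
    ContDiff ℝ n fun z : Var K S N × Channel M K => z.2 m i :=
  (contDiff_apply_apply ℝ ℂ m i).comp contDiff_snd

theorem contDiff_linkGain (k i : Fin K) {n : WithTop ℕ∞} :
    ContDiff ℝ n fun z : Var K S N × Channel M K => sys.linkGain z.1 z.2 k i := by
  simp only [linkGain, dotProduct]
  exact (ContDiff.sum fun m _ =>
    (sys.contDiff_combinerRow k m).mul (contDiff_channel m i)).norm_sq ℝ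

theorem contDiff_impairment (k : Fin K) {n : WithTop ℕ∞} :
    ContDiff ℝ n (Function.uncurry (sys.impairment k)) := by
  have e : Function.uncurry (sys.impairment k) = fun z : Var K S N × Channel M K =>
      sys.noisePart k z.1 + sys.channelPart k z.1 z.2 :=
    funext fun z => sys.impairment_eq k z.1 z.2
  rw [e]
  have hg : ∀ s, ContDiff ℝ n fun z : Var K S N × Channel M K => digitalGain k z.1 s :=
    fun s => (contDiff_digitalRow k s).norm_sq ℝ
  refine ContDiff.add (ContDiff.add ?_ ?_) (ContDiff.add ?_ ?_)
  · exact contDiff_const.mul (ContDiff.sum fun m _ => (sys.contDiff_combinerRow k m).norm_sq ℝ)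
  · exact ContDiff.sum fun s _ => (contDiff_const.mul (hg s)).mul
      (contDiff_const.mul (ContDiff.sum fun m _ => (sys.contDiff_rfCombiner m s).norm_sq ℝ))
  · exact ContDiff.sum fun i _ => (contDiff_coord _).mul (sys.contDiff_linkGain k i)
  · refine ContDiff.sum fun s _ => (contDiff_const.mul (hg s)).mul
      (ContDiff.sum fun i _ => (contDiff_coord _).mul (ContDiff.norm_sq ℝ ?_))
    exact ContDiff.sum fun m _ => (contDiff_conj (sys.contDiff_rfCombiner m s)).mul
      (contDiff_channel m i)

theorem contDiff_receivedPower (k : Fin K) {n : WithTop ℕ∞} :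
    ContDiff ℝ n (Function.uncurry (sys.receivedPower k)) :=
  (sys.contDiff_impairment k).add ((contDiff_coord _).mul (sys.contDiff_linkGain k k))

/-! ### The instantaneous rates -/

/-- The gradient of `γ_k - r_k` at points where the rate is well defined. -/
def rateGrad (k : Fin K) : Var K S N → Channel M K → Var K S N :=
  logRatioGrad (sys.receivedPower k) (sys.impairment k)

/-- The function `γ_k - r_k`, extended measurably. -/
def sampleConstr (k : Fin K) (x : Var K S N) (h : Channel M K) : ℝ :=
  sys.targetRate k - (Real.log (sys.receivedPower k x h) - Real.log (sys.impairment k x h))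

/-- The bounded part of the physical variables where the noise is bounded below. -/
def regularPart (n : ℕ) : Set (Var K S N) :=
  {x | x ∈ physical K S N ∧ ‖x‖ ≤ n ∧ ∀ k, ((n : ℝ) + 1)⁻¹ ≤ sys.impairment k x 0}

/-- The passage from the SINR to two polynomials, to which the estimates for logarithms apply
separately. -/
theorem rate_eq {k : Fin K} {x : Var K S N} {h : Channel M K} (h₁ : sys.impairment k x h ≠ 0)
    (h₂ : sys.receivedPower k x h ≠ 0) :
    sys.rate k x h = Real.log (sys.receivedPower k x h) - Real.log (sys.impairment k x h) := by
  rw [rate, sinr, one_add_div h₁, ← receivedPower, Real.log_div h₂ h₁]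

theorem sampleConstr_eq {k : Fin K} {x : Var K S N} (hx : x ∈ physical K S N)
    (hr : x ∈ sys.regular) (h : Channel M K) :
    sys.sampleConstr k x h = sys.targetRate k - sys.rate k x h := by
  have h₁ : 0 < sys.impairment k x h := (hr k).trans_le (sys.impairment_zero_le hx h)
  have h₂ := h₁.trans_le (sys.impairment_le_receivedPower hx h)
  rw [sampleConstr, rate_eq sys h₁.ne' h₂.ne']

/-- A full gradient exists even where powers vanish: both polynomials are positive at `x` for the
given channel, hence nonzero on a whole neighbourhood, which may depend on the channel. -/
theorem gradient_sample {k : Fin K} {x : Var K S N} (hx : x ∈ physical K S N)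
    (hr : x ∈ sys.regular) (h : Channel M K) :
    gradient (fun y => sys.targetRate k - sys.rate k y h) x = sys.rateGrad k x h := by
  have h₁ : 0 < sys.impairment k x h := (hr k).trans_le (sys.impairment_zero_le hx h)
  have h₂ := h₁.trans_le (sys.impairment_le_receivedPower hx h)
  have hg := hasGradientAt_logRatio (sys.contDiff_receivedPower k) (sys.contDiff_impairment k)
    (sys.targetRate k) h₂.ne' h₁.ne'
  refine HasGradientAt.gradient (hg.congr_of_eventuallyEq ?_)
  have c₁ : Continuous fun y => sys.impairment k y h :=
    ((sys.contDiff_impairment k (n := 2)).differentiable_left (by norm_num) h).continuous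
  have c₂ : Continuous fun y => sys.receivedPower k y h :=
    ((sys.contDiff_receivedPower k (n := 2)).differentiable_left (by norm_num) h).continuous
  filter_upwards [c₁.continuousAt.eventually_ne h₁.ne', c₂.continuousAt.eventually_ne h₂.ne']
    with y hy₁ hy₂
  rw [rate_eq sys hy₁ hy₂]

theorem regularPart_subset_regular (n : ℕ) : sys.regularPart n ⊆ sys.regular := fun _ hx k =>
  lt_of_lt_of_le (by positivity) (hx.2.2 k)

theorem continuous_impairment_zero (k : Fin K) : Continuous fun x => sys.impairment k x 0 :=
  ((sys.contDiff_impairment k (n := 2)).differentiable_left (by norm_num) 0).continuous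

theorem isClosed_physical : IsClosed (physical K S N) := by
  have : physical K S N = ⋂ k, {x | 0 ≤ power x k} := by ext x; simp [physical]
  rw [this]
  exact isClosed_iInter fun k => isClosed_le continuous_const
    ((EuclideanSpace.proj (𝕜 := ℝ) (Sum.inl k) : Var K S N →L[ℝ] ℝ).continuous)

theorem isClosed_regularPart (n : ℕ) : IsClosed (sys.regularPart n) := by
  have : sys.regularPart n = physical K S N ∩ ({x | ‖x‖ ≤ n} ∩
      ⋂ k, {x | ((n : ℝ) + 1)⁻¹ ≤ sys.impairment k x 0}) := by
    ext x; simp only [regularPart, Set.mem_ofPred_eq, Set.mem_inter_iff, Set.mem_iInter]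
  rw [this]
  exact isClosed_physical.inter ((isClosed_le continuous_norm continuous_const).inter
    (isClosed_iInter fun k => isClosed_le continuous_const (sys.continuous_impairment_zero k)))

theorem exists_regularSample (k : Fin K) (n : ℕ) :
    ∃ B : ℝ, 0 ≤ B ∧ RegularSample (sys.regularPart n) (sys.sampleConstr k) (sys.rateGrad k)
      (fun h => B * (1 + ‖h‖) ^ 4) :=
  exists_regularSample_logRatio (sys.quadraticIn_receivedPower k) (sys.contDiff_receivedPower k)
    (sys.quadraticIn_impairment k) (sys.contDiff_impairment k) (sys.targetRate k) n
    (by positivity : (0 : ℝ) < ((n : ℝ) + 1)⁻¹) (fun x hx => hx.2.1)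
    (fun x hx h => (hx.2.2 k).trans ((sys.impairment_zero_le hx.1 h).trans
      (sys.impairment_le_receivedPower hx.1 h)))
    (fun x hx h => (hx.2.2 k).trans (sys.impairment_zero_le hx.1 h))

end Uplink
end RSSCA

/-! ### Independent samples and predictable sequences -/

section Samples

variable {Ω F 𝒴 : Type*} [mΩ : MeasurableSpace Ω] [MeasurableSpace F] [MeasurableSpace 𝒴]

/-- The information contained in the first `l` samples. -/
@[reducible]
def past (H : ℕ → Ω → F) (l : ℕ) : MeasurableSpace Ω :=
  ⨆ i : Fin l, MeasurableSpace.comap (H i) inferInstance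

omit mΩ in
theorem measurable_past (H : ℕ → Ω → F) {i l : ℕ} (hi : i < l) : Measurable[past H l] (H i) :=
  (comap_measurable (H i)).mono (le_iSup (fun j : Fin l =>
    MeasurableSpace.comap (H j) inferInstance) ⟨i, hi⟩) le_rfl

omit mΩ in
theorem past_mono (H : ℕ → Ω → F) : Monotone (past H) := fun _ _ hmn =>
  iSup_le fun i => (measurable_past H (i.2.trans_le hmn)).comap_le

theorem past_le {H : ℕ → Ω → F} (hH : ∀ l, Measurable (H l)) (l : ℕ) : past H l ≤ mΩ :=
  iSup_le fun i => (hH i).comap_le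

/-- The filtration generated by the samples. -/
def pastFiltration (H : ℕ → Ω → F) (hH : ∀ l, Measurable (H l)) : Filtration ℕ mΩ where
  seq := past H
  mono' := past_mono H
  le' := past_le hH

variable {μ : Measure Ω} [IsProbabilityMeasure μ] {ν : Measure F} {H : ℕ → Ω → F}

/-- The samples are independent with law `ν`. -/
structure IsSampling (μ : Measure Ω) (ν : Measure F) (H : ℕ → Ω → F) : Prop where
  measurable : ∀ l, Measurable (H l)
  map_eq : ∀ l, μ.map (H l) = ν
  indep : iIndepFun H μ

namespace IsSampling

theorem isProbabilityMeasure (hs : IsSampling μ ν H) : IsProbabilityMeasure ν := by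
  rw [← hs.map_eq 0]
  exact Measure.isProbabilityMeasure_map (hs.measurable 0).aemeasurable

omit [IsProbabilityMeasure μ] in
theorem indepFun_past (hs : IsSampling μ ν H) {l : ℕ} {Y : Ω → 𝒴} (hY : Measurable[past H l] Y) :
    IndepFun Y (H l) μ := by
  have h := indep_iSup_of_disjoint (fun i => (hs.measurable i).comap_le) hs.indep
    (S := Set.Iio l) (T := {l}) (by simp)
  rw [IndepFun_iff_Indep]
  refine indep_of_indep_of_le_left (indep_of_indep_of_le_right h ?_) ?_
  · exact le_iSup₂_of_le l rfl le_rfl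
  · refine hY.comap_le.trans (iSup_le fun i => ?_)
    exact le_iSup₂_of_le (i : ℕ) i.2 le_rfl

omit [IsProbabilityMeasure μ] in
theorem integrable_comp {φ : F → ℝ} (hs : IsSampling μ ν H) (hφ : Integrable φ ν) (l : ℕ) :
    Integrable (fun ω => φ (H l ω)) μ := by
  rw [← hs.map_eq l] at hφ
  exact hφ.comp_measurable (hs.measurable l)

omit [IsProbabilityMeasure μ] in
theorem memLp_comp {φ : F → ℝ} {p : ENNReal} (hs : IsSampling μ ν H) (hφ : MemLp φ p ν) (l : ℕ) :
    MemLp (fun ω => φ (H l ω)) p μ := by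
  rw [← hs.map_eq l] at hφ
  exact hφ.comp_of_map (hs.measurable l).aemeasurable

omit [IsProbabilityMeasure μ] in
theorem integral_comp {φ : F → ℝ} (hs : IsSampling μ ν H) (hφ : AEStronglyMeasurable φ ν) (l : ℕ) :
    ∫ ω, φ (H l ω) ∂μ = ∫ h, φ h ∂ν := by
  rw [← hs.map_eq l] at hφ ⊢
  rw [integral_map (hs.measurable l).aemeasurable hφ]

/-- A centred function of the next sample is orthogonal to the past. -/
theorem integral_mul_eq_zero (hs : IsSampling μ ν H) {l : ℕ} {Z : Ω → ℝ} {Y : Ω → 𝒴}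
    (hZ : Measurable[past H l] Z) (hY : Measurable[past H l] Y) {ψ : 𝒴 → F → ℝ}
    (hψ : Measurable (Function.uncurry ψ)) (h0 : ∀ y, ∫ h, ψ y h ∂ν = 0)
    (hint : Integrable (fun ω => Z ω * ψ (Y ω) (H l ω)) μ) :
    ∫ ω, Z ω * ψ (Y ω) (H l ω) ∂μ = 0 := by
  have := hs.isProbabilityMeasure
  have hZY : Measurable[past H l] fun ω => (Z ω, Y ω) := hZ.prodMk hY
  have hZY' : Measurable fun ω => (Z ω, Y ω) := hZY.mono (past_le hs.measurable l) le_rfl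
  -- The pair known from the past is independent of the next sample, so the joint law is a product.
  -- By Fubini, the inner integral over the sample vanishes.
  have hmap := (hs.indepFun_past hZY).map_prod_eq_prod_map_map hZY'.aemeasurable
    (hs.measurable l).aemeasurable
  rw [hs.map_eq l] at hmap
  have hpair : Measurable fun ω => ((Z ω, Y ω), H l ω) := hZY'.prodMk (hs.measurable l)
  have := Measure.isProbabilityMeasure_map (μ := μ) hZY'.aemeasurable
  set Ψ : (ℝ × 𝒴) × F → ℝ := fun p => p.1.1 * ψ p.1.2 p.2 with hΨ
  have hΨm : Measurable Ψ := (measurable_fst.comp measurable_fst).mul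
    (hψ.comp ((measurable_snd.comp measurable_fst).prodMk measurable_snd))
  have hΨi : Integrable Ψ ((μ.map fun ω => (Z ω, Y ω)).prod ν) := by
    rw [← hmap, integrable_map_measure hΨm.aestronglyMeasurable hpair.aemeasurable]
    exact hint
  have e : ∫ ω, Z ω * ψ (Y ω) (H l ω) ∂μ = ∫ p, Ψ p ∂(μ.map fun ω => ((Z ω, Y ω), H l ω)) :=
    (integral_map hpair.aemeasurable hΨm.aestronglyMeasurable).symm
  rw [e, hmap, integral_prod Ψ hΨi]
  simp only [hΨ, integral_const_mul, h0, mul_zero, integral_zero]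

variable {Y : ℕ → Ω → 𝒴} {ψ : ℕ → 𝒴 → F → ℝ} {c : ℕ → ℝ} {L : F → ℝ}

omit mΩ [IsProbabilityMeasure μ] in
theorem measurable_increment {l : ℕ} {Y : Ω → 𝒴} {ψ : 𝒴 → F → ℝ} (hY : Measurable[past H l] Y)
    (hψ : Measurable (Function.uncurry ψ)) :
    Measurable[past H (l + 1)] fun ω => ψ (Y ω) (H l ω) :=
  hψ.comp ((hY.mono (past_mono H l.le_succ) le_rfl).prodMk (measurable_past H l.lt_succ_self))

omit [IsProbabilityMeasure μ] in
theorem memLp_increment (hs : IsSampling μ ν H) {l : ℕ} {Y : Ω → 𝒴} {ψ : 𝒴 → F → ℝ} {c : ℝ}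
    {p : ENNReal} (hY : Measurable[past H l] Y) (hψ : Measurable (Function.uncurry ψ))
    (hL : MemLp L p ν) (hb : ∀ y h, |ψ y h| ≤ c * L h) :
    MemLp (fun ω => ψ (Y ω) (H l ω)) p μ :=
  ((hs.memLp_comp hL l).const_mul c).mono'
    ((measurable_increment hY hψ).mono (past_le hs.measurable _) le_rfl).aestronglyMeasurable
    (Eventually.of_forall fun ω => hb (Y ω) (H l ω))

omit [IsProbabilityMeasure μ] in
theorem integral_increment_sq_le (hs : IsSampling μ ν H) {l : ℕ} {Y : Ω → 𝒴} {ψ : 𝒴 → F → ℝ}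
    {c : ℝ} (hY : Measurable[past H l] Y) (hψ : Measurable (Function.uncurry ψ))
    (hL : MemLp L 2 ν) (hb : ∀ y h, |ψ y h| ≤ c * L h) :
    ∫ ω, ψ (Y ω) (H l ω) ^ 2 ∂μ ≤ c ^ 2 * ∫ h, L h ^ 2 ∂ν := by
  have hi := (hs.memLp_increment hY hψ hL hb).integrable_sq
  rw [← hs.integral_comp (hL.integrable_sq.aestronglyMeasurable) l, ← integral_const_mul]
  refine integral_mono hi ((hs.integrable_comp hL.integrable_sq l).const_mul _) fun ω => ?_
  have := hb (Y ω) (H l ω)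
  simp only
  rw [← mul_pow, ← sq_abs]
  gcongr

/-- Pythagoras in `L²`: a centred increment is orthogonal to everything determined by the past. -/
theorem integral_sq_add_increment (hs : IsSampling μ ν H) {l : ℕ} {Z : Ω → ℝ} {Y : Ω → 𝒴}
    {ψ : 𝒴 → F → ℝ} (hZ : Measurable[past H l] Z) (hZL : MemLp Z 2 μ)
    (hY : Measurable[past H l] Y) (hψ : Measurable (Function.uncurry ψ))
    (h0 : ∀ y, ∫ h, ψ y h ∂ν = 0) (hψL : MemLp (fun ω => ψ (Y ω) (H l ω)) 2 μ) (a b : ℝ) :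
    ∫ ω, (a * Z ω + b * ψ (Y ω) (H l ω)) ^ 2 ∂μ
      = a ^ 2 * ∫ ω, Z ω ^ 2 ∂μ + b ^ 2 * ∫ ω, ψ (Y ω) (H l ω) ^ 2 ∂μ := by
  have hcross : Integrable (fun ω => Z ω * ψ (Y ω) (H l ω)) μ := hZL.integrable_mul hψL
  have e0 := hs.integral_mul_eq_zero hZ hY hψ h0 hcross
  have e : ∀ ω, (a * Z ω + b * ψ (Y ω) (H l ω)) ^ 2 = a ^ 2 * Z ω ^ 2
      + b ^ 2 * ψ (Y ω) (H l ω) ^ 2 + 2 * a * b * (Z ω * ψ (Y ω) (H l ω)) := fun ω => by ring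
  simp only [e]
  have hab : Integrable (fun ω => a ^ 2 * Z ω ^ 2 + b ^ 2 * ψ (Y ω) (H l ω) ^ 2) μ :=
    (hZL.integrable_sq.const_mul _).add (hψL.integrable_sq.const_mul _)
  rw [integral_add hab (hcross.const_mul _), integral_add (hZL.integrable_sq.const_mul _)
    (hψL.integrable_sq.const_mul _), integral_const_mul, integral_const_mul, integral_const_mul, e0]
  ring

/-- Sums of centred, square summable functions of the samples with predictable parameters
converge almost surely. -/
theorem ae_exists_tendsto_sum (hs : IsSampling μ ν H) (hY : ∀ l, Measurable[past H l] (Y l))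
    (hψ : ∀ l, Measurable (Function.uncurry (ψ l))) (h0 : ∀ l y, ∫ h, ψ l y h ∂ν = 0)
    (hc : Summable fun l => c l ^ 2) (hL : MemLp L 2 ν) (hb : ∀ l y h, |ψ l y h| ≤ c l * L h) :
    ∀ᵐ ω ∂μ, ∃ a, Tendsto (fun n => ∑ l ∈ Finset.range n, ψ l (Y l ω) (H l ω)) atTop (𝓝 a) := by
  set ξ : ℕ → Ω → ℝ := fun l ω => ψ l (Y l ω) (H l ω) with hξ
  set S : ℕ → Ω → ℝ := fun n ω => ∑ l ∈ Finset.range n, ξ l ω with hS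
  have hξm : ∀ l, Measurable[past H (l + 1)] (ξ l) := fun l => measurable_increment (hY l) (hψ l)
  have hξL : ∀ l, MemLp (ξ l) 2 μ := fun l => hs.memLp_increment (hY l) (hψ l) hL (hb l)
  have hSm : ∀ n, Measurable[past H n] (S n) := fun n =>
    Finset.measurable_sum (m := past H n) _ fun l hl =>
      (hξm l).mono (past_mono H (Finset.mem_range.1 hl)) le_rfl
  have hSL : ∀ n, MemLp (S n) 2 μ := fun n => memLp_finsetSum _ fun l _ => hξL l
  have hSsucc : ∀ n ω, S (n + 1) ω = S n ω + ξ n ω := fun n ω => Finset.sum_range_succ _ _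
  have hmart : Martingale S (pastFiltration H hs.measurable) μ := by
    refine martingale_of_setIntegral_eq_succ (fun n => (hSm n).stronglyMeasurable)
      (fun n => (hSL n).integrable one_le_two) fun n s hms => ?_
    have hms' := past_le hs.measurable n s hms
    have e : ∫ ω in s, ξ n ω ∂μ = 0 := by
      rw [← integral_indicator hms']
      have e' : ∀ ω, s.indicator (ξ n) ω = s.indicator (fun _ => (1 : ℝ)) ω * ξ n ω := fun ω => by
        by_cases h : ω ∈ s <;> simp [h]
      have hi : Integrable (s.indicator (ξ n)) μ :=
        ((hξL n).integrable one_le_two).indicator hms'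
      simp only [e']
      refine hs.integral_mul_eq_zero ?_ (hY n) (hψ n) (h0 n) (hi.congr (Eventually.of_forall e'))
      exact Measurable.indicator (m := past H n) measurable_const hms
    simp only [hSsucc]
    rw [integral_add ((hSL n).integrable one_le_two).integrableOn
      ((hξL n).integrable one_le_two).integrableOn, e, add_zero]
  set C : ℝ := ∫ h, L h ^ 2 ∂ν with hC
  have hC0 : 0 ≤ C := integral_nonneg fun h => sq_nonneg _
  have hSq : ∀ n, ∫ ω, S n ω ^ 2 ∂μ ≤ (∑ l ∈ Finset.range n, c l ^ 2) * C := by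
    intro n
    induction n with
    | zero => simp [hS]
    | succ n ih =>
      have e : ∫ ω, S (n + 1) ω ^ 2 ∂μ = ∫ ω, S n ω ^ 2 ∂μ + ∫ ω, ξ n ω ^ 2 ∂μ := by
        have := hs.integral_sq_add_increment (hSm n) (hSL n) (hY n) (hψ n) (h0 n) (hξL n) 1 1
        simpa only [one_mul, one_pow, hSsucc] using this
      rw [e, Finset.sum_range_succ, add_mul]
      have := hs.integral_increment_sq_le (hY n) (hψ n) hL (hb n)
      linarith
  -- The convergence theorem asks for a bound in `L¹`. It follows from the second moments through
  -- `|s| ≤ 1 + s ^ 2`.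
  have hbdd : ∀ n, eLpNorm (S n) 1 μ ≤ (Real.toNNReal (1 + (∑' l, c l ^ 2) * C) : NNReal) := by
    intro n
    have hi := (hSL n).integrable one_le_two
    rw [eLpNorm_one_eq_lintegral_enorm, ← ofReal_integral_norm_eq_lintegral_enorm hi]
    refine ENNReal.ofReal_le_ofReal ?_
    have h1 : ∫ ω, ‖S n ω‖ ∂μ ≤ ∫ ω, (1 + S n ω ^ 2) ∂μ := by
      refine integral_mono hi.norm ((integrable_const _).add (hSL n).integrable_sq) fun ω => ?_
      simp only [Real.norm_eq_abs]
      nlinarith [sq_abs (S n ω), sq_nonneg (|S n ω| - 1)]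
    have h2 : ∫ ω, (1 + S n ω ^ 2) ∂μ = 1 + ∫ ω, S n ω ^ 2 ∂μ := by
      rw [integral_add (integrable_const _) (hSL n).integrable_sq]; simp
    have h3 : (∑ l ∈ Finset.range n, c l ^ 2) * C ≤ (∑' l, c l ^ 2) * C :=
      mul_le_mul_of_nonneg_right (hc.sum_le_tsum _ fun _ _ => sq_nonneg _) hC0
    linarith [hSq n]
  exact hmart.submartingale.exists_ae_tendsto_of_bdd hbdd

end IsSampling

omit [IsProbabilityMeasure μ] in
-- Tonelli: a nonnegative series with finite expected sum is finite almost surely.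
theorem ae_summable_of_summable_integral {f : ℕ → Ω → ℝ} (h0 : ∀ l ω, 0 ≤ f l ω)
    (hi : ∀ l, Integrable (f l) μ) (hs : Summable fun l => ∫ ω, f l ω ∂μ) :
    ∀ᵐ ω ∂μ, Summable fun l => f l ω := by
  have hm : ∀ l, AEMeasurable (fun ω => ENNReal.ofReal (f l ω)) μ := fun l =>
    (hi l).aestronglyMeasurable.aemeasurable.ennreal_ofReal
  have hfin : ∫⁻ ω, ∑' l, ENNReal.ofReal (f l ω) ∂μ ≠ ⊤ := by
    rw [lintegral_tsum hm]
    simp_rw [← ofReal_integral_eq_lintegral_ofReal (hi _) (Eventually.of_forall (h0 _))]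
    exact hs.tsum_ofReal_ne_top
  filter_upwards [ae_lt_top' (AEMeasurable.tsum hm) hfin] with ω hω
  have := ENNReal.summable_toReal hω.ne
  simpa only [ENNReal.toReal_ofReal (h0 _ ω)] using this

end Samples

/-! ### Recursive averages -/

section Averages

theorem exists_sum_ge_of_tendsto {α : ℕ → ℝ}
    (hα : Tendsto (fun n => ∑ l ∈ Finset.range n, α l) atTop atTop) (m : ℕ) :
    Tendsto (fun n => ∑ l ∈ Finset.Ico m n, α l) atTop atTop := by
  have := tendsto_atTop_add_const_right _ (-∑ l ∈ Finset.range m, α l) hα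
  refine this.congr' ?_
  filter_upwards [eventually_ge_atTop m] with n hn
  rw [Finset.sum_Ico_eq_sub _ hn, sub_eq_add_neg]

/-- A recursive average of a sequence with nonpositive upper limit has nonpositive upper limit. -/
theorem eventually_le_of_recursive_average {α f w : ℕ → ℝ} (hα : ∀ l, 0 ≤ α l ∧ α l ≤ 1)
    (hsum : Tendsto (fun n => ∑ l ∈ Finset.range n, α l) atTop atTop)
    (hf : ∀ᶠ l in atTop, f (l + 1) ≤ (1 - α l) * f l + α l * w l)
    (hw : Tendsto w atTop (𝓝 0)) {ε : ℝ} (hε : 0 < ε) : ∀ᶠ l in atTop, f l ≤ ε := by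
  obtain ⟨m, hm⟩ := eventually_atTop.1 (hf.and (hw.eventually_le_const (half_pos hε)))
  set C := max (f m - ε / 2) 0 with hC
  have hC0 : 0 ≤ C := le_max_right _ _
  -- The excess over `ε / 2` contracts by `1 - α n ≤ exp (-α n)` in each step. The product of these
  -- factors vanishes because the weights have infinite sum.
  have key : ∀ n, m ≤ n → f n - ε / 2 ≤ C * Real.exp (-∑ l ∈ Finset.Ico m n, α l) := by
    intro n hn
    induction n, hn using Nat.le_induction with
    | base => simp [hC]
    | succ n hn ih =>
      obtain ⟨h1, h2⟩ := hm n hn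
      have hα0 := (hα n).1
      have hα1 : 0 ≤ 1 - α n := by linarith [(hα n).2]
      rw [Finset.sum_Ico_succ_top hn, neg_add, Real.exp_add, ← mul_assoc]
      have s1 : f (n + 1) - ε / 2 ≤ (1 - α n) * (f n - ε / 2) := by
        nlinarith [mul_le_mul_of_nonneg_left h2 hα0]
      have s2 : 1 - α n ≤ Real.exp (-α n) := by linarith [Real.add_one_le_exp (-α n)]
      have s3 : 0 ≤ C * Real.exp (-∑ l ∈ Finset.Ico m n, α l) := by positivity
      calc f (n + 1) - ε / 2 ≤ (1 - α n) * (f n - ε / 2) := s1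
        _ ≤ (1 - α n) * (C * Real.exp (-∑ l ∈ Finset.Ico m n, α l)) := by gcongr
        _ ≤ Real.exp (-α n) * (C * Real.exp (-∑ l ∈ Finset.Ico m n, α l)) := by gcongr
        _ = _ := mul_comm _ _
  have hlim : Tendsto (fun n => C * Real.exp (-∑ l ∈ Finset.Ico m n, α l)) atTop (𝓝 0) := by
    rw [← mul_zero C]
    exact (Real.tendsto_exp_neg_atTop_nhds_zero.comp (exists_sum_ge_of_tendsto hsum m)).const_mul C
  filter_upwards [hlim.eventually_le_const (half_pos hε), eventually_ge_atTop m] with n h1 h2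
  linarith [key n h2]

theorem tendsto_zero_of_recursive_average {α f w : ℕ → ℝ} (hα : ∀ l, 0 ≤ α l ∧ α l ≤ 1)
    (hsum : Tendsto (fun n => ∑ l ∈ Finset.range n, α l) atTop atTop)
    (hf0 : ∀ l, 0 ≤ f l) (hf : ∀ᶠ l in atTop, f (l + 1) ≤ (1 - α l) * f l + α l * w l)
    (hw : Tendsto w atTop (𝓝 0)) : Tendsto f atTop (𝓝 0) := by
  rw [Metric.tendsto_nhds]
  intro ε hε
  filter_upwards [eventually_le_of_recursive_average hα hsum hf hw (half_pos hε)] with l hl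
  rw [Real.dist_eq, sub_zero, abs_of_nonneg (hf0 l)]
  linarith

theorem tendsto_sum_range_shift {α : ℕ → ℝ}
    (hsum : Tendsto (fun n => ∑ l ∈ Finset.range n, α l) atTop atTop) :
    Tendsto (fun n => ∑ l ∈ Finset.range n, α (l + 1)) atTop atTop := by
  have := tendsto_atTop_add_const_right _ (-α 0) ((tendsto_add_atTop_iff_nat 1).2 hsum)
  refine this.congr fun n => ?_
  rw [Finset.sum_range_succ']
  ring

/-- The recursive average of a sequence with weights `β`, started from zero. -/
def recAverage {V : Type*} [AddCommGroup V] [Module ℝ V] (β : ℕ → ℝ) (n : ℕ → V) : ℕ → V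
  | 0 => β 0 • n 0
  | l + 1 => (1 - β (l + 1)) • recAverage β n l + β (l + 1) • n (l + 1)

/-- A Kronecker type argument. Subtracting the error `S (l + 1) - a` of the partial sums removes the
rough input, and the difference is a recursive average of a null sequence. -/
theorem tendsto_recAverage_of_tendsto_sum {β n : ℕ → ℝ} (hβ : ∀ l, 0 < β l ∧ β l ≤ 1)
    (hsum : Tendsto (fun n => ∑ l ∈ Finset.range n, β l) atTop atTop) {a : ℝ}
    (ha : Tendsto (fun m => ∑ l ∈ Finset.range m, β l * n l) atTop (𝓝 a)) :
    Tendsto (recAverage β n) atTop (𝓝 0) := by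
  set S : ℕ → ℝ := fun m => ∑ l ∈ Finset.range m, β l * n l with hS
  have hS1 : Tendsto (fun l => S (l + 1) - a) atTop (𝓝 0) := by
    rw [← sub_self a]
    exact ((tendsto_add_atTop_iff_nat 1).2 ha).sub_const a
  have hv : Tendsto (fun l => |recAverage β n l - (S (l + 1) - a)|) atTop (𝓝 0) := by
    refine tendsto_zero_of_recursive_average (α := fun l => β (l + 1))
      (w := fun l => |S (l + 1) - a|)
      (fun l => ⟨(hβ _).1.le, (hβ _).2⟩) (tendsto_sum_range_shift hsum) (fun l => abs_nonneg _)
      (Eventually.of_forall fun l => ?_) (by simpa using hS1.abs)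
    have e : recAverage β n (l + 1) - (S (l + 1 + 1) - a)
        = (1 - β (l + 1)) * (recAverage β n l - (S (l + 1) - a)) - β (l + 1) * (S (l + 1) - a) := by
      have : S (l + 1 + 1) = S (l + 1) + β (l + 1) * n (l + 1) := Finset.sum_range_succ _ _
      rw [this, recAverage, smul_eq_mul, smul_eq_mul]
      ring
    rw [e]
    refine (abs_sub _ _).trans ?_
    rw [abs_mul, abs_mul, abs_of_pos (hβ (l + 1)).1,
      abs_of_nonneg (by linarith [(hβ (l + 1)).2] : 0 ≤ 1 - β (l + 1))]
  have hv' := (tendsto_zero_iff_abs_tendsto_zero _).2 hv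
  simpa using hv'.add hS1

end Averages

/-! ### Recursive averages of centred noise. -/

section Noise

variable {Ω F 𝒴 : Type*} [mΩ : MeasurableSpace Ω] [MeasurableSpace F] [MeasurableSpace 𝒴]
  {μ : Measure Ω} [IsProbabilityMeasure μ] {ν : Measure F} {H : ℕ → Ω → F}

/-- Convergence follows from that of the weighted martingale. Summability comes from the energy
inequality `hrec`: the loss `β * E u ^ 2` telescopes against a summable input `β ^ 2 * C`. -/
theorem IsSampling.ae_recAverage (hs : IsSampling μ ν H) {Y : ℕ → Ω → 𝒴} {ψ : 𝒴 → F → ℝ}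
    {L : F → ℝ} {β : ℕ → ℝ} (hY : ∀ l, Measurable[past H l] (Y l))
    (hψ : Measurable (Function.uncurry ψ)) (h0 : ∀ y, ∫ h, ψ y h ∂ν = 0)
    (hL : MemLp L 2 ν) (hb : ∀ y h, |ψ y h| ≤ L h) (hβ : ∀ l, 0 < β l ∧ β l ≤ 1)
    (hβ_sum : Tendsto (fun n => ∑ l ∈ Finset.range n, β l) atTop atTop)
    (hβ_sq : Summable fun l => β l ^ 2) :
    ∀ᵐ ω ∂μ, Tendsto (recAverage β fun l => ψ (Y l ω) (H l ω)) atTop (𝓝 0) ∧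
      Summable fun l => β l * (recAverage β (fun l => ψ (Y l ω) (H l ω)) l) ^ 2 := by
  have hlim := hs.ae_exists_tendsto_sum (ψ := fun l y h => β l * ψ y h) hY
    (fun l => hψ.const_mul (β l)) (fun l y => by rw [integral_const_mul, h0, mul_zero]) hβ_sq hL
    (fun l y h => by rw [abs_mul, abs_of_pos (hβ l).1]; exact
      mul_le_mul_of_nonneg_left (hb y h) (hβ l).1.le)
  set ξ : ℕ → Ω → ℝ := fun l ω => ψ (Y l ω) (H l ω) with hξ
  set u : ℕ → Ω → ℝ := fun l ω => recAverage β (fun l => ξ l ω) l with hu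
  have hb' : ∀ y h, |ψ y h| ≤ 1 * L h := fun y h => by rw [one_mul]; exact hb y h
  have hξL : ∀ l, MemLp (ξ l) 2 μ := fun l => hs.memLp_increment (hY l) hψ hL hb'
  have hum : ∀ l, Measurable[past H (l + 1)] (u l) := by
    intro l
    induction l with
    | zero => exact (IsSampling.measurable_increment (hY 0) hψ).const_smul (β 0)
    | succ l ih =>
      exact ((ih.mono (past_mono H (l + 1).le_succ) le_rfl).const_smul (1 - β (l + 1))).add
        ((IsSampling.measurable_increment (hY (l + 1)) hψ).const_smul (β (l + 1)))
  have huL : ∀ l, MemLp (u l) 2 μ := by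
    intro l
    induction l with
    | zero => exact (hξL 0).const_smul (β 0)
    | succ l ih => exact (ih.const_smul (1 - β (l + 1))).add ((hξL (l + 1)).const_smul (β (l + 1)))
  set C : ℝ := ∫ h, L h ^ 2 ∂ν with hC
  have hrec : ∀ l, ∫ ω, u (l + 1) ω ^ 2 ∂μ
      ≤ (1 - β (l + 1)) * ∫ ω, u l ω ^ 2 ∂μ + β (l + 1) ^ 2 * C := by
    intro l
    have e := hs.integral_sq_add_increment (hum l) (huL l) (hY (l + 1)) hψ h0 (hξL (l + 1))
      (1 - β (l + 1)) (β (l + 1))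
    have e' : ∫ ω, u (l + 1) ω ^ 2 ∂μ = (1 - β (l + 1)) ^ 2 * ∫ ω, u l ω ^ 2 ∂μ
        + β (l + 1) ^ 2 * ∫ ω, ξ (l + 1) ω ^ 2 ∂μ := e
    rw [e']
    have h1 := hs.integral_increment_sq_le (hY (l + 1)) hψ hL hb'
    rw [one_pow, one_mul] at h1
    have h2 : 0 ≤ ∫ ω, u l ω ^ 2 ∂μ := integral_nonneg fun ω => sq_nonneg _
    have h3 : (1 - β (l + 1)) ^ 2 ≤ 1 - β (l + 1) := by
      nlinarith [(hβ (l + 1)).1, (hβ (l + 1)).2]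
    exact add_le_add (mul_le_mul_of_nonneg_right h3 h2)
      (mul_le_mul_of_nonneg_left h1 (sq_nonneg _))
  have hu0 : ∀ l, 0 ≤ ∫ ω, u l ω ^ 2 ∂μ := fun l => integral_nonneg fun ω => sq_nonneg _
  have hC0 : 0 ≤ C := integral_nonneg fun h => sq_nonneg _
  have hbound : ∀ n, ∫ ω, u n ω ^ 2 ∂μ + ∑ l ∈ Finset.range n, β (l + 1) * ∫ ω, u l ω ^ 2 ∂μ
      ≤ ∫ ω, u 0 ω ^ 2 ∂μ + (∑ l ∈ Finset.range n, β (l + 1) ^ 2) * C := by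
    intro n
    induction n with
    | zero => simp
    | succ n ih =>
      rw [Finset.sum_range_succ, Finset.sum_range_succ, add_mul]
      linarith [hrec n]
  have hβ_sq' : Summable fun l => β (l + 1) ^ 2 :=
    (summable_nat_add_iff 1 (f := fun l => β l ^ 2)).2 hβ_sq
  have hsum1 : Summable fun l => β (l + 1) * ∫ ω, u l ω ^ 2 ∂μ := by
    refine summable_of_sum_range_le (c := ∫ ω, u 0 ω ^ 2 ∂μ + (∑' l, β (l + 1) ^ 2) * C)
      (fun l => mul_nonneg (hβ _).1.le (hu0 l)) fun n => ?_
    have := mul_le_mul_of_nonneg_right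
      (hβ_sq'.sum_le_tsum (Finset.range n) fun _ _ => sq_nonneg _) hC0
    linarith [hbound n, hu0 n]
  -- The telescoped sum pairs `β (l + 1)` with `u l`. Since `β` need not be monotone, one more use
  -- of `hrec` is needed to pair weights and averages with equal indices.
  have hsum2 : Summable fun l => ∫ ω, β l * u l ω ^ 2 ∂μ := by
    simp only [integral_const_mul]
    rw [← summable_nat_add_iff 1]
    refine Summable.of_nonneg_of_le (fun l => mul_nonneg (hβ _).1.le (hu0 _)) (fun l => ?_)
      (hsum1.add (hβ_sq'.mul_right C))
    have h1 := hrec l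
    have h2 := hu0 l
    have h3 := hu0 (l + 1)
    have hb0 := (hβ (l + 1)).1
    have hb1 := (hβ (l + 1)).2
    have : β (l + 1) * ∫ ω, u (l + 1) ω ^ 2 ∂μ
        ≤ β (l + 1) * ((1 - β (l + 1)) * ∫ ω, u l ω ^ 2 ∂μ + β (l + 1) ^ 2 * C) :=
      mul_le_mul_of_nonneg_left h1 hb0.le
    have h4 : 0 ≤ β (l + 1) ^ 2 * ∫ ω, u l ω ^ 2 ∂μ := by positivity
    have h5 : β (l + 1) * (β (l + 1) ^ 2 * C) ≤ 1 * (β (l + 1) ^ 2 * C) := by gcongr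
    nlinarith
  filter_upwards [hlim, ae_summable_of_summable_integral
    (fun l ω => mul_nonneg (hβ l).1.le (sq_nonneg _))
    (fun l => (huL l).integrable_sq.const_mul (β l)) hsum2] with ω h1 h2
  obtain ⟨a, ha⟩ := h1
  exact ⟨tendsto_recAverage_of_tendsto_sum hβ hβ_sum ha, h2⟩

end Noise

/-! ### Moments of sums of independent centred variables -/

theorem pow_mul_pow_le_add_pow {a b : ℝ} (ha : 0 ≤ a) (hb : 0 ≤ b) {i N : ℕ} (hi : i ≤ N) :
    a ^ i * b ^ (N - i) ≤ a ^ N + b ^ N := by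
  have hm : 0 ≤ max a b := le_max_of_le_left ha
  calc a ^ i * b ^ (N - i) ≤ max a b ^ i * max a b ^ (N - i) := by
        gcongr
        · exact le_max_left _ _
        · exact le_max_right _ _
    _ = max a b ^ N := by rw [← pow_add, Nat.add_sub_cancel' hi]
    _ ≤ a ^ N + b ^ N := by
        rcases le_total a b with h | h
        · rw [max_eq_right h]; linarith [pow_nonneg ha N]
        · rw [max_eq_left h]; linarith [pow_nonneg hb N]

/-- The first two binomial terms are kept exactly because the linear one integrates to zero. Each
remaining monomial is `w ^ 2` times a mixed monomial of even total degree `N`, dominated by the two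
pure powers. -/
theorem add_pow_le_second_order (s w : ℝ) {N : ℕ} (hN : Even N) :
    (s + w) ^ (N + 2) ≤ s ^ (N + 2) + (N + 2) * (s ^ (N + 1) * w)
      + 2 ^ (N + 2) * (s ^ N * w ^ 2 + w ^ (N + 2)) := by
  rw [add_comm s w, add_pow, Finset.sum_range_succ', Finset.sum_range_succ']
  have hs : |s| ^ N = s ^ N := hN.pow_abs s
  have hw : |w| ^ N = w ^ N := hN.pow_abs w
  have hterm : ∀ j ∈ Finset.range (N + 1),
      w ^ (j + 1 + 1) * s ^ (N + 2 - (j + 1 + 1)) * ((N + 2).choose (j + 1 + 1) : ℝ)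
      ≤ (s ^ N * w ^ 2 + w ^ (N + 2)) * ((N + 2).choose (j + 1 + 1) : ℝ) := by
    intro j hj
    have hj' : j ≤ N := Nat.lt_succ_iff.1 (Finset.mem_range.1 hj)
    refine mul_le_mul_of_nonneg_right ?_ (Nat.cast_nonneg _)
    have e1 : N + 2 - (j + 1 + 1) = N - j := by omega
    rw [e1]
    refine (le_abs_self _).trans ?_
    rw [abs_mul, abs_pow, abs_pow]
    have h := pow_mul_pow_le_add_pow (abs_nonneg w) (abs_nonneg s) hj'
    rw [hs, hw] at h
    calc |w| ^ (j + 1 + 1) * |s| ^ (N - j) = w ^ 2 * (|w| ^ j * |s| ^ (N - j)) := by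
          rw [← sq_abs w]; ring
      _ ≤ w ^ 2 * (w ^ N + s ^ N) := by gcongr
      _ = s ^ N * w ^ 2 + w ^ (N + 2) := by ring
  have hsum := Finset.sum_le_sum hterm
  rw [← Finset.mul_sum] at hsum
  have hch : (∑ j ∈ Finset.range (N + 1), ((N + 2).choose (j + 1 + 1) : ℝ)) ≤ 2 ^ (N + 2) := by
    have := Nat.sum_range_choose (N + 2)
    rw [Finset.sum_range_succ', Finset.sum_range_succ'] at this
    have h2 : ∑ j ∈ Finset.range (N + 1), (N + 2).choose (j + 1 + 1) ≤ 2 ^ (N + 2) := by omega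
    exact_mod_cast h2
  have hpos : 0 ≤ s ^ N * w ^ 2 + w ^ (N + 2) := by
    have : w ^ (N + 2) = w ^ N * w ^ 2 := pow_add _ _ _
    rw [this, ← hs, ← hw]
    positivity
  have := mul_le_mul_of_nonneg_left hch hpos
  refine (add_le_add (add_le_add (hsum.trans this) le_rfl) le_rfl).trans (le_of_eq ?_)
  have e0 : N + 2 - (0 + 1) = N + 1 := by omega
  simp only [e0, pow_zero, zero_add, pow_one, one_mul, Nat.choose_one_right, Nat.choose_zero_right,
    Nat.cast_one, mul_one, Nat.sub_zero]
  push_cast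
  ring

section Moments

variable {Ω F : Type*} [mΩ : MeasurableSpace Ω] [MeasurableSpace F]
  {μ : Measure Ω} [IsProbabilityMeasure μ] {ν : Measure F} {H : ℕ → Ω → F} {L : F → ℝ}

/-- Induction on `q`, and for each `q` on `n`: adding a term costs at most a multiple of the lower
moment of the sum, of order `n ^ q`, plus a constant. One constant serves all `φ` dominated by `L`,
which the union over a net requires. -/
theorem IsSampling.exists_moment_bound (hs : IsSampling μ ν H) (hL : ∀ p : ℕ, MemLp L p ν) (q : ℕ) :
    ∃ C : ℝ, 0 ≤ C ∧ ∀ φ : F → ℝ, Measurable φ → (∀ h, |φ h| ≤ L h) → ∫ h, φ h ∂ν = 0 →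
      ∀ n : ℕ, Integrable (fun ω => (∑ i ∈ Finset.range n, φ (H i ω)) ^ (2 * q)) μ ∧
        ∫ ω, (∑ i ∈ Finset.range n, φ (H i ω)) ^ (2 * q) ∂μ ≤ C * (n : ℝ) ^ q := by
  have hν := hs.isProbabilityMeasure
  have hLint : ∀ p : ℕ, Integrable (fun h => ‖L h‖ ^ p) ν := fun p => by
    rcases Nat.eq_zero_or_pos p with rfl | hp
    · simp
    · exact (hL p).integrable_norm_pow hp.ne'
  -- integrability of all monomials in the partial sums and the next term
  have hmono : ∀ φ : F → ℝ, Measurable φ → (∀ h, |φ h| ≤ L h) → ∀ n a b : ℕ,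
      Integrable (fun ω => (∑ i ∈ Finset.range n, φ (H i ω)) ^ a * φ (H n ω) ^ b) μ := by
    intro φ hφ hb n a b
    have hT : MemLp (fun ω => ∑ i ∈ Finset.range (n + 1), L (H i ω)) ((a + b : ℕ) : ENNReal) μ :=
      memLp_finsetSum _ fun i _ => hs.memLp_comp (hL _) i
    have hTi : Integrable (fun ω => ‖∑ i ∈ Finset.range (n + 1), L (H i ω)‖ ^ (a + b)) μ := by
      rcases Nat.eq_zero_or_pos (a + b) with h0 | hp
      · simp [h0]
      · exact hT.integrable_norm_pow hp.ne'
    have hφm : ∀ i, Measurable fun ω => φ (H i ω) := fun i => hφ.comp (hs.measurable i)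
    refine hTi.mono' (((Finset.measurable_sum _ fun i _ => hφm i).pow_const a).mul
      ((hφm n).pow_const b)).aestronglyMeasurable (Eventually.of_forall fun ω => ?_)
    have hL0 : ∀ i, 0 ≤ L (H i ω) := fun i => (abs_nonneg _).trans (hb _)
    have h1 : |∑ i ∈ Finset.range n, φ (H i ω)| ≤ ∑ i ∈ Finset.range (n + 1), L (H i ω) := by
      refine (Finset.abs_sum_le_sum_abs _ _).trans ?_
      rw [Finset.sum_range_succ]
      linarith [Finset.sum_le_sum fun i (_ : i ∈ Finset.range n) => hb (H i ω), hL0 n]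
    have h2 : |φ (H n ω)| ≤ ∑ i ∈ Finset.range (n + 1), L (H i ω) := by
      rw [Finset.sum_range_succ]
      linarith [Finset.sum_nonneg fun i (_ : i ∈ Finset.range n) => hL0 i, hb (H n ω)]
    have h0 : 0 ≤ ∑ i ∈ Finset.range (n + 1), L (H i ω) := Finset.sum_nonneg fun i _ => hL0 i
    rw [Real.norm_eq_abs, abs_mul, abs_pow, abs_pow, Real.norm_of_nonneg h0, pow_add]
    gcongr
  induction q with
  | zero =>
    refine ⟨1, zero_le_one, fun φ _ _ _ n => ?_⟩
    simp
  | succ q ih =>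
    obtain ⟨C, hC, hih⟩ := ih
    set B2 : ℝ := ∫ h, ‖L h‖ ^ 2 ∂ν with hB2
    set Bq : ℝ := ∫ h, ‖L h‖ ^ (2 * q + 2) ∂ν with hBq
    have hB20 : 0 ≤ B2 := integral_nonneg fun h => by positivity
    have hBq0 : 0 ≤ Bq := integral_nonneg fun h => by positivity
    set A : ℝ := 2 ^ (2 * q + 2) * (C * B2 + Bq) with hA
    have hA0 : 0 ≤ A := by positivity
    refine ⟨A, hA0, fun φ hφ hb h0 n => ?_⟩
    set S : ℕ → Ω → ℝ := fun n ω => ∑ i ∈ Finset.range n, φ (H i ω) with hS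
    have hint : ∀ n k, Integrable (fun ω => S n ω ^ k) μ := fun n k => by
      simpa using hmono φ hφ hb n k 0
    have hSm : ∀ n, Measurable[past H n] (S n) := fun n =>
      Finset.measurable_sum (m := past H n) _ fun i hi =>
        hφ.comp (measurable_past H (Finset.mem_range.1 hi))
    have hφsq : ∀ p : ℕ, ∀ h, ‖φ h ^ p‖ ≤ ‖L h‖ ^ p := fun p h => by
      rw [norm_pow]
      gcongr
      exact (hb h).trans (le_abs_self _)
    have hφint : ∀ p : ℕ, Integrable (fun h => φ h ^ p) ν := fun p =>
      (hLint p).mono' (hφ.pow_const p).aestronglyMeasurable (Eventually.of_forall (hφsq p))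
    have hφle : ∀ p : ℕ, ∫ h, φ h ^ p ∂ν ≤ ∫ h, ‖L h‖ ^ p ∂ν := fun p =>
      integral_mono (hφint p) (hLint p) fun h => (le_abs_self _).trans (hφsq p h)
    refine ⟨hint n _, ?_⟩
    change ∫ ω, S n ω ^ (2 * (q + 1)) ∂μ ≤ _
    induction n with
    | zero => simp [hS]
    | succ n ihn =>
      have e2 : 2 * (q + 1) = 2 * q + 2 := by ring
      rw [e2] at ihn ⊢
      have hcross : ∫ ω, S n ω ^ (2 * q + 1) * φ (H n ω) ∂μ = 0 := by
        have hi := hmono φ hφ hb n (2 * q + 1) 1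
        simp only [pow_one] at hi
        exact hs.integral_mul_eq_zero (Y := fun _ => ()) (ψ := fun _ => φ)
          ((hSm n).pow_const _) measurable_const (hφ.comp measurable_snd) (fun _ => h0) hi
      -- Independence factorizes this integral: the orthogonality statement is applied to the
      -- centred function `φ ^ 2 - ∫ φ ^ 2`.
      have hquad : ∫ ω, S n ω ^ (2 * q) * φ (H n ω) ^ 2 ∂μ
          = (∫ ω, S n ω ^ (2 * q) ∂μ) * ∫ h, φ h ^ 2 ∂ν := by
        have hi := hmono φ hφ hb n (2 * q) 2
        have hc := (hint n (2 * q)).mul_const (∫ h, φ h ^ 2 ∂ν)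
        have := hs.integral_mul_eq_zero (l := n) (Z := fun ω => S n ω ^ (2 * q)) (Y := fun _ => ())
          (ψ := fun _ h => φ h ^ 2 - ∫ h, φ h ^ 2 ∂ν)
          ((hSm n).pow_const _) measurable_const
          (((hφ.comp measurable_snd).pow_const 2).sub_const _)
          (fun _ => by rw [integral_sub (hφint 2) (integrable_const _)]; simp)
          ((hi.sub hc).congr (Eventually.of_forall fun ω => by simp only [Pi.sub_apply]; ring))
        simp only [mul_sub] at this
        rw [integral_sub hi hc, integral_mul_const] at this
        linarith
      have hle : ∫ ω, S (n + 1) ω ^ (2 * q + 2) ∂μ ≤ ∫ ω, (S n ω ^ (2 * q + 2)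
          + (2 * q + 2) * (S n ω ^ (2 * q + 1) * φ (H n ω))
          + 2 ^ (2 * q + 2) * (S n ω ^ (2 * q) * φ (H n ω) ^ 2 + φ (H n ω) ^ (2 * q + 2))) ∂μ := by
        have i1 := hmono φ hφ hb n (2 * q + 1) 1
        have i2 := hmono φ hφ hb n 0 (2 * q + 2)
        simp only [pow_one, pow_zero, one_mul] at i1 i2
        refine integral_mono (hint _ _) (((hint n _).add (i1.const_mul _)).add
          (((hmono φ hφ hb n (2 * q) 2).add i2).const_mul _)) fun ω => ?_
        have := add_pow_le_second_order (S n ω) (φ (H n ω)) (even_two_mul q)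
        simp only [hS, Finset.sum_range_succ] at this ⊢
        push_cast at this
        exact this
      have hsplit : ∫ ω, (S n ω ^ (2 * q + 2)
          + (2 * q + 2) * (S n ω ^ (2 * q + 1) * φ (H n ω))
          + 2 ^ (2 * q + 2) * (S n ω ^ (2 * q) * φ (H n ω) ^ 2 + φ (H n ω) ^ (2 * q + 2))) ∂μ
          = ∫ ω, S n ω ^ (2 * q + 2) ∂μ + 2 ^ (2 * q + 2) *
            ((∫ ω, S n ω ^ (2 * q) ∂μ) * (∫ h, φ h ^ 2 ∂ν) + ∫ h, φ h ^ (2 * q + 2) ∂ν) := by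
        have i1 := hmono φ hφ hb n (2 * q + 1) 1
        have i2 := hmono φ hφ hb n 0 (2 * q + 2)
        have i3 := hmono φ hφ hb n (2 * q) 2
        simp only [pow_one, pow_zero, one_mul] at i1 i2
        have j1 : Integrable (fun ω => S n ω ^ (2 * q + 2)
          + (2 * q + 2) * (S n ω ^ (2 * q + 1) * φ (H n ω))) μ := (hint n _).add (i1.const_mul _)
        have j2 : Integrable (fun ω => S n ω ^ (2 * q) * φ (H n ω) ^ 2
          + φ (H n ω) ^ (2 * q + 2)) μ := i3.add i2
        rw [integral_add j1 (j2.const_mul _), integral_add (hint n _) (i1.const_mul _),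
          integral_const_mul, integral_const_mul, integral_add i3 i2, hcross, hquad, mul_zero,
          add_zero, hs.integral_comp (φ := fun h => φ h ^ (2 * q + 2))
            (hφ.pow_const _).aestronglyMeasurable n]
      rw [hsplit] at hle
      have k1 := (hih φ hφ hb h0 n).2
      have k2 := hφle 2
      have k3 := hφle (2 * q + 2)
      have k4 : 0 ≤ ∫ h, φ h ^ 2 ∂ν := integral_nonneg fun h => sq_nonneg _
      have hn1 : (n : ℝ) ^ q ≤ ((n : ℝ) + 1) ^ q := by gcongr; linarith
      have hn2 : (1 : ℝ) ≤ ((n : ℝ) + 1) ^ q := one_le_pow₀ (by linarith [Nat.cast_nonneg (α := ℝ) n])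
      have k5 : (∫ ω, S n ω ^ (2 * q) ∂μ) * (∫ h, φ h ^ 2 ∂ν) ≤ C * ((n : ℝ) + 1) ^ q * B2 := by
        have : ∫ ω, S n ω ^ (2 * q) ∂μ ≤ C * ((n : ℝ) + 1) ^ q :=
          k1.trans (mul_le_mul_of_nonneg_left hn1 hC)
        exact mul_le_mul this k2 k4 (by positivity)
      have k6 : ∫ h, φ h ^ (2 * q + 2) ∂ν ≤ Bq * ((n : ℝ) + 1) ^ q :=
        k3.trans (le_mul_of_one_le_right hBq0 hn2)
      have k7 : 2 ^ (2 * q + 2) * ((∫ ω, S n ω ^ (2 * q) ∂μ) * (∫ h, φ h ^ 2 ∂ν)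
          + ∫ h, φ h ^ (2 * q + 2) ∂ν) ≤ A * ((n : ℝ) + 1) ^ q := by
        rw [hA, mul_assoc]
        refine mul_le_mul_of_nonneg_left ?_ (by positivity)
        linarith
      have k8 : A * (n : ℝ) ^ (q + 1) ≤ A * (n * ((n : ℝ) + 1) ^ q) := by
        rw [pow_succ']
        gcongr
      push_cast
      have : A * ((n : ℝ) + 1) ^ (q + 1) = A * (n * ((n : ℝ) + 1) ^ q) + A * ((n : ℝ) + 1) ^ q := by
        ring
      linarith

omit [IsProbabilityMeasure μ] in
theorem IsSampling.ae_exists_sum_le (hs : IsSampling μ ν H) (hL : Integrable L ν) :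
    ∀ᵐ ω ∂μ, ∃ C : ℝ, 0 ≤ C ∧ ∀ n : ℕ, ∑ i ∈ Finset.range (n + 1), L (H i ω) ≤ C * ((n : ℝ) + 1) := by
  -- The strong law is applied to a measurable version; the two agree at all samples simultaneously,
  -- almost surely.
  obtain ⟨L', hL'm, hL'⟩ := hL.aestronglyMeasurable
  have hlaw : ∀ i, IdentDistrib (H i) (H 0) μ μ := fun i =>
    ⟨(hs.measurable i).aemeasurable, (hs.measurable 0).aemeasurable, by rw [hs.map_eq, hs.map_eq]⟩
  have hid : ∀ i, IdentDistrib (fun ω => L' (H i ω)) (fun ω => L' (H 0 ω)) μ μ := fun i =>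
    (hlaw i).comp hL'm.measurable
  have hind : Pairwise fun i j => IndepFun (fun ω => L' (H i ω)) (fun ω => L' (H j ω)) μ :=
    fun i j hij => (hs.indep.indepFun hij).comp hL'm.measurable hL'm.measurable
  have hae : ∀ᵐ ω ∂μ, ∀ i, L (H i ω) = L' (H i ω) := ae_all_iff.2 fun i => by
    have := hL'
    rw [← hs.map_eq i] at this
    exact ae_of_ae_map (hs.measurable i).aemeasurable this
  filter_upwards [strong_law_ae_real (fun i ω => L' (H i ω)) (hs.integrable_comp (hL.congr hL') 0)
    hind hid, hae] with ω hω hω'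
  obtain ⟨C, hC⟩ := hω.bddAbove_range
  refine ⟨max C 0, le_max_right _ _, fun n => ?_⟩
  have := (hC ⟨n + 1, rfl⟩).trans (le_max_left C 0)
  simp only [hω']
  push_cast at this
  rwa [div_le_iff₀ (by positivity)] at this

end Moments

/-! ### Uniform rates of convergence of sample averages -/

section UniformRate

variable {ι : Type*} [Fintype ι]

theorem EuclideanSpace.norm_le_sum_abs (v : EuclideanSpace ℝ ι) : ‖v‖ ≤ ∑ i, |v i| := by
  rw [EuclideanSpace.norm_eq]
  refine Real.sqrt_le_iff.2 ⟨Finset.sum_nonneg fun i _ => abs_nonneg _, ?_⟩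
  simp only [Real.norm_eq_abs]
  exact Finset.sum_sq_le_sq_sum_of_nonneg fun i _ => abs_nonneg _

/-- Bounded sets have nets of polynomial cardinality. -/
theorem exists_net {X : Set (EuclideanSpace ℝ ι)} {R : ℕ} (hX : ∀ x ∈ X, ‖x‖ ≤ R) (n : ℕ) :
    ∃ T : Finset (EuclideanSpace ℝ ι), (∀ y ∈ T, y ∈ X) ∧
      T.card ≤ ((2 * R + 1) * (n + 1)) ^ Fintype.card ι ∧
      ∀ x ∈ X, ∃ y ∈ T, ‖x - y‖ ≤ Fintype.card ι * ((n : ℝ) + 1)⁻¹ := by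
  classical
  set c : EuclideanSpace ℝ ι → ι → ℤ := fun x i => ⌊((n : ℝ) + 1) * x i⌋ with hc
  set G : Finset (ι → ℤ) :=
    Fintype.piFinset fun _ => Finset.Icc (-((R * (n + 1) : ℕ) : ℤ)) ((R * (n + 1) : ℕ) : ℤ) with hG
  have hn : (0 : ℝ) < (n : ℝ) + 1 := by positivity
  have hcG : c '' X ⊆ ↑G := by
    rintro _ ⟨x, hx, rfl⟩
    rw [Finset.mem_coe, hG, Fintype.mem_piFinset]
    intro i
    have h1 : |x i| ≤ R := (PiLp.norm_apply_le x i).trans (hX x hx)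
    rw [abs_le] at h1
    rw [Finset.mem_Icc, hc]
    constructor
    · rw [Int.le_floor]; push_cast; nlinarith
    · have : ((⌊((n : ℝ) + 1) * x i⌋ : ℤ) : ℝ) ≤ (((R * (n + 1) : ℕ) : ℤ) : ℝ) := by
        refine (Int.floor_le _).trans ?_
        push_cast; nlinarith
      exact_mod_cast this
  -- One point of `X` is chosen in each grid cell of side `1 / (n + 1)` that meets `X`, so the net
  -- lies inside `X`.
  obtain ⟨T, hTX, hT⟩ := Set.exists_subset_bijOn X c
  have hfin : T.Finite := Set.Finite.of_finite_image
    ((G.finite_toSet.subset hcG).subset (by rw [hT.image_eq])) hT.injOn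
  refine ⟨hfin.toFinset, fun y hy => hTX (hfin.mem_toFinset.1 hy), ?_, fun x hx => ?_⟩
  · have h1 : hfin.toFinset.card ≤ G.card := by
      refine Finset.card_le_card_of_injOn c (fun y hy => ?_) (by simpa using hT.injOn)
      exact hcG ⟨y, hTX (by simpa using hy), rfl⟩
    refine h1.trans ?_
    rw [hG, Fintype.card_piFinset, Finset.prod_const, Finset.card_univ, Int.card_Icc]
    refine Nat.pow_le_pow_left ?_ _
    have : ((R * (n + 1) : ℕ) : ℤ) + 1 - -((R * (n + 1) : ℕ) : ℤ)
        = ((2 * (R * (n + 1)) + 1 : ℕ) : ℤ) := by push_cast; ring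
    rw [this, Int.toNat_natCast]
    nlinarith
  · have : c x ∈ c '' T := by rw [hT.image_eq]; exact ⟨x, hx, rfl⟩
    obtain ⟨y, hy, hyx⟩ := this
    refine ⟨y, hfin.mem_toFinset.2 hy, (EuclideanSpace.norm_le_sum_abs _).trans ?_⟩
    have : ∀ i ∈ Finset.univ, |(x - y) i| ≤ ((n : ℝ) + 1)⁻¹ := fun i _ => by
      have h1 := Int.abs_sub_lt_one_of_floor_eq_floor (congrFun hyx i)
      rw [← mul_sub, abs_mul, abs_of_pos hn, ← lt_div_iff₀' hn, one_div, abs_sub_comm] at h1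
      exact h1.le
    refine (Finset.sum_le_sum this).trans ?_
    rw [Finset.sum_const, nsmul_eq_mul, Finset.card_univ]

variable {Ω F : Type*} [mΩ : MeasurableSpace Ω] [MeasurableSpace F]
  {μ : Measure Ω} [IsProbabilityMeasure μ] {ν : Measure F} {H : ℕ → Ω → F} {L : F → ℝ}

/-- Sample averages of a bounded Lipschitz family converge uniformly at a polynomial rate. -/
theorem IsSampling.ae_uniform_rate (hs : IsSampling μ ν H) (hL : ∀ p : ℕ, MemLp L p ν)
    (hL0 : ∀ h, 0 ≤ L h) {X : Set (EuclideanSpace ℝ ι)} {R : ℕ} (hX : ∀ x ∈ X, ‖x‖ ≤ R)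
    {ψ : EuclideanSpace ℝ ι → F → ℝ} (hψ : ∀ x ∈ X, Measurable (ψ x))
    (hb : ∀ x ∈ X, ∀ h, |ψ x h| ≤ L h)
    (hlip : ∀ x ∈ X, ∀ y ∈ X, ∀ h, |ψ x h - ψ y h| ≤ L h * ‖x - y‖) :
    ∀ᵐ ω ∂μ, ∃ C : ℝ, ∀ n : ℕ, ∀ x ∈ X,
      |(∑ i ∈ Finset.range (n + 1), ψ x (H i ω)) / ((n : ℝ) + 1) - ∫ h, ψ x h ∂ν|
        ≤ C * ((n : ℝ) + 1) ^ (-(3 / 8) : ℝ) := by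
  have hν := hs.isProbabilityMeasure
  have hLi : Integrable L ν := by simpa using (hL 1).integrable (by simp)
  set m : ℝ := ∫ h, L h ∂ν with hm
  have hm0 : 0 ≤ m := integral_nonneg hL0
  have hψi : ∀ x ∈ X, Integrable (ψ x) ν := fun x hx =>
    hLi.mono' (hψ x hx).aestronglyMeasurable (Eventually.of_forall (hb x hx))
  have hψm : ∀ x ∈ X, |∫ h, ψ x h ∂ν| ≤ m := fun x hx =>
    norm_integral_le_of_norm_le (f := ψ x) hLi (Eventually.of_forall (hb x hx))
  set φ : EuclideanSpace ℝ ι → F → ℝ := fun x h => ψ x h - ∫ h, ψ x h ∂ν with hφ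
  set D := Fintype.card ι with hD
  -- Moments of order `8 * q` are at most `C * (n + 1) ^ (4 * q)`. Dividing by `(n + 1) ^ (5 * q)`
  -- leaves `(n + 1) ^ (-q)`, and summing over the `O((n + 1) ^ D)` net points leaves the summable
  -- `(n + 1) ^ (-2)`. Taking roots gives sums of order `(n + 1) ^ (5/8)`, that is, averages of
  -- order `(n + 1) ^ (-3/8)`.
  set q := D + 2 with hq
  have hL' : ∀ p : ℕ, MemLp (fun h => L h + m) p ν := fun p => (hL p).add (memLp_const m)
  obtain ⟨C, hC, hmom⟩ := hs.exists_moment_bound hL' (4 * q)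
  have hφ1 : ∀ x ∈ X, Measurable (φ x) := fun x hx => (hψ x hx).sub_const _
  have hφ2 : ∀ x ∈ X, ∀ h, |φ x h| ≤ L h + m := fun x hx h =>
    (abs_sub _ _).trans (add_le_add (hb x hx h) (hψm x hx))
  have hφ3 : ∀ x ∈ X, ∫ h, φ x h ∂ν = 0 := fun x hx => by
    simp only [hφ]
    rw [integral_sub (hψi x hx) (integrable_const _)]; simp
  choose T hTX hTc hTn using exists_net hX
  set S : ℕ → EuclideanSpace ℝ ι → Ω → ℝ := fun n x ω =>
    ∑ i ∈ Finset.range (n + 1), φ x (H i ω) with hS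
  set Z : ℕ → Ω → ℝ := fun n ω =>
    ∑ y ∈ T n, S n y ω ^ (2 * (4 * q)) / ((n : ℝ) + 1) ^ (5 * q) with hZ
  have hZi : ∀ n, Integrable (Z n) μ := fun n => integrable_finsetSum _ fun y hy =>
    ((hmom (φ y) (hφ1 y (hTX n y hy)) (hφ2 y (hTX n y hy)) (hφ3 y (hTX n y hy)) (n + 1)).1).div_const _
  have hZ0 : ∀ n ω, 0 ≤ Z n ω := fun n ω => Finset.sum_nonneg fun y _ =>
    div_nonneg ((even_two_mul _).pow_nonneg _) (by positivity)
  have hZint : ∀ n, ∫ ω, Z n ω ∂μ ≤ (2 * R + 1 : ℝ) ^ D * C * (((n + 1 : ℕ) : ℝ) ^ 2)⁻¹ := by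
    intro n
    have hn : (0 : ℝ) < (n : ℝ) + 1 := by positivity
    simp only [hZ]
    rw [integral_finsetSum _ fun y hy =>
      ((hmom (φ y) (hφ1 y (hTX n y hy)) (hφ2 y (hTX n y hy)) (hφ3 y (hTX n y hy)) (n + 1)).1).div_const _]
    have hterm : ∀ y ∈ T n, ∫ ω, S n y ω ^ (2 * (4 * q)) / ((n : ℝ) + 1) ^ (5 * q) ∂μ
        ≤ C * (((n : ℝ) + 1) ^ q)⁻¹ := fun y hy => by
      rw [integral_div, div_le_iff₀ (by positivity)]
      have := (hmom (φ y) (hφ1 y (hTX n y hy)) (hφ2 y (hTX n y hy)) (hφ3 y (hTX n y hy)) (n + 1)).2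
      refine this.trans (le_of_eq ?_)
      push_cast
      rw [mul_assoc, show 5 * q = q + 4 * q by ring, pow_add ((n : ℝ) + 1) q,
        inv_mul_cancel_left₀ (by positivity)]
    refine (Finset.sum_le_sum hterm).trans ?_
    rw [Finset.sum_const, nsmul_eq_mul]
    have hcard : ((T n).card : ℝ) ≤ ((2 * R + 1) * ((n : ℝ) + 1)) ^ D := by
      exact_mod_cast hTc n
    refine (mul_le_mul_of_nonneg_right hcard (by positivity)).trans (le_of_eq ?_)
    push_cast
    rw [mul_pow, hq, pow_add]
    field_simp
  have hsumm : Summable fun n => ∫ ω, Z n ω ∂μ := by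
    refine Summable.of_nonneg_of_le (fun n => integral_nonneg (hZ0 n)) hZint (Summable.mul_left _ ?_)
    exact (summable_nat_add_iff 1 (f := fun n : ℕ => ((n : ℝ) ^ 2)⁻¹)).2
      (Real.summable_nat_pow_inv.2 (by norm_num))
  filter_upwards [ae_summable_of_summable_integral hZ0 hZi hsumm, hs.ae_exists_sum_le hLi]
    with ω hω hLω
  obtain ⟨C₁, hC₁⟩ := hω.tendsto_atTop_zero.bddAbove_range
  obtain ⟨C₂, hC₂, hLsum⟩ := hLω
  set C₃ := max C₁ 1 with hC₃
  have hC₃1 : 1 ≤ C₃ := le_max_right _ _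
  have hpt : ∀ n, ∀ y ∈ T n, |S n y ω| ≤ C₃ * ((n : ℝ) + 1) ^ (5 / 8 : ℝ) := by
    intro n y hy
    have hn : (0 : ℝ) < (n : ℝ) + 1 := by positivity
    have h1 : S n y ω ^ (2 * (4 * q)) / ((n : ℝ) + 1) ^ (5 * q) ≤ C₃ :=
      ((Finset.single_le_sum (f := fun y => S n y ω ^ (2 * (4 * q)) / ((n : ℝ) + 1) ^ (5 * q))
        (fun y _ => div_nonneg ((even_two_mul _).pow_nonneg _) (by positivity)) hy).trans
        (hC₁ ⟨n, rfl⟩)).trans (le_max_left _ _)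
    rw [div_le_iff₀ (by positivity)] at h1
    refine le_of_pow_le_pow_left₀ (n := 2 * (4 * q)) (by omega) (by positivity) ?_
    rw [(even_two_mul (4 * q)).pow_abs, mul_pow]
    have h2 : (((n : ℝ) + 1) ^ (5 / 8 : ℝ)) ^ (2 * (4 * q)) = ((n : ℝ) + 1) ^ (5 * q) := by
      rw [← Real.rpow_natCast, ← Real.rpow_mul hn.le, ← Real.rpow_natCast]
      congr 1
      push_cast
      ring
    rw [h2]
    refine h1.trans (mul_le_mul_of_nonneg_right ?_ (by positivity))
    exact le_self_pow₀ hC₃1 (by omega)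
  refine ⟨C₃ + (C₂ + m) * D, fun n x hx => ?_⟩
  have hn : (0 : ℝ) < (n : ℝ) + 1 := by positivity
  have hn1 : (1 : ℝ) ≤ (n : ℝ) + 1 := by linarith [Nat.cast_nonneg (α := ℝ) n]
  obtain ⟨y, hy, hxy⟩ := hTn n x hx
  have e : (∑ i ∈ Finset.range (n + 1), ψ x (H i ω)) / ((n : ℝ) + 1) - ∫ h, ψ x h ∂ν
      = S n x ω / ((n : ℝ) + 1) := by
    simp only [hS, hφ, Finset.sum_sub_distrib, Finset.sum_const, Finset.card_range, nsmul_eq_mul]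
    push_cast
    field_simp
  have hφl : ∀ h, |φ x h - φ y h| ≤ (L h + m) * ‖x - y‖ := fun h => by
    have h1 := hlip x hx y (hTX n y hy) h
    have h2 : |(∫ h, ψ x h ∂ν) - ∫ h, ψ y h ∂ν| ≤ m * ‖x - y‖ := by
      rw [← integral_sub (hψi x hx) (hψi y (hTX n y hy)), hm, ← integral_mul_const]
      exact norm_integral_le_of_norm_le (f := fun h => ψ x h - ψ y h) (hLi.mul_const _)
        (Eventually.of_forall (hlip x hx y (hTX n y hy)))
    have : φ x h - φ y h = (ψ x h - ψ y h) - ((∫ h, ψ x h ∂ν) - ∫ h, ψ y h ∂ν) := by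
      simp only [hφ]; ring
    rw [this, add_mul]
    exact (abs_sub _ _).trans (add_le_add h1 h2)
  -- Off the net the sums change only by a constant: the Lipschitz constants add up to order `n + 1`
  -- and the mesh is of order `1 / (n + 1)`.
  have hSl : |S n x ω - S n y ω| ≤ (C₂ + m) * D := by
    have h1 : |S n x ω - S n y ω| ≤ ∑ i ∈ Finset.range (n + 1), (L (H i ω) + m) * ‖x - y‖ := by
      simp only [hS, ← Finset.sum_sub_distrib]
      exact (Finset.abs_sum_le_sum_abs _ _).trans (Finset.sum_le_sum fun i _ => hφl _)
    rw [← Finset.sum_mul, Finset.sum_add_distrib, Finset.sum_const, Finset.card_range,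
      nsmul_eq_mul] at h1
    push_cast at h1
    have h2 : ∑ i ∈ Finset.range (n + 1), L (H i ω) + ((n : ℝ) + 1) * m
        ≤ (C₂ + m) * ((n : ℝ) + 1) := by linarith [hLsum n]
    refine h1.trans ((mul_le_mul h2 hxy (norm_nonneg _) (by positivity)).trans (le_of_eq ?_))
    rw [hD]
    field_simp
  rw [e, abs_div, abs_of_pos hn, div_le_iff₀ hn, mul_assoc]
  have hp : ((n : ℝ) + 1) ^ (-(3 / 8) : ℝ) * ((n : ℝ) + 1) = ((n : ℝ) + 1) ^ (5 / 8 : ℝ) := by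
    rw [← Real.rpow_add_one hn.ne']; norm_num
  have hp1 : (1 : ℝ) ≤ ((n : ℝ) + 1) ^ (5 / 8 : ℝ) := Real.one_le_rpow hn1 (by norm_num)
  rw [hp, add_mul]
  have t1 := hpt n y hy
  have t2 : (C₂ + m) * D ≤ (C₂ + m) * D * ((n : ℝ) + 1) ^ (5 / 8 : ℝ) :=
    le_mul_of_one_le_right (by positivity) hp1
  have t3 : |S n x ω| ≤ |S n y ω| + |S n x ω - S n y ω| := by
    have := abs_add_le (S n y ω) (S n x ω - S n y ω)
    rwa [add_sub_cancel] at this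
  linarith

end UniformRate

/-! ### Averaged functions and path properties -/

section Mean

variable {ι F : Type*} [Fintype ι] [MeasurableSpace F] {ν : Measure F}
  {X : Set (EuclideanSpace ℝ ι)} {ψ : EuclideanSpace ℝ ι → F → ℝ}
  {g : EuclideanSpace ℝ ι → F → EuclideanSpace ℝ ι} {L : F → ℝ}

namespace RegularSample

theorem integrable_fun (hS : RegularSample X ψ g L) (hL : Integrable L ν)
    {x : EuclideanSpace ℝ ι} (hx : x ∈ X) : Integrable (ψ x) ν :=
  hL.mono' (hS.measurable_fun.comp measurable_prodMk_left).aestronglyMeasurable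
    (Eventually.of_forall (hS.abs_le x hx))

theorem integrable_grad (hS : RegularSample X ψ g L) (hL : Integrable L ν)
    {x : EuclideanSpace ℝ ι} (hx : x ∈ X) : Integrable (g x) ν :=
  hL.mono' (hS.measurable_grad.comp measurable_prodMk_left).aestronglyMeasurable
    (Eventually.of_forall (hS.norm_grad_le x hx))

theorem norm_mean_grad_le (hS : RegularSample X ψ g L) (hL : Integrable L ν)
    {x : EuclideanSpace ℝ ι} (hx : x ∈ X) : ‖∫ h, g x h ∂ν‖ ≤ ∫ h, L h ∂ν :=
  norm_integral_le_of_norm_le hL (Eventually.of_forall (hS.norm_grad_le x hx))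

theorem mean_grad_lipschitz (hS : RegularSample X ψ g L) (hL : Integrable L ν)
    {x y : EuclideanSpace ℝ ι} (hx : x ∈ X) (hy : y ∈ X) :
    ‖∫ h, g y h ∂ν - ∫ h, g x h ∂ν‖ ≤ (∫ h, L h ∂ν) * ‖y - x‖ := by
  rw [← integral_sub (hS.integrable_grad hL hy) (hS.integrable_grad hL hx), ← integral_mul_const]
  exact norm_integral_le_of_norm_le (hL.mul_const _)
    (Eventually.of_forall (hS.grad_lipschitz x hx y hy))

theorem mean_taylor (hS : RegularSample X ψ g L) (hL : Integrable L ν)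
    {x y : EuclideanSpace ℝ ι} (hx : x ∈ X) (hy : y ∈ X) :
    |∫ h, ψ y h ∂ν - ∫ h, ψ x h ∂ν - inner ℝ (∫ h, g x h ∂ν) (y - x)|
      ≤ (∫ h, L h ∂ν) * ‖y - x‖ ^ 2 := by
  have i1 := hS.integrable_fun hL hx
  have i2 := hS.integrable_fun hL hy
  have i3 := hS.integrable_grad hL hx
  have e : inner ℝ (∫ h, g x h ∂ν) (y - x) = ∫ h, inner ℝ (g x h) (y - x) ∂ν := by
    rw [real_inner_comm, ← integral_inner i3]
    exact integral_congr_ae (Eventually.of_forall fun h => real_inner_comm _ _)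
  have i4 : Integrable (fun h => inner ℝ (g x h) (y - x)) ν := i3.inner_const _
  have i5 : Integrable (fun h => ψ y h - ψ x h) ν := i2.sub i1
  rw [e, ← integral_sub i2 i1, ← integral_sub i5 i4, ← integral_mul_const]
  exact norm_integral_le_of_norm_le (f := fun h => ψ y h - ψ x h - inner ℝ (g x h) (y - x))
    (hL.mul_const _) (Eventually.of_forall (hS.taylor x hx y hy))

/-- `X` need not be convex, so the mean value inequality is not available. The Taylor estimate and
the bounded diameter replace it. -/
theorem lipschitz (hS : RegularSample X ψ g L) {R : ℝ} (hX : ∀ x ∈ X, ‖x‖ ≤ R)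
    {x y : EuclideanSpace ℝ ι} (hx : x ∈ X) (hy : y ∈ X) (h : F) :
    |ψ y h - ψ x h| ≤ (1 + 2 * R) * L h * ‖y - x‖ := by
  have h1 := hS.taylor x hx y hy h
  have h2 : |inner ℝ (g x h) (y - x)| ≤ L h * ‖y - x‖ :=
    (abs_real_inner_le_norm _ _).trans
      (mul_le_mul_of_nonneg_right (hS.norm_grad_le x hx h) (norm_nonneg _))
  have h3 : ‖y - x‖ ≤ 2 * R := by
    linarith [norm_sub_le y x, hX x hx, hX y hy]
  have hL0 : 0 ≤ L h := (abs_nonneg _).trans (hS.abs_le x hx h)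
  have h4 : L h * ‖y - x‖ ^ 2 ≤ L h * (2 * R * ‖y - x‖) := by
    rw [pow_two]
    exact mul_le_mul_of_nonneg_left (mul_le_mul_of_nonneg_right h3 (norm_nonneg _)) hL0
  have h5 : ψ y h - ψ x h
      = (ψ y h - ψ x h - inner ℝ (g x h) (y - x)) + inner ℝ (g x h) (y - x) := by ring
  rw [h5]
  refine (abs_add_le _ _).trans ?_
  linarith

end RegularSample
end Mean

/-! ### Almost sure properties of a path. -/

section Path

/-- The projection of a real number to the unit interval. -/
def clampUnit (t : ℝ) : ℝ := max 0 (min t 1)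

theorem clampUnit_nonneg (t : ℝ) : 0 ≤ clampUnit t := le_max_left _ _

theorem clampUnit_le_one (t : ℝ) : clampUnit t ≤ 1 := max_le zero_le_one (min_le_right _ _)

theorem measurable_clampUnit : Measurable clampUnit :=
  measurable_const.max (measurable_id.min measurable_const)

variable {ι F : Type*} [Fintype ι] [MeasurableSpace F]

/-- The average of the first `l + 1` samples of `ψ`. -/
def sampleMean {V : Type*} [AddCommGroup V] [Module ℝ V] (ψ : EuclideanSpace ℝ ι → F → V)
    (h : ℕ → F) (l : ℕ) (x : EuclideanSpace ℝ ι) : V :=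
  ((l : ℝ) + 1)⁻¹ • ∑ i ∈ Finset.range (l + 1), ψ x (h i)

/-- The smoothing width at step `l`. -/
def smoothWidth (l : ℕ) : ℝ := ((l : ℝ) + 1) ^ (-(3 / 4) : ℝ)

theorem smoothWidth_pos (l : ℕ) : 0 < smoothWidth l := Real.rpow_pos_of_pos (by positivity) _

/-- The properties of typical samples `h` along iterates `x` in `X` that the convergence analysis
of the algorithm uses. -/
structure TypicalPath (ν : Measure F) (X : Set (EuclideanSpace ℝ ι))
    (ψ : EuclideanSpace ℝ ι → F → ℝ) (g : EuclideanSpace ℝ ι → F → EuclideanSpace ℝ ι)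
    (L : F → ℝ) (β : ℕ → ℝ) (h : ℕ → F) (x : ℕ → EuclideanSpace ℝ ι) : Prop where
  bound : ∃ C : ℝ, 0 ≤ C ∧ ∀ n : ℕ, ∑ i ∈ Finset.range (n + 1), L (h i) ≤ C * ((n : ℝ) + 1)
  rate_fun : ∃ C : ℝ, 0 ≤ C ∧ ∀ n : ℕ, ∀ y ∈ X,
    |sampleMean ψ h n y - ∫ s, ψ y s ∂ν| ≤ C * ((n : ℝ) + 1) ^ (-(3 / 8) : ℝ)
  rate_grad : ∃ C : ℝ, 0 ≤ C ∧ ∀ n : ℕ, ∀ y ∈ X,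
    ‖sampleMean g h n y - ∫ s, g y s ∂ν‖ ≤ C * ((n : ℝ) + 1) ^ (-(3 / 8) : ℝ)
  noise_tendsto :
    Tendsto (recAverage β fun l => g (x l) (h l) - ∫ s, g (x l) s ∂ν) atTop (𝓝 0)
  noise_summable : Summable fun l =>
    β l * ‖recAverage β (fun l => g (x l) (h l) - ∫ s, g (x l) s ∂ν) l‖ ^ 2
  penalty_tendsto : ∃ a, Tendsto (fun n => ∑ l ∈ Finset.range n,
    clampUnit (sampleMean ψ h l (x (l + 1)) / smoothWidth l)
      * (((l : ℝ) + 2)⁻¹ * (ψ (x (l + 1)) (h (l + 1)) - ∫ s, ψ (x (l + 1)) s ∂ν))) atTop (𝓝 a)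
  penalty_summable : Summable fun l : ℕ =>
    (((l : ℝ) + 2)⁻¹ * (ψ (x (l + 1)) (h (l + 1)) - ∫ s, ψ (x (l + 1)) s ∂ν)) ^ 2 / smoothWidth l

omit [Fintype ι] in
theorem recAverage_apply (β : ℕ → ℝ) (n : ℕ → EuclideanSpace ℝ ι) (l : ℕ) (i : ι) :
    recAverage β n l i = recAverage β (fun l => n l i) l := by
  induction l with
  | zero => simp [recAverage]
  | succ l ih => simp [recAverage, ih]

/-- The terms are of order `l ^ (-2 + 3/4) = l ^ (-5/4)`. Summability requires a width exponent
below 1; square summability of the widths requires one above 1/2. The choice 3/4 meets both. -/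
theorem summable_penalty_weights :
    Summable fun l : ℕ => (((l : ℝ) + 2)⁻¹) ^ 2 / smoothWidth l := by
  have hs : Summable fun l : ℕ => ((l + 1 : ℕ) : ℝ) ^ (-(5 / 4) : ℝ) :=
    (summable_nat_add_iff 1 (f := fun l : ℕ => (l : ℝ) ^ (-(5 / 4) : ℝ))).2
      (Real.summable_nat_rpow.2 (by norm_num))
  refine Summable.of_nonneg_of_le (fun l => ?_) (fun l => ?_) hs
  · have := smoothWidth_pos l
    positivity
  · have hl : (0 : ℝ) < (l : ℝ) + 1 := by positivity
    rw [div_le_iff₀ (smoothWidth_pos l), smoothWidth]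
    push_cast
    rw [← Real.rpow_add hl, inv_pow]
    have : (-(5 / 4) : ℝ) + -(3 / 4) = -((2 : ℕ) : ℝ) := by norm_num
    rw [this, Real.rpow_neg hl.le, Real.rpow_natCast]
    gcongr
    linarith

variable {Ω : Type*} [mΩ : MeasurableSpace Ω] {μ : Measure Ω} [IsProbabilityMeasure μ]
  {ν : Measure F} {H : ℕ → Ω → F} {X : Set (EuclideanSpace ℝ ι)}
  {ψ : EuclideanSpace ℝ ι → F → ℝ} {g : EuclideanSpace ℝ ι → F → EuclideanSpace ℝ ι} {L : F → ℝ}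

/-- The centred version of a function of the sample, truncated to `X`. -/
def centred (ν : Measure F) (X : Set (EuclideanSpace ℝ ι)) (ψ : EuclideanSpace ℝ ι → F → ℝ)
    (y : EuclideanSpace ℝ ι) (h : F) : ℝ :=
  X.indicator (fun y => ψ y h) y - ∫ s, X.indicator (fun y => ψ y s) y ∂ν

omit [Fintype ι] in
-- Martingale arguments need bounds at every parameter value, also for paths that leave `X`. The
-- truncated function has them and agrees with the original one on paths that stay in `X`.
theorem centred_of_mem {y : EuclideanSpace ℝ ι} (hy : y ∈ X) (h : F) :
    centred ν X ψ y h = ψ y h - ∫ s, ψ y s ∂ν := by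
  simp [centred, hy]

omit [Fintype ι] in
theorem measurable_centred [SFinite ν] (hX : MeasurableSet X)
    (hψ : Measurable (Function.uncurry ψ)) :
    Measurable (Function.uncurry (centred ν X ψ)) := by
  have hi : Measurable (Function.uncurry fun y h => X.indicator (fun y => ψ y h) y) := by
    have : (Function.uncurry fun y h => X.indicator (fun y => ψ y h) y)
        = (Prod.fst ⁻¹' X).indicator (Function.uncurry ψ) := by
      ext ⟨y, h⟩
      by_cases hy : y ∈ X <;> simp [hy]
    rw [this]
    exact hψ.indicator (measurable_fst hX)
  exact hi.sub ((hi.stronglyMeasurable.integral_prod_right').measurable.comp measurable_fst)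

omit [Fintype ι] in
theorem abs_centred_le (hL : Integrable L ν) (hL0 : ∀ h, 0 ≤ L h)
    (hb : ∀ y ∈ X, ∀ h, |ψ y h| ≤ L h) (y : EuclideanSpace ℝ ι) (h : F) :
    |centred ν X ψ y h| ≤ L h + ∫ s, L s ∂ν := by
  by_cases hy : y ∈ X
  · rw [centred_of_mem hy]
    exact (abs_sub _ _).trans (add_le_add (hb y hy h) (norm_integral_le_of_norm_le (f := ψ y) hL
      (Eventually.of_forall (hb y hy))))
  · simp only [centred, hy, not_false_eq_true, Set.indicator_of_notMem, integral_zero, sub_zero,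
      abs_zero]
    exact add_nonneg (hL0 h) (integral_nonneg hL0)

omit [Fintype ι] in
theorem integral_centred [IsProbabilityMeasure ν] (hL : Integrable L ν)
    (hψ : Measurable (Function.uncurry ψ)) (hb : ∀ y ∈ X, ∀ h, |ψ y h| ≤ L h)
    (y : EuclideanSpace ℝ ι) : ∫ h, centred ν X ψ y h ∂ν = 0 := by
  by_cases hy : y ∈ X
  · have hi : Integrable (ψ y) ν :=
      hL.mono' (hψ.comp measurable_prodMk_left).aestronglyMeasurable
        (Eventually.of_forall (hb y hy))
    simp only [centred_of_mem hy]
    rw [integral_sub hi (integrable_const _)]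
    simp
  · simp [centred, hy]

/-- Almost every path that stays in `X` is typical. -/
theorem IsSampling.ae_typicalPath (hs : IsSampling μ ν H) (hL : ∀ p : ℕ, MemLp L p ν)
    (hL0 : ∀ h, 0 ≤ L h) {R : ℕ} (hXR : ∀ x ∈ X, ‖x‖ ≤ R) (hXm : MeasurableSet X)
    (hS : RegularSample X ψ g L) {β : ℕ → ℝ} (hβ : ∀ l, 0 < β l ∧ β l ≤ 1)
    (hβ_sum : Tendsto (fun n => ∑ l ∈ Finset.range n, β l) atTop atTop)
    (hβ_sq : Summable fun l => β l ^ 2) {x : ℕ → Ω → EuclideanSpace ℝ ι}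
    (hx : ∀ l, Measurable[past H l] (x l)) :
    ∀ᵐ ω ∂μ, (∀ l, x l ω ∈ X) →
      TypicalPath ν X ψ g L β (fun l => H l ω) (fun l => x l ω) := by
  have hν := hs.isProbabilityMeasure
  have hLi : Integrable L ν := by simpa using (hL 1).integrable (by simp)
  have hgm : ∀ i, Measurable (Function.uncurry fun y h => g y h i) := fun i =>
    (EuclideanSpace.proj (𝕜 := ℝ) i : EuclideanSpace ℝ ι →L[ℝ] ℝ).continuous.measurable.comp
      hS.measurable_grad
  have hgb : ∀ i, ∀ y ∈ X, ∀ h, |g y h i| ≤ L h := fun i y hy h =>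
    (PiLp.norm_apply_le (g y h) i).trans (hS.norm_grad_le y hy h)
  set m : ℝ := ∫ s, L s ∂ν with hm
  have hL' : MemLp (fun h => L h + m) 2 ν := (hL 2).add (memLp_const m)
  -- uniform rates
  have r0 : ∀ᵐ ω ∂μ, ∃ C : ℝ, ∀ n : ℕ, ∀ y ∈ X,
      |(∑ i ∈ Finset.range (n + 1), ψ y (H i ω)) / ((n : ℝ) + 1) - ∫ h, ψ y h ∂ν|
        ≤ C * ((n : ℝ) + 1) ^ (-(3 / 8) : ℝ) := by
    have hR : (1 : ℝ) ≤ 1 + 2 * R := by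
      linarith [Nat.cast_nonneg (α := ℝ) R]
    refine hs.ae_uniform_rate (L := fun h => (1 + 2 * R) * L h) (fun p => (hL p).const_mul _)
      (fun h => mul_nonneg (by positivity) (hL0 h)) hXR
      (fun y _ => hS.measurable_fun.comp measurable_prodMk_left)
      (fun y hy h => (hS.abs_le y hy h).trans (le_mul_of_one_le_left (hL0 h) hR))
      (fun y hy z hz h => hS.lipschitz hXR hz hy h)
  have r1 : ∀ᵐ ω ∂μ, ∀ i, ∃ C : ℝ, ∀ n : ℕ, ∀ y ∈ X,
      |(∑ j ∈ Finset.range (n + 1), g y (H j ω) i) / ((n : ℝ) + 1) - ∫ h, g y h i ∂ν|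
        ≤ C * ((n : ℝ) + 1) ^ (-(3 / 8) : ℝ) := by
    refine ae_all_iff.2 fun i => hs.ae_uniform_rate (ψ := fun y h => g y h i) hL hL0 hXR
      (fun y _ => (hgm i).comp measurable_prodMk_left) (hgb i) fun y hy z hz h => ?_
    exact (PiLp.norm_apply_le (g y h - g z h) i).trans (hS.grad_lipschitz z hz y hy h)
  -- gradient noise
  have r2 : ∀ᵐ ω ∂μ, ∀ i,
      Tendsto (recAverage β fun l => centred ν X (fun y h => g y h i) (x l ω) (H l ω)) atTop (𝓝 0)
      ∧ Summable fun l => β l *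
        (recAverage β (fun l => centred ν X (fun y h => g y h i) (x l ω) (H l ω)) l) ^ 2 :=
    ae_all_iff.2 fun i => hs.ae_recAverage hx (measurable_centred hXm (hgm i))
      (integral_centred hLi (hgm i) (hgb i)) hL' (abs_centred_le hLi hL0 (hgb i)) hβ hβ_sum hβ_sq
  -- penalty noise
  set t : ℕ → Ω → ℝ := fun l ω => match l with
    | 0 => 0
    | l + 1 => sampleMean ψ (fun i => H i ω) l (x (l + 1) ω) / smoothWidth l with ht
  -- The slope argument with index `l + 1` involves only the samples `0, ..., l` and `x (l + 1)`, so
  -- it is known before sample `l + 1` arrives. The value at index 0 is a filler whose slope is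
  -- zero.
  have htm : ∀ l, Measurable[past H l] (t l) := by
    intro l
    cases l with
    | zero => exact measurable_const
    | succ l =>
      have h1 : Measurable[past H (l + 1)] fun ω =>
          ∑ i ∈ Finset.range (l + 1), ψ (x (l + 1) ω) (H i ω) :=
        Finset.measurable_sum (m := past H (l + 1)) _ fun i hi =>
          hS.measurable_fun.comp
            ((hx (l + 1)).prodMk (measurable_past H (Finset.mem_range.1 hi)))
      exact (h1.const_smul (((l : ℝ) + 1)⁻¹)).div_const (smoothWidth l)
  have hcm := measurable_centred (ν := ν) hXm hS.measurable_fun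
  have r3 := hs.ae_exists_tendsto_sum (Y := fun l ω => (t l ω, x l ω))
    (ψ := fun l y h => clampUnit y.1 * (((l : ℝ) + 1)⁻¹ * centred ν X ψ y.2 h))
    (c := fun l => ((l : ℝ) + 1)⁻¹) (L := fun h => L h + m)
    (fun l => (htm l).prodMk (hx l))
    (fun l => (measurable_clampUnit.comp (measurable_fst.comp measurable_fst)).mul
      ((hcm.comp ((measurable_snd.comp measurable_fst).prodMk measurable_snd)).const_mul _))
    (fun l y => by
      rw [integral_const_mul, integral_const_mul,
        integral_centred hLi hS.measurable_fun hS.abs_le, mul_zero, mul_zero])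
    (by
      have := (summable_nat_add_iff 1 (f := fun n : ℕ => ((n : ℝ) ^ 2)⁻¹)).2
        (Real.summable_nat_pow_inv.2 (by norm_num))
      refine this.congr fun l => ?_
      push_cast
      rw [inv_pow]) hL'
    (fun l y h => by
      rw [abs_mul, abs_mul, abs_of_nonneg (clampUnit_nonneg _),
        abs_of_pos (by positivity : (0 : ℝ) < ((l : ℝ) + 1)⁻¹)]
      refine (mul_le_of_le_one_left (by positivity) (clampUnit_le_one _)).trans ?_
      exact mul_le_mul_of_nonneg_left (abs_centred_le hLi hL0 hS.abs_le _ _) (by positivity))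
  have hcL : ∀ l, MemLp (fun ω => centred ν X ψ (x l ω) (H l ω)) 2 μ := fun l =>
    hs.memLp_increment (hx l) hcm hL' (c := 1)
      (fun y h => by rw [one_mul]; exact abs_centred_le hLi hL0 hS.abs_le y h)
  have r4 : ∀ᵐ ω ∂μ, Summable fun l : ℕ => (((l : ℝ) + 2)⁻¹) ^ 2 / smoothWidth l
      * centred ν X ψ (x (l + 1) ω) (H (l + 1) ω) ^ 2 := by
    have hw : ∀ l : ℕ, 0 ≤ (((l : ℝ) + 2)⁻¹) ^ 2 / smoothWidth l := fun l =>
      div_nonneg (sq_nonneg _) (smoothWidth_pos l).le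
    refine ae_summable_of_summable_integral (fun l ω => mul_nonneg (hw l) (sq_nonneg _))
      (fun l => (hcL (l + 1)).integrable_sq.const_mul _) ?_
    refine Summable.of_nonneg_of_le
      (fun l => integral_nonneg fun ω => mul_nonneg (hw l) (sq_nonneg _)) (fun l => ?_)
      (summable_penalty_weights.mul_right (∫ h, (L h + m) ^ 2 ∂ν))
    rw [integral_const_mul]
    refine mul_le_mul_of_nonneg_left ?_ (hw l)
    have := hs.integral_increment_sq_le (hx (l + 1)) hcm hL' (c := 1)
      (fun y h => by rw [one_mul]; exact abs_centred_le hLi hL0 hS.abs_le y h)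
    simpa using this
  filter_upwards [hs.ae_exists_sum_le hLi, r0, r1, r2, r3, r4] with ω h5 h0 h1 h2 h3 h4 hω
  have hmean : ∀ y ∈ X, ∀ i, (∫ s, g y s ∂ν) i = ∫ s, g y s i ∂ν := fun y hy i =>
    ((EuclideanSpace.proj (𝕜 := ℝ) i : EuclideanSpace ℝ ι →L[ℝ] ℝ).integral_comp_comm
      (hS.integrable_grad hLi hy)).symm
  have hrpos : ∀ n : ℕ, (0 : ℝ) ≤ ((n : ℝ) + 1) ^ (-(3 / 8) : ℝ) := fun n => by positivity
  have hcoord : ∀ i l, recAverage β (fun l => g (x l ω) (H l ω) - ∫ s, g (x l ω) s ∂ν) l i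
      = recAverage β (fun l => centred ν X (fun y h => g y h i) (x l ω) (H l ω)) l := by
    intro i l
    rw [recAverage_apply]
    congr 1
    funext l
    rw [centred_of_mem (hω l), PiLp.sub_apply, hmean _ (hω l)]
  refine ⟨h5, ?_, ?_, ?_, ?_, ?_, ?_⟩
  · obtain ⟨C, hC⟩ := h0
    refine ⟨max C 0, le_max_right _ _, fun n y hy => ?_⟩
    have := hC n y hy
    rw [sampleMean, smul_eq_mul, inv_mul_eq_div]
    exact this.trans (mul_le_mul_of_nonneg_right (le_max_left _ _) (hrpos n))
  · choose C hC using h1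
    refine ⟨∑ i, max (C i) 0, Finset.sum_nonneg fun i _ => le_max_right _ _, fun n y hy => ?_⟩
    refine (EuclideanSpace.norm_le_sum_abs _).trans ?_
    rw [Finset.sum_mul]
    refine Finset.sum_le_sum fun i _ => ?_
    have := hC i n y hy
    rw [PiLp.sub_apply, hmean y hy, sampleMean, PiLp.smul_apply, smul_eq_mul, inv_mul_eq_div]
    have e : (∑ j ∈ Finset.range (n + 1), g y (H j ω)) i
        = ∑ j ∈ Finset.range (n + 1), g y (H j ω) i :=
      map_sum (EuclideanSpace.proj (𝕜 := ℝ) i : EuclideanSpace ℝ ι →L[ℝ] ℝ) _ _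
    rw [e]
    exact this.trans (mul_le_mul_of_nonneg_right (le_max_left _ _) (hrpos n))
  · have h6 : ∀ i, Tendsto (fun l =>
        |recAverage β (fun l => g (x l ω) (H l ω) - ∫ s, g (x l ω) s ∂ν) l i|) atTop (𝓝 0) := by
      intro i
      simp only [hcoord]
      simpa using (h2 i).1.abs
    have h7 := tendsto_finsetSum Finset.univ fun i _ => h6 i
    rw [Finset.sum_const_zero] at h7
    exact squeeze_zero_norm (fun l => EuclideanSpace.norm_le_sum_abs _) h7
  · have h6 := summable_sum fun i (_ : i ∈ Finset.univ) => (h2 i).2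
    refine h6.congr fun l => ?_
    rw [EuclideanSpace.real_norm_sq_eq, Finset.mul_sum]
    exact Finset.sum_congr rfl fun i _ => by rw [hcoord]
  · obtain ⟨a, ha⟩ := h3
    refine ⟨a, ((tendsto_add_atTop_iff_nat 1).2 ha).congr fun n => ?_⟩
    rw [Finset.sum_range_succ']
    have e0 : clampUnit (t 0 ω) = 0 := by simp [ht, clampUnit]
    rw [e0, zero_mul, add_zero]
    refine Finset.sum_congr rfl fun l _ => ?_
    simp only [ht]
    rw [centred_of_mem (hω (l + 1))]
    push_cast
    ring_nf
  · refine h4.congr fun l => ?_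
    rw [centred_of_mem (hω (l + 1)), mul_pow]
    ring

end Path

/-! ### Lagrange multipliers for convex programs -/

section Duality

variable {E J : Type*} [AddCommGroup E] [Module ℝ E] [Fintype J]

/-- Strong duality for convex programs that satisfy the Slater condition. -/
theorem exists_multipliers_of_slater {χ : Set E} {o : E → ℝ}
    (ho : ConvexOn ℝ χ o) {φ : J → E → ℝ} (hφ : ∀ k, ConvexOn ℝ χ (φ k)) {z : E} (hz : z ∈ χ)
    (hφz : ∀ k, φ k z ≤ 0) (hmin : ∀ y ∈ χ, (∀ k, φ k y ≤ 0) → o z ≤ o y)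
    {w : E} (hw : w ∈ χ) (hφw : ∀ k, φ k w < 0) :
    ∃ lam : J → ℝ, (∀ k, 0 ≤ lam k) ∧ (∀ k, lam k * φ k z = 0) ∧
      ∀ y ∈ χ, o z ≤ o y + ∑ k, lam k * φ k y := by
  classical
  -- The constraint levels and objective excesses that can be strictly exceeded form an open convex
  -- set. Optimality of `z` keeps the origin out of it, and a separating functional has the
  -- multipliers as coefficients.
  set A : Set ((J → ℝ) × ℝ) := {p | ∃ y ∈ χ, (∀ k, φ k y < p.1 k) ∧ o y - o z < p.2} with hA
  have hconv : Convex ℝ A := by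
    rintro ⟨u, r⟩ ⟨y, hy, hyu, hyr⟩ ⟨u', r'⟩ ⟨y', hy', hyu', hyr'⟩ a b ha hb hab
    refine ⟨a • y + b • y', ho.1 hy hy' ha hb hab, fun k => ?_, ?_⟩
    · have h1 := (hφ k).2 hy hy' ha hb hab
      have h2 := hyu k
      have h3 := hyu' k
      simp only [smul_eq_mul, Prod.fst_add, Prod.smul_fst, Pi.add_apply, Pi.smul_apply] at *
      rcases ha.eq_or_lt with rfl | ha'
      · have : b = 1 := by linarith
        subst this; linarith
      · nlinarith [mul_lt_mul_of_pos_left h2 ha', mul_le_mul_of_nonneg_left h3.le hb]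
    · have h1 := ho.2 hy hy' ha hb hab
      simp only [smul_eq_mul, Prod.snd_add, Prod.smul_snd] at *
      have e : a * (o y - o z) + b * (o y' - o z) = a * o y + b * o y' - o z := by
        rw [mul_sub, mul_sub]; linear_combination (-o z) * hab
      rcases ha.eq_or_lt with rfl | ha'
      · have : b = 1 := by linarith
        subst this; linarith
      · nlinarith [mul_lt_mul_of_pos_left hyr ha', mul_le_mul_of_nonneg_left hyr'.le hb]
  have hopen : IsOpen A := by
    have : A = ⋃ y ∈ χ, {p : (J → ℝ) × ℝ | (∀ k, φ k y < p.1 k) ∧ o y - o z < p.2} := by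
      ext p; simp only [hA, Set.mem_ofPred_eq, Set.mem_iUnion, exists_prop]
    rw [this]
    refine isOpen_biUnion fun y _ => IsOpen.and ?_ (isOpen_lt continuous_const continuous_snd)
    have : {p : (J → ℝ) × ℝ | ∀ k, φ k y < p.1 k} = ⋂ k, {p | φ k y < p.1 k} := by ext; simp
    rw [this]
    exact isOpen_iInter_of_finite fun k => isOpen_lt continuous_const (by fun_prop)
  have h0 : (0 : (J → ℝ) × ℝ) ∉ A := by
    rintro ⟨y, hy, hyu, hyr⟩
    have := hmin y hy fun k => (hyu k).le
    simp only [Prod.snd_zero] at hyr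
    linarith
  obtain ⟨f, hf⟩ := geometric_hahn_banach_point_open hconv hopen h0
  rw [map_zero] at hf
  set m : J → ℝ := fun k => f (Pi.single k 1, 0) with hm
  set m0 : ℝ := f (0, 1) with hm0
  have hrep : ∀ u r, f (u, r) = ∑ k, u k * m k + r * m0 := by
    intro u r
    have e : ((u, r) : (J → ℝ) × ℝ)
        = ∑ k, u k • ((Pi.single k 1, 0) : (J → ℝ) × ℝ) + r • ((0, 1) : (J → ℝ) × ℝ) := by
      refine Prod.ext ?_ ?_
      · rw [Prod.fst_add, Prod.fst_sum]
        funext i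
        simp [Finset.sum_apply, Pi.single_apply]
      · rw [Prod.snd_add, Prod.snd_sum]
        simp
    rw [e, map_add, map_sum, map_smul, smul_eq_mul]
    simp only [map_smul, smul_eq_mul, hm, hm0]
  have hwA : ∀ k : J, ∀ t : ℝ, 0 ≤ t → (Pi.single k t, o w - o z + 1) ∈ A := by
    intro k t ht
    refine ⟨w, hw, fun i => (hφw i).trans_le ?_, by simp⟩
    by_cases h : i = k
    · subst h; simpa using ht
    · simp [h]
  have hw0 : ((0 : J → ℝ), o w - o z + 1) ∈ A := ⟨w, hw, hφw, by simp⟩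
  have nonneg_of : ∀ a b : ℝ, (∀ t, 0 ≤ t → 0 < a + t * b) → 0 ≤ b := by
    intro a b hab
    by_contra hb
    push Not at hb
    have := hab (|a| / -b) (div_nonneg (abs_nonneg _) (by linarith))
    have e : |a| / -b * b = -|a| := by rw [div_neg, neg_mul, div_mul_cancel₀ _ hb.ne]
    rw [e] at this
    linarith [le_abs_self a]
  have hmk : ∀ k, 0 ≤ m k := fun k => nonneg_of ((o w - o z + 1) * m0) (m k) fun t ht => by
    have := hf _ (hwA k t ht)
    rw [hrep] at this
    have e : ∑ i, (Pi.single k t : J → ℝ) i * m i = t * m k := by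
      rw [Finset.sum_eq_single k (fun i _ hi => by simp [hi]) (by simp)]
      simp
    linarith
  have hm0' : 0 ≤ m0 := nonneg_of ((o w - o z + 1) * m0) m0 fun t ht => by
    have := hf ((0 : J → ℝ), o w - o z + 1 + t) ⟨w, hw, hφw, by
      change o w - o z < o w - o z + 1 + t
      linarith⟩
    rw [hrep] at this
    simp only [Pi.zero_apply, zero_mul, Finset.sum_const_zero, zero_add] at this
    linarith
  have hlag : ∀ y ∈ χ, 0 ≤ ∑ k, φ k y * m k + (o y - o z) * m0 := by
    intro y hy
    refine le_of_forall_pos_le_add fun ε hε => ?_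
    -- A slack of `ε / T` in every coordinate moves the boundary point into `A` and costs `ε - ε /
    -- T`, less than `ε`.
    set T : ℝ := ∑ k, m k + m0 + 1 with hT
    have hTpos : 0 < T := by
      have := Finset.sum_nonneg fun k (_ : k ∈ Finset.univ) => hmk k
      linarith
    have hδ : 0 < ε / T := div_pos hε hTpos
    have := hf (fun k => φ k y + ε / T, o y - o z + ε / T)
      ⟨y, hy, fun k => by
        change φ k y < φ k y + ε / T
        linarith, by
        change o y - o z < o y - o z + ε / T
        linarith⟩
    rw [hrep] at this
    simp only [add_mul, Finset.sum_add_distrib, ← Finset.mul_sum] at this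
    have e : ε / T * ∑ k, m k + ε / T * m0 = ε - ε / T := by
      have : ε / T * T = ε := div_mul_cancel₀ _ hTpos.ne'
      have h2 : ε / T * T = ε / T * ∑ k, m k + ε / T * m0 + ε / T := by rw [hT]; ring
      linarith
    linarith
  -- The Slater point excludes a vertical hyperplane: `A` contains a point with zero constraint
  -- coordinates, where the functional would vanish if `m0 = 0`.
  have hm0pos : 0 < m0 := by
    refine lt_of_le_of_ne hm0' fun h => ?_
    have h1 := hf _ hw0
    rw [hrep] at h1
    simp only [Pi.zero_apply, zero_mul, Finset.sum_const_zero, zero_add, ← h, mul_zero] at h1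
    exact lt_irrefl _ h1
  have hlag' : ∀ y ∈ χ, o z ≤ o y + ∑ k, m k / m0 * φ k y := by
    intro y hy
    have h1 := div_nonneg (hlag y hy) hm0pos.le
    have e : (∑ k, φ k y * m k + (o y - o z) * m0) / m0
        = ∑ k, m k / m0 * φ k y + (o y - o z) := by
      rw [add_div, mul_div_cancel_right₀ _ hm0pos.ne', Finset.sum_div]
      congr 1
      exact Finset.sum_congr rfl fun k _ => by ring
    rw [e] at h1
    linarith
  refine ⟨fun k => m k / m0, fun k => div_nonneg (hmk k) hm0pos.le, fun k => ?_, hlag'⟩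
  have hle : ∀ i ∈ Finset.univ, m i / m0 * φ i z ≤ 0 := fun i _ =>
    mul_nonpos_of_nonneg_of_nonpos (div_nonneg (hmk i) hm0pos.le) (hφz i)
  have hsum : ∑ i, m i / m0 * φ i z = 0 :=
    le_antisymm (Finset.sum_nonpos hle) (by linarith [hlag' z hz])
  exact (Finset.sum_eq_zero_iff_of_nonpos hle).1 hsum k (Finset.mem_univ k)

end Duality

/-! ### The smoothed positive part -/

section Huber

/-- A smoothed positive part, with slope `clampUnit (a / s)`. -/
def smoothPos (s a : ℝ) : ℝ := clampUnit (a / s) * a - s * clampUnit (a / s) ^ 2 / 2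

variable {s : ℝ}

/-- The variational inequality for the projection of `a / s` onto the unit interval, multiplied by
`s`. -/
theorem clampUnit_obtuse (hs : 0 < s) (a : ℝ) {t : ℝ} (h0 : 0 ≤ t) (h1 : t ≤ 1) :
    (t - clampUnit (a / s)) * (a - s * clampUnit (a / s)) ≤ 0 := by
  unfold clampUnit
  have e : a = s * (a / s) := by field_simp
  set c := a / s with hc
  rw [e]
  rcases le_total c 0 with hc0 | hc0
  · rw [min_eq_left (hc0.trans zero_le_one), max_eq_left hc0]
    nlinarith [mul_nonneg h0 hs.le, mul_nonneg (mul_nonneg h0 hs.le) (neg_nonneg.2 hc0)]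
  · rcases le_total c 1 with hc1 | hc1
    · rw [min_eq_left hc1, max_eq_right hc0]; simp
    · rw [min_eq_right hc1, max_eq_right zero_le_one]
      have : 0 ≤ s * (c - 1) := mul_nonneg hs.le (by linarith)
      nlinarith

/-- The smoothed positive part is the maximum of `t * a - s * t ^ 2 / 2` over the unit interval,
attained at `clampUnit (a / s)`. Its convexity and its dependence on the width follow by inserting a
suboptimal `t`. -/
theorem mul_sub_le_smoothPos (hs : 0 < s) (a : ℝ) {t : ℝ} (h0 : 0 ≤ t) (h1 : t ≤ 1) :
    t * a - s * t ^ 2 / 2 ≤ smoothPos s a := by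
  have h := clampUnit_obtuse hs a h0 h1
  unfold smoothPos
  nlinarith [mul_nonneg hs.le (sq_nonneg (t - clampUnit (a / s)))]

theorem smoothPos_nonneg (hs : 0 < s) (a : ℝ) : 0 ≤ smoothPos s a := by
  simpa using mul_sub_le_smoothPos hs a le_rfl zero_le_one

theorem smoothPos_sub_le (hs : 0 < s) (a b : ℝ) :
    smoothPos s b - smoothPos s a ≤ clampUnit (b / s) * (b - a) := by
  have h := mul_sub_le_smoothPos hs a (clampUnit_nonneg (b / s)) (clampUnit_le_one (b / s))
  have e : smoothPos s b = clampUnit (b / s) * b - s * clampUnit (b / s) ^ 2 / 2 := rfl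
  rw [e]
  linarith

/-- The slope is Lipschitz with constant `1 / s`, which gives a quadratic upper bound. -/
theorem smoothPos_add_le (hs : 0 < s) (a v : ℝ) :
    smoothPos s (a + v) ≤ smoothPos s a + clampUnit (a / s) * v + v ^ 2 / (2 * s) := by
  have h := clampUnit_obtuse hs a (clampUnit_nonneg ((a + v) / s)) (clampUnit_le_one _)
  have e : smoothPos s (a + v)
      = clampUnit ((a + v) / s) * (a + v) - s * clampUnit ((a + v) / s) ^ 2 / 2 := rfl
  rw [e, smoothPos]
  set t := clampUnit (a / s)
  set t' := clampUnit ((a + v) / s)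
  have h2 : (t' - t) * v - s * (t' - t) ^ 2 / 2 ≤ v ^ 2 / (2 * s) := by
    rw [le_div_iff₀ (by positivity)]
    nlinarith [sq_nonneg (v - s * (t' - t))]
  nlinarith

theorem smoothPos_le_add (hs : 0 < s) (a b : ℝ) : smoothPos s b ≤ smoothPos s a + |b - a| := by
  have h := smoothPos_sub_le hs a b
  have h2 : clampUnit (b / s) * (b - a) ≤ |b - a| := by
    refine (le_abs_self _).trans ?_
    rw [abs_mul, abs_of_nonneg (clampUnit_nonneg _)]
    exact mul_le_of_le_one_left (abs_nonneg _) (clampUnit_le_one _)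
  linarith

theorem smoothPos_le_of_width {s' : ℝ} (hs' : 0 < s') (hss : s' ≤ s) (a : ℝ) :
    smoothPos s' a ≤ smoothPos s a + (s - s') / 2 := by
  have hs : 0 < s := hs'.trans_le hss
  have h := mul_sub_le_smoothPos hs a (clampUnit_nonneg (a / s')) (clampUnit_le_one _)
  have h1 : clampUnit (a / s') ^ 2 ≤ 1 :=
    pow_le_one₀ (clampUnit_nonneg _) (clampUnit_le_one _)
  have e : smoothPos s' a = clampUnit (a / s') * a - s' * clampUnit (a / s') ^ 2 / 2 := rfl
  rw [e]
  nlinarith [mul_nonneg (sub_nonneg.2 hss) (sub_nonneg.2 h1)]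

/-- An exact penalty with a large weight dominates a Lagrange term up to the width. -/
theorem mul_le_penalty (hs : 0 < s) (a : ℝ) {lam ρ : ℝ} (h0 : 0 ≤ lam) (h1 : lam ≤ ρ) :
    lam * a ≤ ρ * (clampUnit (a / s) * a) + ρ * s := by
  have hρ : 0 ≤ ρ := h0.trans h1
  have h := clampUnit_obtuse hs a zero_le_one le_rfl
  have hc0 := clampUnit_nonneg (a / s)
  have hc1 := clampUnit_le_one (a / s)
  set t := clampUnit (a / s)
  have h2 : (1 - t) * a ≤ s := by
    have : s * t * (1 - t) ≤ s * 1 * 1 := by gcongr; linarith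
    nlinarith
  rcases le_total 0 a with ha | ha
  · have : lam * a ≤ ρ * a := mul_le_mul_of_nonneg_right h1 ha
    nlinarith [mul_le_mul_of_nonneg_left h2 hρ]
  · have h3 : t = 0 := by
      have : a / s ≤ 0 := div_nonpos_of_nonpos_of_nonneg ha hs.le
      exact max_eq_left ((min_le_left _ _).trans this)
    rw [h3]
    nlinarith [mul_nonneg h0 (neg_nonneg.2 ha), mul_nonneg hρ hs.le]

end Huber

/-! ### Tracking of a slowly moving target -/

section Tracking

variable {V : Type*} [NormedAddCommGroup V] [NormedSpace ℝ V]

theorem norm_recAverage_le {β : ℕ → ℝ} (hβ : ∀ l, 0 < β l ∧ β l ≤ 1) {v : ℕ → V} {m : ℝ}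
    (hv : ∀ l, ‖v l‖ ≤ m) (l : ℕ) : ‖recAverage β v l‖ ≤ m := by
  have hm : 0 ≤ m := (norm_nonneg _).trans (hv 0)
  induction l with
  | zero =>
    rw [recAverage, norm_smul, Real.norm_of_nonneg (hβ 0).1.le]
    exact (mul_le_of_le_one_left (norm_nonneg _) (hβ 0).2).trans (hv 0)
  | succ l ih =>
    rw [recAverage]
    refine (norm_add_le _ _).trans ?_
    have h1 : 0 ≤ 1 - β (l + 1) := by linarith [(hβ (l + 1)).2]
    rw [norm_smul, norm_smul, Real.norm_of_nonneg h1, Real.norm_of_nonneg (hβ (l + 1)).1.le]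
    have h2 := mul_le_mul_of_nonneg_left ih h1
    have h3 := mul_le_mul_of_nonneg_left (hv (l + 1)) (hβ (l + 1)).1.le
    linarith

omit [NormedSpace ℝ V] in
theorem recAverage_add [Module ℝ V] (β : ℕ → ℝ) (v w : ℕ → V) (l : ℕ) :
    recAverage β (fun l => v l + w l) l = recAverage β v l + recAverage β w l := by
  induction l with
  | zero => simp [recAverage]
  | succ l ih => simp only [recAverage, ih, smul_add]; abel

variable {α β d : ℕ → ℝ} {v : ℕ → V} {m : ℝ}

theorem recAverage_sub_succ (β : ℕ → ℝ) (v : ℕ → V) (l : ℕ) :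
    recAverage β v (l + 1) - v (l + 1 + 1)
      = (1 - β (l + 1)) • (recAverage β v l - v (l + 1)) + (v (l + 1) - v (l + 1 + 1)) := by
  rw [recAverage, sub_smul, one_smul, sub_smul, one_smul, smul_sub]
  abel

theorem norm_recAverage_sub_le (hβ : ∀ l, 0 < β l ∧ β l ≤ 1) (l : ℕ) :
    ‖recAverage β v (l + 1) - v (l + 1)‖ ≤ ‖recAverage β v l - v (l + 1)‖ := by
  have h1 : 0 ≤ 1 - β (l + 1) := by linarith [(hβ (l + 1)).2]
  have e : recAverage β v (l + 1) - v (l + 1)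
      = (1 - β (l + 1)) • (recAverage β v l - v (l + 1)) := by
    rw [recAverage, smul_sub, sub_smul 1 (β (l + 1)) (v (l + 1)), one_smul]
    abel
  rw [e, norm_smul, Real.norm_of_nonneg h1]
  exact mul_le_of_le_one_left (norm_nonneg _) (by linarith [(hβ (l + 1)).1])

/-- The lag behind the next target contracts by `1 - β` and grows by at most a multiple of `α`. It
is thus bounded by a recursive average of a multiple of `α / β`. -/
theorem tendsto_recAverage_sub (hα : ∀ l, 0 < α l ∧ α l ≤ 1) (hβ : ∀ l, 0 < β l ∧ β l ≤ 1)
    (hβ_sum : Tendsto (fun n => ∑ l ∈ Finset.range n, β l) atTop atTop)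
    (hαβ : Tendsto (fun l => α l / β l) atTop (𝓝 0)) {R : ℝ}
    (hm : 0 ≤ m) (hd : ∀ l, 0 ≤ d l ∧ d l ≤ R)
    (hv : ∀ l, ‖v (l + 1) - v l‖ ≤ m * (α l * d l)) :
    Tendsto (fun l => recAverage β v l - v l) atTop (𝓝 0) := by
  have hc : Tendsto (fun l => ‖recAverage β v l - v (l + 1)‖) atTop (𝓝 0) := by
    refine tendsto_zero_of_recursive_average (α := fun l => β (l + 1))
      (w := fun l => m * R * (α (l + 1) / β (l + 1)))
      (fun l => ⟨(hβ _).1.le, (hβ _).2⟩) (tendsto_sum_range_shift hβ_sum) (fun l => norm_nonneg _)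
      (Eventually.of_forall fun l => ?_) ?_
    · rw [recAverage_sub_succ]
      refine (norm_add_le _ _).trans ?_
      have h1 : 0 ≤ 1 - β (l + 1) := by linarith [(hβ (l + 1)).2]
      rw [norm_smul, Real.norm_of_nonneg h1]
      refine add_le_add le_rfl ?_
      rw [norm_sub_rev]
      refine (hv (l + 1)).trans ?_
      have hb := (hβ (l + 1)).1
      have e : β (l + 1) * (m * R * (α (l + 1) / β (l + 1))) = m * (α (l + 1) * R) := by
        field_simp
      rw [e]
      have := (hα (l + 1)).1.le
      have := (hd (l + 1)).2
      gcongr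
    · have := ((tendsto_add_atTop_iff_nat 1).2 hαβ).const_mul (m * R)
      rwa [mul_zero] at this
  rw [← tendsto_add_atTop_iff_nat 1]
  exact squeeze_zero_norm (fun l => norm_recAverage_sub_le hβ l) hc

/-- The target moves by `m * α * d`, so the squared lag gains at most `m ^ 2 * (α * d) ^ 2 / β`
while losing `β` times itself. Where `α ≤ δ * β`, telescoping bounds the weighted sum by a constant
plus `m ^ 2 * δ ^ 2` times that of `d ^ 2`. Thus the lag is charged to the very quantity whose
summability is sought, with an arbitrarily small factor. -/
theorem eventually_sum_recAverage_sub_le (hα : ∀ l, 0 < α l ∧ α l ≤ 1)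
    (hβ : ∀ l, 0 < β l ∧ β l ≤ 1)
    (hαβ : Tendsto (fun l => α l / β l) atTop (𝓝 0))
    (hv : ∀ l, ‖v (l + 1) - v l‖ ≤ m * (α l * d l)) {ε : ℝ} (hε : 0 < ε) :
    ∀ᶠ M in atTop, ∃ C : ℝ, ∀ n, M ≤ n →
      ∑ l ∈ Finset.Ico M n, α l * ‖recAverage β v l - v l‖ ^ 2
        ≤ C + ε * ∑ l ∈ Finset.Ico M n, α l * d l ^ 2 := by
  obtain ⟨δ, hδ, hδ1⟩ : ∃ δ : ℝ, 0 < δ ∧ m ^ 2 * δ ^ 2 ≤ ε := by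
    have hm1 : 0 < |m| + 1 := by positivity
    refine ⟨Real.sqrt ε / (|m| + 1), by positivity, ?_⟩
    rw [← mul_pow, ← sq_abs, abs_mul, abs_of_pos (by positivity : 0 < Real.sqrt ε / (|m| + 1))]
    calc (|m| * (Real.sqrt ε / (|m| + 1))) ^ 2
        ≤ ((|m| + 1) * (Real.sqrt ε / (|m| + 1))) ^ 2 := by gcongr; linarith
      _ = ε := by rw [mul_div_cancel₀ _ hm1.ne', Real.sq_sqrt hε.le]
  obtain ⟨M₀, hM₀⟩ := eventually_atTop.1 (hαβ.eventually_le_const hδ)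
  filter_upwards [eventually_ge_atTop (M₀ + 1)] with M hM
  obtain ⟨P, rfl⟩ : ∃ P, M = P + 1 := ⟨M - 1, by omega⟩
  set c : ℕ → V := fun l => recAverage β v l - v (l + 1) with hc
  refine ⟨δ * ‖c P‖ ^ 2, fun n hn => ?_⟩
  -- The potential `δ * ‖c‖ ^ 2` makes the induction telescope.
  have key : ∀ n, P + 1 ≤ n →
      ∑ l ∈ Finset.Ico (P + 1) n, α l * ‖recAverage β v l - v l‖ ^ 2 + δ * ‖c (n - 1)‖ ^ 2
        ≤ δ * ‖c P‖ ^ 2 + m ^ 2 * δ ^ 2 * ∑ l ∈ Finset.Ico (P + 1) n, α l * d l ^ 2 := by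
    intro n hn
    induction n, hn using Nat.le_induction with
    | base => simp
    | succ n hn ih =>
      obtain ⟨l, rfl⟩ : ∃ l, n = l + 1 := ⟨n - 1, by omega⟩
      rw [Finset.sum_Ico_succ_top hn, Finset.sum_Ico_succ_top hn]
      simp only [Nat.add_sub_cancel] at ih ⊢
      have hb0 := (hβ (l + 1)).1
      have hb1 := (hβ (l + 1)).2
      have ha0 := (hα (l + 1)).1
      have hr : α (l + 1) ≤ δ * β (l + 1) := by
        have := hM₀ (l + 1) (by omega)
        rwa [div_le_iff₀ hb0] at this
      have h1 : ‖recAverage β v (l + 1) - v (l + 1)‖ ^ 2 ≤ ‖c l‖ ^ 2 := by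
        gcongr
        exact norm_recAverage_sub_le hβ l
      have h2 : ‖c (l + 1)‖ ^ 2 ≤ (1 - β (l + 1)) * ‖c l‖ ^ 2
          + m ^ 2 * δ * (α (l + 1) * d (l + 1) ^ 2) := by
        have e : c (l + 1) = (1 - β (l + 1)) • c l + (v (l + 1) - v (l + 1 + 1)) :=
          recAverage_sub_succ β v l
        have h3 : ‖c (l + 1)‖ ≤ (1 - β (l + 1)) * ‖c l‖ + m * (α (l + 1) * d (l + 1)) := by
          rw [e]
          refine (norm_add_le _ _).trans ?_
          rw [norm_smul, Real.norm_of_nonneg (by linarith : 0 ≤ 1 - β (l + 1)),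
            norm_sub_rev (v (l + 1))]
          exact add_le_add le_rfl (hv (l + 1))
        set D := m * (α (l + 1) * d (l + 1)) with hD
        have h4 : ‖c (l + 1)‖ ^ 2 ≤ ((1 - β (l + 1)) * ‖c l‖ + D) ^ 2 := by gcongr
        -- Convexity of the square for the weights `1 - β` and `β`, with `D = β * (D / β)`.
        have h5 : ((1 - β (l + 1)) * ‖c l‖ + D) ^ 2
            ≤ (1 - β (l + 1)) * ‖c l‖ ^ 2 + D ^ 2 / β (l + 1) := by
          rw [← sub_nonneg]
          have : (1 - β (l + 1)) * ‖c l‖ ^ 2 + D ^ 2 / β (l + 1)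
              - ((1 - β (l + 1)) * ‖c l‖ + D) ^ 2
              = (1 - β (l + 1)) * (β (l + 1) * ‖c l‖ - D) ^ 2 / β (l + 1) := by
            field_simp; ring
          rw [this]
          exact div_nonneg (mul_nonneg (by linarith) (sq_nonneg _)) hb0.le
        have h6 : D ^ 2 / β (l + 1) ≤ m ^ 2 * δ * (α (l + 1) * d (l + 1) ^ 2) := by
          rw [div_le_iff₀ hb0, hD]
          have : 0 ≤ m ^ 2 * (α (l + 1) * d (l + 1) ^ 2) := by positivity
          nlinarith [mul_le_mul_of_nonneg_left hr this]
        linarith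
      have h7 : α (l + 1) * ‖recAverage β v (l + 1) - v (l + 1)‖ ^ 2
          ≤ δ * β (l + 1) * ‖c l‖ ^ 2 :=
        mul_le_mul hr h1 (sq_nonneg _) (by positivity)
      nlinarith [mul_le_mul_of_nonneg_left h2 hδ.le]
  have h := key n hn
  have h0 : 0 ≤ ∑ l ∈ Finset.Ico (P + 1) n, α l * d l ^ 2 :=
    Finset.sum_nonneg fun l _ => mul_nonneg (hα l).1.le (sq_nonneg _)
  have h1 := mul_le_mul_of_nonneg_right hδ1 h0
  have h2 : 0 ≤ δ * ‖c (n - 1)‖ ^ 2 := by positivity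
  linarith

end Tracking

/-! ### Quadratic surrogates -/

section QuadModel

variable {E : Type*} [NormedAddCommGroup E] [InnerProductSpace ℝ E]

/-- The quadratic model with value `a`, gradient `v` and curvature `2 t` at `x`. -/
def quadModel (a : ℝ) (v : E) (t : ℝ) (x y : E) : ℝ := a + inner ℝ v (y - x) + t * ‖y - x‖ ^ 2

theorem quadModel_combo (a : ℝ) (v : E) (t : ℝ) (x y z : E) {p q : ℝ} (hpq : p + q = 1) :
    quadModel a v t x (p • y + q • z)
      = p * quadModel a v t x y + q * quadModel a v t x z - p * q * t * ‖y - z‖ ^ 2 := by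
  have e : p • y + q • z - x = p • (y - x) + q • (z - x) := by
    have : x = (p + q) • x := by rw [hpq, one_smul]
    conv_lhs => rw [this]
    simp only [smul_sub, add_smul]; abel
  have e2 : y - z = (y - x) - (z - x) := by abel
  obtain rfl : q = 1 - p := by linarith
  unfold quadModel
  rw [e, e2]
  generalize y - x = Y
  generalize z - x = Z
  rw [norm_sub_sq_real, norm_add_sq_real, inner_add_right, inner_smul_right, inner_smul_right,
    norm_smul, norm_smul, real_inner_smul_left, real_inner_smul_right, mul_pow, mul_pow,
    Real.norm_eq_abs, Real.norm_eq_abs, sq_abs, sq_abs]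
  ring

theorem convexOn_quadModel {χ : Set E} (hχ : Convex ℝ χ) (a : ℝ) (v : E) {t : ℝ} (ht : 0 ≤ t)
    (x : E) : ConvexOn ℝ χ (quadModel a v t x) := by
  refine ⟨hχ, fun y _ z _ p q hp hq hpq => ?_⟩
  rw [quadModel_combo _ _ _ _ _ _ hpq, smul_eq_mul, smul_eq_mul]
  have : 0 ≤ p * q * t * ‖y - z‖ ^ 2 := by positivity
  linarith

theorem quadModel_self (a : ℝ) (v : E) (t : ℝ) (x : E) : quadModel a v t x x = a := by
  simp [quadModel]

theorem tendsto_quadModel {J : Type*} {u : Filter J} {a : J → ℝ} {v x : J → E} {a' : ℝ} {v' x' : E}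
    (ha : Tendsto a u (𝓝 a')) (hv : Tendsto v u (𝓝 v')) (hx : Tendsto x u (𝓝 x')) (t : ℝ) (y : E) :
    Tendsto (fun j => quadModel (a j) (v j) t (x j) y) u (𝓝 (quadModel a' v' t x' y)) := by
  have h1 := hx.const_sub y
  exact (ha.add (hv.inner h1)).add ((h1.norm.pow 2).const_mul t)

theorem quadModel_le (a : ℝ) (v : E) {t : ℝ} (ht : 0 ≤ t) (x y : E) {A V B : ℝ} (ha : a ≤ A)
    (hv : ‖v‖ ≤ V) (hB : ‖y - x‖ ≤ B) : quadModel a v t x y ≤ A + V * B + t * B ^ 2 := by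
  have h1 : inner ℝ v (y - x) ≤ V * B := (real_inner_le_norm _ _).trans
    (mul_le_mul hv hB (norm_nonneg _) ((norm_nonneg _).trans hv))
  have h2 : t * ‖y - x‖ ^ 2 ≤ t * B ^ 2 := by gcongr
  unfold quadModel
  linarith

/-- In the application the constraint set leaves the combiner and the beamformers unbounded. The
quadratic term alone keeps the surrogate solutions near the iterates. -/
theorem norm_sub_le_of_quadModel_le {a A V : ℝ} {v x y : E} {t : ℝ} (ht : 0 < t) (ha : |a| ≤ A)
    (hv : ‖v‖ ≤ V) (h : quadModel a v t x y ≤ A) : ‖y - x‖ ≤ 1 + (2 * A + V) / t := by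
  have hA : 0 ≤ A := (abs_nonneg _).trans ha
  have hV : 0 ≤ V := (norm_nonneg _).trans hv
  have h1 : -(V * ‖y - x‖) ≤ inner ℝ v (y - x) := by
    have := (abs_real_inner_le_norm v (y - x)).trans
      (mul_le_mul_of_nonneg_right hv (norm_nonneg _))
    exact (abs_le.1 this).1
  have h2 := (abs_le.1 ha).1
  unfold quadModel at h
  by_cases hd : ‖y - x‖ ≤ 1
  · have : 0 ≤ (2 * A + V) / t := by positivity
    linarith
  · push Not at hd
    have h3 : t * ‖y - x‖ ^ 2 ≤ (2 * A + V) * ‖y - x‖ := by nlinarith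
    have h4 : ‖y - x‖ ≤ (2 * A + V) / t := by
      rw [le_div_iff₀ ht]
      have : ‖y - x‖ * (‖y - x‖ * t) ≤ ‖y - x‖ * (2 * A + V) := by nlinarith
      exact le_of_mul_le_mul_left this (by linarith)
    linarith

/-- At a minimizer of a Lagrangian the strong convexity of the surrogates gives a decrease that is
quadratic in the distance. -/
theorem objective_le_of_multipliers {J : Type*} [Fintype J] {χ : Set E} (hχ : Convex ℝ χ)
    (o : E →L[ℝ] ℝ) {a τ lam : J → ℝ} {v : J → E} {x z : E} (hx : x ∈ χ) (hz : z ∈ χ)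
    (hc : ∀ k, lam k * quadModel (a k) (v k) (τ k) x z = 0)
    (hmin : ∀ y ∈ χ, o z ≤ o y + ∑ k, lam k * quadModel (a k) (v k) (τ k) x y) :
    o z ≤ o x + ∑ k, lam k * a k - (∑ k, lam k * τ k) * ‖z - x‖ ^ 2 := by
  -- The Lagrangian is tested on the segment from `z` to `x`. After division by `t`, the limit `t →
  -- 0` keeps the full curvature term.
  have key : ∀ t : ℝ, 0 < t → t ≤ 1 →
      o z ≤ o x + ∑ k, lam k * a k - (1 - t) * ((∑ k, lam k * τ k) * ‖z - x‖ ^ 2) := by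
    intro t ht ht1
    have h := hmin (t • x + (1 - t) • z) (hχ hx hz ht.le (by linarith) (by ring))
    have e : ∀ k, lam k * quadModel (a k) (v k) (τ k) x (t • x + (1 - t) • z)
        = t * (lam k * a k) - t * (1 - t) * ‖z - x‖ ^ 2 * (lam k * τ k) := fun k => by
      rw [quadModel_combo _ _ _ _ _ _ (by ring : t + (1 - t) = 1), quadModel_self, norm_sub_rev]
      linear_combination (1 - t) * hc k
    simp only [e, Finset.sum_sub_distrib, ← Finset.mul_sum, map_add, map_smul, smul_eq_mul] at h
    have : t * o z ≤ t * (o x + ∑ k, lam k * a k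
        - (1 - t) * ((∑ k, lam k * τ k) * ‖z - x‖ ^ 2)) := by linarith
    exact le_of_mul_le_mul_left this ht
  have hlim : Tendsto (fun t : ℝ => o x + ∑ k, lam k * a k
      - (1 - t) * ((∑ k, lam k * τ k) * ‖z - x‖ ^ 2)) (𝓝[>] 0)
      (𝓝 (o x + ∑ k, lam k * a k - (1 - 0) * ((∑ k, lam k * τ k) * ‖z - x‖ ^ 2))) := by
    refine Tendsto.mono_left (Continuous.tendsto ?_ 0) nhdsWithin_le_nhds
    fun_prop
  rw [sub_zero, one_mul] at hlim
  refine ge_of_tendsto hlim ?_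
  filter_upwards [Ioc_mem_nhdsGT (zero_lt_one' ℝ)] with t ht
  exact key t ht.1 ht.2

end QuadModel

/-! ### Sequences with bounded partial sums -/

section BoundedSums

/-- The partial sums from `M` on are bounded above. -/
def BddSumsFrom (M : ℕ) (w : ℕ → ℝ) : Prop :=
  ∃ C : ℝ, ∀ n, M ≤ n → ∑ l ∈ Finset.Ico M n, w l ≤ C

variable {M : ℕ} {v w : ℕ → ℝ}

theorem BddSumsFrom.add (hv : BddSumsFrom M v) (hw : BddSumsFrom M w) :
    BddSumsFrom M fun l => v l + w l := by
  obtain ⟨C, hC⟩ := hv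
  obtain ⟨D, hD⟩ := hw
  exact ⟨C + D, fun n hn => by
    rw [Finset.sum_add_distrib]; exact add_le_add (hC n hn) (hD n hn)⟩

theorem BddSumsFrom.const_mul (hw : BddSumsFrom M w) {c : ℝ} (hc : 0 ≤ c) :
    BddSumsFrom M fun l => c * w l := by
  obtain ⟨C, hC⟩ := hw
  exact ⟨c * C, fun n hn => by
    rw [← Finset.mul_sum]; exact mul_le_mul_of_nonneg_left (hC n hn) hc⟩

theorem BddSumsFrom.mono (hw : BddSumsFrom M w) (h : ∀ l, M ≤ l → v l ≤ w l) : BddSumsFrom M v := by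
  obtain ⟨C, hC⟩ := hw
  exact ⟨C, fun n hn => (Finset.sum_le_sum fun l hl => h l (Finset.mem_Ico.1 hl).1).trans (hC n hn)⟩

theorem Summable.bddSumsFrom (hw : Summable w) (h0 : ∀ l, 0 ≤ w l) : BddSumsFrom M w :=
  ⟨∑' l, w l, fun _ _ => hw.sum_le_tsum _ fun l _ => h0 l⟩

theorem bddSumsFrom_of_tendsto {a : ℝ}
    (h : Tendsto (fun n => ∑ l ∈ Finset.range n, w l) atTop (𝓝 a)) : BddSumsFrom M w := by
  obtain ⟨C, hC⟩ := h.bddAbove_range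
  exact ⟨C - ∑ l ∈ Finset.range M, w l, fun n hn => by
    rw [Finset.sum_Ico_eq_sub _ hn]; linarith [hC ⟨n, rfl⟩]⟩

theorem bddSumsFrom_telescope {s : ℕ → ℝ} (h0 : ∀ l, 0 ≤ s l) :
    BddSumsFrom M fun l => s l - s (l + 1) :=
  ⟨s M, fun n hn => by
    have := Finset.sum_Ico_sub s hn
    have e : ∑ l ∈ Finset.Ico M n, (s l - s (l + 1)) = -∑ l ∈ Finset.Ico M n, (s (l + 1) - s l) := by
      rw [← Finset.sum_neg_distrib]; simp
    rw [e, this]; linarith [h0 n]⟩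

end BoundedSums

/-! ### Convergence along a typical path -/

section PathAnalysis

variable {ι F J : Type*} [Fintype ι] [MeasurableSpace F] [Fintype J]

/-- The gradient estimates at step `l`. -/
def gradTrack (g : EuclideanSpace ℝ ι → F → EuclideanSpace ℝ ι) (β : ℕ → ℝ) (h : ℕ → F)
    (x : ℕ → EuclideanSpace ℝ ι) : ℕ → EuclideanSpace ℝ ι :=
  recAverage β fun i => g (x i) (h i)

/-- The surrogate of step `l`. -/
def stepModel (ψ : EuclideanSpace ℝ ι → F → ℝ)
    (g : EuclideanSpace ℝ ι → F → EuclideanSpace ℝ ι) (τ : ℝ) (β : ℕ → ℝ) (h : ℕ → F)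
    (x : ℕ → EuclideanSpace ℝ ι) (l : ℕ) : EuclideanSpace ℝ ι → ℝ :=
  quadModel (sampleMean ψ h l (x l)) (gradTrack g β h x l) τ (x l)

/-- The limiting surrogate at `z`. -/
def limitModel (ν : Measure F) (ψ : EuclideanSpace ℝ ι → F → ℝ)
    (g : EuclideanSpace ℝ ι → F → EuclideanSpace ℝ ι) (τ : ℝ) (z : EuclideanSpace ℝ ι) :
    EuclideanSpace ℝ ι → ℝ :=
  quadModel (∫ s, ψ z s ∂ν) (∫ s, g z s ∂ν) τ z

/-- A run of the successive approximation method with a linear objective `o` along typical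
samples. -/
structure SurrogateRun (ν : Measure F) (X χ : Set (EuclideanSpace ℝ ι))
    (o : EuclideanSpace ℝ ι →L[ℝ] ℝ) (ψ : J → EuclideanSpace ℝ ι → F → ℝ)
    (g : J → EuclideanSpace ℝ ι → F → EuclideanSpace ℝ ι) (L : J → F → ℝ) (τ : J → ℝ)
    (α β : ℕ → ℝ) (h : ℕ → F) (x xbar : ℕ → EuclideanSpace ℝ ι) : Prop where
  isCompact : IsCompact X
  isClosed : IsClosed χ
  convex : Convex ℝ χ
  obj_nonneg : ∀ y ∈ χ, 0 ≤ o y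
  obj_le : ∃ P, ∀ y ∈ χ, o y ≤ P
  exists_zero : ∃ B, 0 ≤ B ∧ ∀ l, ∃ y ∈ χ, o y = 0 ∧ ‖y - x l‖ ≤ B
  pos_of_zero : ∀ y ∈ X, o y = 0 → y ∈ χ → ∃ k, 0 < ∫ s, ψ k y s ∂ν
  sample : ∀ k, RegularSample X (ψ k) (g k) (L k)
  integrable : ∀ k, Integrable (L k) ν
  typical : ∀ k, TypicalPath ν X (ψ k) (g k) (L k) β h x
  curv_pos : ∀ k, 0 < τ k
  step_mem : ∀ l, 0 < α l ∧ α l ≤ 1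
  step_tendsto : Tendsto α atTop (𝓝 0)
  step_sum : Tendsto (fun n => ∑ l ∈ Finset.range n, α l) atTop atTop
  step_sq : Summable fun l => α l ^ 2
  weight_mem : ∀ l, 0 < β l ∧ β l ≤ 1
  weight_sum : Tendsto (fun n => ∑ l ∈ Finset.range n, β l) atTop atTop
  ratio_tendsto : Tendsto (fun l => α l / β l) atTop (𝓝 0)
  mem_reg : ∀ l, x l ∈ X
  mem : ∀ l, x l ∈ χ
  bar_mem : ∀ l, xbar l ∈ χ
  step : ∀ l, x (l + 1) = (1 - α l) • x l + α l • xbar l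
  model_le : ∀ l A, 0 ≤ A → (∀ k, sampleMean (ψ k) h l (x l) ≤ A) →
    ∀ k, stepModel (ψ k) (g k) (τ k) β h x l (xbar l) ≤ A
  solves : ∀ l, (∃ y ∈ χ, ∀ k, stepModel (ψ k) (g k) (τ k) β h x l y ≤ 0) →
    (∀ k, stepModel (ψ k) (g k) (τ k) β h x l (xbar l) ≤ 0) ∧
    ∀ y ∈ χ, (∀ k, stepModel (ψ k) (g k) (τ k) β h x l y ≤ 0) → o (xbar l) ≤ o y
  slater : ∀ (φ : ℕ → ℕ) (z : EuclideanSpace ℝ ι), StrictMono φ →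
    Tendsto (fun j => x (φ j)) atTop (𝓝 z) →
    ∃ y ∈ χ, ∀ k, limitModel ν (ψ k) (g k) (τ k) z y < 0

omit [Fintype ι] [MeasurableSpace F] in
theorem abs_sampleMean_le {ψ : EuclideanSpace ℝ ι → F → ℝ} {L : F → ℝ} {h : ℕ → F} {C : ℝ}
    (hL : ∀ n : ℕ, ∑ i ∈ Finset.range (n + 1), L (h i) ≤ C * ((n : ℝ) + 1)) {y : EuclideanSpace ℝ ι}
    (hb : ∀ s, |ψ y s| ≤ L s) (n : ℕ) : |sampleMean ψ h n y| ≤ C := by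
  have hn : (0 : ℝ) < (n : ℝ) + 1 := by positivity
  rw [sampleMean, smul_eq_mul, abs_mul, abs_of_pos (inv_pos.2 hn), inv_mul_le_iff₀ hn, mul_comm]
  exact ((Finset.abs_sum_le_sum_abs _ _).trans (Finset.sum_le_sum fun i _ => hb _)).trans (hL n)

omit [MeasurableSpace F] in
theorem norm_sampleMean_le {g : EuclideanSpace ℝ ι → F → EuclideanSpace ℝ ι} {L : F → ℝ}
    {h : ℕ → F} {C : ℝ}
    (hL : ∀ n : ℕ, ∑ i ∈ Finset.range (n + 1), L (h i) ≤ C * ((n : ℝ) + 1)) {y : EuclideanSpace ℝ ι}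
    (hb : ∀ s, ‖g y s‖ ≤ L s) (n : ℕ) : ‖sampleMean g h n y‖ ≤ C := by
  have hn : (0 : ℝ) < (n : ℝ) + 1 := by positivity
  rw [sampleMean, norm_smul, Real.norm_of_nonneg (inv_pos.2 hn).le, inv_mul_le_iff₀ hn, mul_comm]
  exact ((norm_sum_le _ _).trans (Finset.sum_le_sum fun i _ => hb _)).trans (hL n)

theorem sampleMean_taylor {X : Set (EuclideanSpace ℝ ι)} {ψ : EuclideanSpace ℝ ι → F → ℝ}
    {g : EuclideanSpace ℝ ι → F → EuclideanSpace ℝ ι} {L : F → ℝ} {h : ℕ → F} {C : ℝ}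
    (hS : RegularSample X ψ g L)
    (hL : ∀ n : ℕ, ∑ i ∈ Finset.range (n + 1), L (h i) ≤ C * ((n : ℝ) + 1))
    {x y : EuclideanSpace ℝ ι} (hx : x ∈ X) (hy : y ∈ X) (n : ℕ) :
    |sampleMean ψ h n y - sampleMean ψ h n x - inner ℝ (sampleMean g h n x) (y - x)|
      ≤ C * ‖y - x‖ ^ 2 := by
  have hn : (0 : ℝ) < (n : ℝ) + 1 := by positivity
  have e : sampleMean ψ h n y - sampleMean ψ h n x - inner ℝ (sampleMean g h n x) (y - x)
      = ((n : ℝ) + 1)⁻¹ * ∑ i ∈ Finset.range (n + 1),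
        (ψ y (h i) - ψ x (h i) - inner ℝ (g x (h i)) (y - x)) := by
    simp only [sampleMean, Finset.sum_sub_distrib, smul_eq_mul, real_inner_smul_left, sum_inner]
    ring
  rw [e, abs_mul, abs_of_pos (inv_pos.2 hn), inv_mul_le_iff₀ hn]
  refine (Finset.abs_sum_le_sum_abs _ _).trans
    ((Finset.sum_le_sum fun i _ => hS.taylor x hx y hy (h i)).trans ?_)
  rw [← Finset.sum_mul, ← mul_assoc, mul_comm _ C]
  exact mul_le_mul_of_nonneg_right (hL n) (sq_nonneg _)

omit [Fintype ι] [MeasurableSpace F] in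
theorem sampleMean_succ (ψ : EuclideanSpace ℝ ι → F → ℝ) (h : ℕ → F) (l : ℕ)
    (y : EuclideanSpace ℝ ι) :
    sampleMean ψ h (l + 1) y
      = sampleMean ψ h l y + ((l : ℝ) + 2)⁻¹ * (ψ y (h (l + 1)) - sampleMean ψ h l y) := by
  have h1 : ((l : ℝ) + 1) ≠ 0 := by positivity
  have h2 : ((l : ℝ) + 2) ≠ 0 := by positivity
  simp only [sampleMean, smul_eq_mul]
  rw [Finset.sum_range_succ _ (l + 1)]
  push_cast
  rw [show (l : ℝ) + 1 + 1 = l + 2 by ring]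
  field_simp
  ring

theorem tendsto_rate : Tendsto (fun n : ℕ => ((n : ℝ) + 1) ^ (-(3 / 8) : ℝ)) atTop (𝓝 0) :=
  (tendsto_rpow_neg_atTop (by norm_num : (0 : ℝ) < 3 / 8)).comp
    (tendsto_atTop_add_const_right _ 1 tendsto_natCast_atTop_atTop)

namespace SurrogateRun

variable {ν : Measure F} {X χ : Set (EuclideanSpace ℝ ι)} {o : EuclideanSpace ℝ ι →L[ℝ] ℝ}
  {ψ : J → EuclideanSpace ℝ ι → F → ℝ} {g : J → EuclideanSpace ℝ ι → F → EuclideanSpace ℝ ι}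
  {L : J → F → ℝ} {τ : J → ℝ} {α β : ℕ → ℝ} {h : ℕ → F} {x xbar : ℕ → EuclideanSpace ℝ ι}

omit [Fintype J] in
-- Splits the gradient estimate into averaged noise and a delayed average of the true gradients,
-- which are controlled by different arguments.
theorem gradTrack_eq (ν : Measure F) (k : J) (l : ℕ) :
    gradTrack (g k) β h x l = recAverage β (fun l => g k (x l) (h l) - ∫ s, g k (x l) s ∂ν) l
      + recAverage β (fun l => ∫ s, g k (x l) s ∂ν) l := by
  rw [← recAverage_add]
  simp only [sub_add_cancel]
  rfl

variable (r : SurrogateRun ν X χ o ψ g L τ α β h x xbar)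
include r

omit [Fintype J] in
theorem step_sub (l : ℕ) : x (l + 1) - x l = α l • (xbar l - x l) := by
  rw [r.step, sub_smul, one_smul, smul_sub]; abel

omit [Fintype J] in
theorem norm_step (l : ℕ) : ‖x (l + 1) - x l‖ = α l * ‖xbar l - x l‖ := by
  rw [r.step_sub, norm_smul, Real.norm_of_nonneg (r.step_mem l).1.le]

/-- Uniform bounds on all quantities along the run. -/
theorem exists_bounds [Nonempty J] : ∃ B : ℝ, 1 ≤ B ∧ (∀ k l, ∀ y ∈ X, |sampleMean (ψ k) h l y| ≤ B) ∧
    (∀ k l, ∀ y ∈ X, ‖sampleMean (g k) h l y‖ ≤ B) ∧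
    (∀ k, ∀ n : ℕ, ∑ i ∈ Finset.range (n + 1), L k (h i) ≤ B * ((n : ℝ) + 1)) ∧
    (∀ k l, ‖gradTrack (g k) β h x l‖ ≤ B) ∧ (∀ l, ‖xbar l - x l‖ ≤ B) ∧
    (∀ k, ∫ s, L k s ∂ν ≤ B) := by
  classical
  choose C hC0 hC using fun k => (r.typical k).bound
  have hu : ∀ k, ∃ U : ℝ, ∀ l,
      ‖recAverage β (fun l => g k (x l) (h l) - ∫ s, g k (x l) s ∂ν) l‖ ≤ U := fun k => by
    obtain ⟨U, hU⟩ := (r.typical k).noise_tendsto.norm.bddAbove_range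
    exact ⟨U, fun l => hU ⟨l, rfl⟩⟩
  choose U hU using hu
  set m : J → ℝ := fun k => ∫ s, L k s ∂ν with hm
  have hm0 : ∀ k, 0 ≤ m k := fun k =>
    (norm_nonneg _).trans ((r.sample k).norm_mean_grad_le (r.integrable k) (r.mem_reg 0))
  have hU0 : ∀ k, 0 ≤ U k := fun k => (norm_nonneg _).trans (hU k 0)
  have hκ : ∀ k l, ‖gradTrack (g k) β h x l‖ ≤ U k + m k := fun k l => by
    rw [gradTrack_eq ν]
    exact (norm_add_le _ _).trans (add_le_add (hU k l) (norm_recAverage_le r.weight_mem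
      (fun l => (r.sample k).norm_mean_grad_le (r.integrable k) (r.mem_reg l)) l))
  set A : ℝ := ∑ k, (C k + U k + m k) with hA
  have hterm0 : ∀ k, 0 ≤ C k + U k + m k := fun k => by linarith [hC0 k, hU0 k, hm0 k]
  have hle : ∀ k, C k + U k + m k ≤ A := fun k =>
    Finset.single_le_sum (f := fun k => C k + U k + m k) (fun i _ => hterm0 i) (Finset.mem_univ k)
  have hA0 : 0 ≤ A := Finset.sum_nonneg fun i _ => hterm0 i
  -- A single strongly convex surrogate suffices to bound the distance to the surrogate solution.
  obtain ⟨k₀⟩ := ‹Nonempty J›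
  set R : ℝ := 1 + (2 * A + A) / τ k₀ with hR
  have hR0 : 0 ≤ (2 * A + A) / τ k₀ := div_nonneg (by linarith) (r.curv_pos k₀).le
  have hmean : ∀ k l, ∀ y ∈ X, |sampleMean (ψ k) h l y| ≤ A := fun k l y hy =>
    (abs_sampleMean_le (hC k) ((r.sample k).abs_le y hy) l).trans
      (by linarith [hle k, hU0 k, hm0 k])
  refine ⟨A + R, by linarith, fun k l y hy => (hmean k l y hy).trans (by linarith),
    fun k l y hy => ?_, fun k n => ?_, fun k l => ?_, fun l => ?_, fun k => ?_⟩
  · exact (norm_sampleMean_le (hC k) ((r.sample k).norm_grad_le y hy) l).trans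
      (by linarith [hle k, hU0 k, hm0 k])
  · exact (hC k n).trans (mul_le_mul_of_nonneg_right (by linarith [hle k, hU0 k, hm0 k])
      (by positivity))
  · exact (hκ k l).trans (by linarith [hle k, hC0 k])
  · have h1 := r.model_le l A hA0 (fun k => (le_abs_self _).trans (hmean k l _ (r.mem_reg l))) k₀
    have := norm_sub_le_of_quadModel_le (r.curv_pos k₀) (hmean k₀ l _ (r.mem_reg l))
      ((hκ k₀ l).trans (by linarith [hle k₀, hC0 k₀] : U k₀ + m k₀ ≤ A)) h1
    linarith
  · linarith [hle k, hC0 k, hU0 k]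

theorem mean_grad_step [Nonempty J] (k : J) (l : ℕ) :
    ‖∫ s, g k (x (l + 1)) s ∂ν - ∫ s, g k (x l) s ∂ν‖
      ≤ (∫ s, L k s ∂ν) * (α l * ‖xbar l - x l‖) := by
  rw [← r.norm_step]
  exact (r.sample k).mean_grad_lipschitz (r.integrable k) (r.mem_reg l) (r.mem_reg (l + 1))

theorem tendsto_gradTrack_sub [Nonempty J] (k : J) :
    Tendsto (fun l => gradTrack (g k) β h x l - ∫ s, g k (x l) s ∂ν) atTop (𝓝 0) := by
  obtain ⟨B, hB1, -, -, -, -, hd, -⟩ := r.exists_bounds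
  have h0 : 0 ≤ ∫ s, L k s ∂ν :=
    (norm_nonneg _).trans ((r.sample k).norm_mean_grad_le (r.integrable k) (r.mem_reg 0))
  have h1 := tendsto_recAverage_sub (v := fun l => ∫ s, g k (x l) s ∂ν) r.step_mem r.weight_mem r.weight_sum r.ratio_tendsto h0
    (fun l => ⟨norm_nonneg _, hd l⟩) (r.mean_grad_step k)
  have h2 := (r.typical k).noise_tendsto.add h1
  rw [add_zero] at h2
  refine h2.congr fun l => ?_
  rw [gradTrack_eq ν, add_sub_assoc]

omit [Fintype J] in
-- The iterate depends on the samples being averaged, so a pointwise law of large numbers would not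
-- do; the uniform rate is used.
theorem tendsto_sampleMean_sub (k : J) :
    Tendsto (fun l => sampleMean (ψ k) h l (x l) - ∫ s, ψ k (x l) s ∂ν) atTop (𝓝 0) := by
  obtain ⟨C, -, hC⟩ := (r.typical k).rate_fun
  refine squeeze_zero_norm (fun l => hC l (x l) (r.mem_reg l)) ?_
  simpa using tendsto_rate.const_mul C

omit [Fintype J] in
theorem tendsto_mean (k : J) {φ : ℕ → ℕ} {z : EuclideanSpace ℝ ι}
    (hz : Tendsto (fun j => x (φ j)) atTop (𝓝 z)) :
    Tendsto (fun j => ∫ s, ψ k (x (φ j)) s ∂ν) atTop (𝓝 (∫ s, ψ k z s ∂ν)) ∧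
    Tendsto (fun j => ∫ s, g k (x (φ j)) s ∂ν) atTop (𝓝 (∫ s, g k z s ∂ν)) := by
  have hzX : z ∈ X := r.isCompact.isClosed.mem_of_tendsto hz
    (Eventually.of_forall fun j => r.mem_reg _)
  have hd : Tendsto (fun j => ‖x (φ j) - z‖) atTop (𝓝 0) := tendsto_iff_norm_sub_tendsto_zero.1 hz
  have hS := r.sample k
  have hi := r.integrable k
  constructor
  · rw [tendsto_iff_norm_sub_tendsto_zero]
    refine squeeze_zero (fun j => norm_nonneg _) (g := fun j => (∫ s, L k s ∂ν) * ‖x (φ j) - z‖ ^ 2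
      + (∫ s, L k s ∂ν) * ‖x (φ j) - z‖) (fun j => ?_) ?_
    · have h1 := hS.mean_taylor hi hzX (r.mem_reg (φ j))
      have h2 : |inner ℝ (∫ s, g k z s ∂ν) (x (φ j) - z)| ≤ (∫ s, L k s ∂ν) * ‖x (φ j) - z‖ :=
        (abs_real_inner_le_norm _ _).trans
          (mul_le_mul_of_nonneg_right (hS.norm_mean_grad_le hi hzX) (norm_nonneg _))
      rw [Real.norm_eq_abs]
      have h3 := abs_add_le (∫ s, ψ k (x (φ j)) s ∂ν - ∫ s, ψ k z s ∂ν
        - inner ℝ (∫ s, g k z s ∂ν) (x (φ j) - z)) (inner ℝ (∫ s, g k z s ∂ν) (x (φ j) - z))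
      rw [sub_add_cancel] at h3
      linarith
    · simpa using ((hd.pow 2).const_mul (∫ s, L k s ∂ν)).add (hd.const_mul (∫ s, L k s ∂ν))
  · rw [tendsto_iff_norm_sub_tendsto_zero]
    refine squeeze_zero (fun j => norm_nonneg _)
      (fun j => hS.mean_grad_lipschitz hi hzX (r.mem_reg (φ j))) ?_
    simpa using hd.const_mul (∫ s, L k s ∂ν)

theorem tendsto_stepModel [Nonempty J] (k : J) {φ : ℕ → ℕ} {z : EuclideanSpace ℝ ι}
    (hφ : Tendsto φ atTop atTop) (hz : Tendsto (fun j => x (φ j)) atTop (𝓝 z))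
    (y : EuclideanSpace ℝ ι) :
    Tendsto (fun j => stepModel (ψ k) (g k) (τ k) β h x (φ j) y) atTop
      (𝓝 (limitModel ν (ψ k) (g k) (τ k) z y)) := by
  obtain ⟨h1, h2⟩ := r.tendsto_mean k hz
  have h3 := ((r.tendsto_sampleMean_sub k).comp hφ).add h1
  have h4 := ((r.tendsto_gradTrack_sub k).comp hφ).add h2
  simp only [Function.comp_apply, sub_add_cancel, zero_add] at h3 h4
  exact tendsto_quadModel h3 h4 hz _ _

/-- The Slater condition at limit points holds uniformly along the run. -/
theorem eventually_slater [Nonempty J] : ∃ ε : ℝ, 0 < ε ∧ ∀ᶠ l in atTop, ∃ y ∈ χ, ∀ k,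
    stepModel (ψ k) (g k) (τ k) β h x l y ≤ -ε := by
  by_contra hcon
  push Not at hcon
  -- If no margin worked, iterates failing with margin `1 / (n + 1)` would accumulate at some `z`.
  -- The Slater point of `z` is strictly feasible for the nearby step surrogates, a contradiction.
  obtain ⟨φ, hφ, hp⟩ := extraction_forall_of_frequently fun n : ℕ =>
    hcon (((n : ℝ) + 1)⁻¹) (by positivity)
  obtain ⟨z, -, θ, hθ, hz⟩ := r.isCompact.tendsto_subseq fun j => r.mem_reg (φ j)
  obtain ⟨y, hy, hslat⟩ := r.slater (φ ∘ θ) z (hφ.comp hθ) hz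
  have hinv : Tendsto (fun j => (((θ j : ℕ) : ℝ) + 1)⁻¹) atTop (𝓝 0) := by
    have := tendsto_one_div_add_atTop_nhds_zero_nat (𝕜 := ℝ)
    simp only [one_div] at this
    exact this.comp hθ.tendsto_atTop
  have hev : ∀ᶠ j in atTop, ∀ k, stepModel (ψ k) (g k) (τ k) β h x (φ (θ j)) y
      + (((θ j : ℕ) : ℝ) + 1)⁻¹ < 0 := by
    refine eventually_all.2 fun k => ?_
    have h1 := (r.tendsto_stepModel k (hφ.comp hθ).tendsto_atTop hz y).add hinv
    rw [add_zero] at h1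
    exact h1.eventually_lt_const (hslat k)
  obtain ⟨j, hj⟩ := hev.exists
  obtain ⟨k, hk⟩ := hp (θ j) y hy
  linarith [hj k]

/-- The limit points are feasible. -/
theorem eventually_mean_le [Nonempty J] (k : J) {ε : ℝ} (hε : 0 < ε) :
    ∀ᶠ l in atTop, ∫ s, ψ k (x l) s ∂ν ≤ ε := by
  obtain ⟨B, hB1, -, -, -, -, hd, hm⟩ := r.exists_bounds
  obtain ⟨δ, hδ, hsl⟩ := r.eventually_slater
  -- Feasibility of `xbar` for its surrogate says that the linearized change is at most minus the
  -- current sample value. Hence the mean contracts by `1 - α`, up to value error, gradient error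
  -- and Taylor remainder.
  refine eventually_le_of_recursive_average (α := α)
    (w := fun l => |sampleMean (ψ k) h l (x l) - ∫ s, ψ k (x l) s ∂ν|
      + ‖gradTrack (g k) β h x l - ∫ s, g k (x l) s ∂ν‖ * B + B * B ^ 2 * α l)
    (fun l => ⟨(r.step_mem l).1.le, (r.step_mem l).2⟩) r.step_sum ?_ ?_ hε
  · filter_upwards [hsl] with l hl
    obtain ⟨y, hy, hyl⟩ := hl
    have hfeas := (r.solves l ⟨y, hy, fun k => (hyl k).trans (by linarith)⟩).1 k
    have ha := (r.step_mem l).1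
    have ht := (r.sample k).mean_taylor (r.integrable k) (r.mem_reg l) (r.mem_reg (l + 1))
    rw [r.norm_step, r.step_sub, inner_smul_right] at ht
    have ht := (abs_le.1 ht).2
    unfold stepModel quadModel at hfeas
    have e1 : inner ℝ (∫ s, g k (x l) s ∂ν) (xbar l - x l)
        = inner ℝ (gradTrack (g k) β h x l) (xbar l - x l)
          - inner ℝ (gradTrack (g k) β h x l - ∫ s, g k (x l) s ∂ν) (xbar l - x l) := by
      rw [inner_sub_left]; ring
    have e2 : -inner ℝ (gradTrack (g k) β h x l - ∫ s, g k (x l) s ∂ν) (xbar l - x l)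
        ≤ ‖gradTrack (g k) β h x l - ∫ s, g k (x l) s ∂ν‖ * B :=
      (neg_le_abs _).trans ((abs_real_inner_le_norm _ _).trans
        (mul_le_mul_of_nonneg_left (hd l) (norm_nonneg _)))
    have e3 := neg_abs_le (sampleMean (ψ k) h l (x l) - ∫ s, ψ k (x l) s ∂ν)
    have e4 : 0 ≤ τ k * ‖xbar l - x l‖ ^ 2 := mul_nonneg (r.curv_pos k).le (sq_nonneg _)
    have e5 : inner ℝ (∫ s, g k (x l) s ∂ν) (xbar l - x l) ≤ -(∫ s, ψ k (x l) s ∂ν)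
        + |sampleMean (ψ k) h l (x l) - ∫ s, ψ k (x l) s ∂ν|
        + ‖gradTrack (g k) β h x l - ∫ s, g k (x l) s ∂ν‖ * B := by linarith
    have e6 := mul_le_mul_of_nonneg_left e5 ha.le
    have e7 : (∫ s, L k s ∂ν) * (α l * ‖xbar l - x l‖) ^ 2 ≤ B * (α l * B) ^ 2 := by
      have := hd l
      have := hm k
      gcongr
    have e8 : B * (α l * B) ^ 2 = α l * (B * B ^ 2 * α l) := by ring
    linarith
  · have h1 := (r.tendsto_sampleMean_sub k).abs
    have h2 := (r.tendsto_gradTrack_sub k).norm.mul_const B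
    have h3 := r.step_tendsto.const_mul (B * B ^ 2)
    simpa using (h1.add h2).add h3

theorem mean_le_zero_of_tendsto [Nonempty J] (k : J) {φ : ℕ → ℕ} {z : EuclideanSpace ℝ ι}
    (hφ : Tendsto φ atTop atTop) (hz : Tendsto (fun j => x (φ j)) atTop (𝓝 z)) :
    ∫ s, ψ k z s ∂ν ≤ 0 :=
  le_of_forall_pos_le_add fun ε hε => by
    rw [zero_add]
    exact le_of_tendsto (r.tendsto_mean k hz).1
      (hφ.eventually (r.eventually_mean_le k hε))

/-- Limit points are feasible, whereas at zero objective some constraint is violated. Compactness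
turns this into a positive lower bound. -/
theorem eventually_objective_ge [Nonempty J] : ∃ c : ℝ, 0 < c ∧ ∀ᶠ l in atTop, c ≤ o (x l) := by
  by_contra hcon
  push Not at hcon
  obtain ⟨φ, hφ, hp⟩ := extraction_forall_of_frequently fun n : ℕ =>
    hcon (((n : ℝ) + 1)⁻¹) (by positivity)
  obtain ⟨z, hzX, θ, hθ, hz⟩ := r.isCompact.tendsto_subseq fun j => r.mem_reg (φ j)
  have hzχ : z ∈ χ := r.isClosed.mem_of_tendsto hz (Eventually.of_forall fun j => r.mem _)
  have hinv : Tendsto (fun j => (((θ j : ℕ) : ℝ) + 1)⁻¹) atTop (𝓝 0) := by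
    have := tendsto_one_div_add_atTop_nhds_zero_nat (𝕜 := ℝ)
    simp only [one_div] at this
    exact this.comp hθ.tendsto_atTop
  have h0 : o z ≤ 0 := le_of_tendsto_of_tendsto ((o.continuous.tendsto z).comp hz) hinv
    (Eventually.of_forall fun j => (hp (θ j)).le)
  obtain ⟨k, hk⟩ := r.pos_of_zero z hzX (le_antisymm h0 (r.obj_nonneg z hzχ)) hzχ
  exact absurd (r.mean_le_zero_of_tendsto k (hφ.comp hθ).tendsto_atTop hz) (not_le.2 hk)

/-- Eventually, the objective decreases by the Lagrange terms and a multiple of the squared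
distance. -/
theorem eventually_exists_multipliers [Nonempty J] : ∃ Λ c : ℝ, 0 < Λ ∧ 0 < c ∧ ∀ᶠ l in atTop,
    (∀ k, stepModel (ψ k) (g k) (τ k) β h x l (xbar l) ≤ 0) ∧
    ∃ lam : J → ℝ, (∀ k, 0 ≤ lam k ∧ lam k ≤ Λ) ∧
      o (xbar l) ≤ o (x l) + ∑ k, lam k * sampleMean (ψ k) h l (x l)
        - c * ‖xbar l - x l‖ ^ 2 := by
  obtain ⟨B, hB1, hmean, -, -, hκ, hd, -⟩ := r.exists_bounds
  obtain ⟨ε, hε, hsl⟩ := r.eventually_slater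
  obtain ⟨c₁, hc₁, hobj⟩ := r.eventually_objective_ge
  obtain ⟨P, hP⟩ := r.obj_le
  obtain ⟨B', hB', hzero⟩ := r.exists_zero
  obtain ⟨k₀, hk₀⟩ := Finite.exists_min τ
  obtain ⟨k₁, hk₁⟩ := Finite.exists_max τ
  have hτ0 := r.curv_pos k₀
  have hτ1 := r.curv_pos k₁
  have hP0 : 0 ≤ P := (r.obj_nonneg _ (r.mem 0)).trans (hP _ (r.mem 0))
  set B₁ : ℝ := B + B * B' + τ k₁ * B' ^ 2 with hB₁
  have hB₁0 : 0 < B₁ := by positivity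
  -- `B₁` bounds every surrogate at the points of zero objective near the iterate. Multipliers with
  -- sum below `c₀` thus contribute at most `c₁ / 2` there.
  set c₀ : ℝ := c₁ / (2 * B₁) with hc₀
  have hc₀0 : 0 < c₀ := by positivity
  refine ⟨P / ε + 1, min (c₀ * τ k₀) (c₁ / 2 / B ^ 2), by positivity, by positivity, ?_⟩
  filter_upwards [hsl, hobj] with l hl hol
  obtain ⟨w, hw, hwl⟩ := hl
  obtain ⟨hfeas, hmin⟩ := r.solves l ⟨w, hw, fun k => (hwl k).trans (by linarith)⟩
  refine ⟨hfeas, ?_⟩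
  obtain ⟨lam, hlam0, hcomp, hlag⟩ := exists_multipliers_of_slater (χ := χ) (o := o)
    (o.toLinearMap.convexOn r.convex)
    (fun k => convexOn_quadModel r.convex (sampleMean (ψ k) h l (x l)) (gradTrack (g k) β h x l)
      (r.curv_pos k).le (x l)) (r.bar_mem l) hfeas hmin hw
    (fun k => (hwl k).trans_lt (by linarith))
  -- The Lagrangian inequality at the Slater point, where each surrogate is at most `-ε` and the
  -- objective at most `P`, bounds the multipliers.
  have hsum : ∑ k, lam k ≤ P / ε := by
    rw [le_div_iff₀ hε]
    have h1 := hlag w hw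
    have h2 : ∑ k, lam k * quadModel (sampleMean (ψ k) h l (x l)) (gradTrack (g k) β h x l) (τ k)
        (x l) w ≤ ∑ k, lam k * -ε :=
      Finset.sum_le_sum fun k _ => mul_le_mul_of_nonneg_left (hwl k) (hlam0 k)
    rw [← Finset.sum_mul] at h2
    linarith [hP w hw, r.obj_nonneg _ (r.bar_mem l)]
  have hdec := objective_le_of_multipliers r.convex o (r.mem l) (r.bar_mem l) hcomp hlag
  have hdB : ‖xbar l - x l‖ ^ 2 ≤ B ^ 2 := by
    have := hd l
    gcongr
  by_cases hc : c₀ ≤ ∑ k, lam k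
  · refine ⟨lam, fun k => ⟨hlam0 k, ?_⟩, ?_⟩
    · have := Finset.single_le_sum (f := lam) (fun i _ => hlam0 i) (Finset.mem_univ k)
      linarith
    · have h1 : c₀ * τ k₀ ≤ ∑ k, lam k * τ k := by
        calc c₀ * τ k₀ ≤ (∑ k, lam k) * τ k₀ := by gcongr
          _ = ∑ k, lam k * τ k₀ := Finset.sum_mul _ _ _
          _ ≤ ∑ k, lam k * τ k :=
            Finset.sum_le_sum fun k _ => mul_le_mul_of_nonneg_left (hk₀ k) (hlam0 k)
      have h2 : min (c₀ * τ k₀) (c₁ / 2 / B ^ 2) * ‖xbar l - x l‖ ^ 2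
          ≤ (∑ k, lam k * τ k) * ‖xbar l - x l‖ ^ 2 :=
        mul_le_mul_of_nonneg_right ((min_le_left _ _).trans h1) (sq_nonneg _)
      linarith
  -- With small multipliers the Lagrangian at a point of zero objective shows `o (xbar l) ≤ c₁ / 2`,
  -- while `o (x l) ≥ c₁`. The gain `c₁ / 2` dominates the bounded squared distance, and zero
  -- multipliers serve.
  · push Not at hc
    refine ⟨fun _ => 0, fun k => ⟨le_rfl, by positivity⟩, ?_⟩
    obtain ⟨y, hy, hy0, hyB⟩ := hzero l
    have h1 := hlag y hy
    have h2 : ∑ k, lam k * quadModel (sampleMean (ψ k) h l (x l)) (gradTrack (g k) β h x l) (τ k)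
        (x l) y ≤ ∑ k, lam k * B₁ := by
      refine Finset.sum_le_sum fun k _ => mul_le_mul_of_nonneg_left ?_ (hlam0 k)
      refine (quadModel_le _ _ (r.curv_pos k).le _ _
        ((le_abs_self _).trans (hmean k l _ (r.mem_reg l))) (hκ k l) hyB).trans ?_
      have : τ k * B' ^ 2 ≤ τ k₁ * B' ^ 2 := mul_le_mul_of_nonneg_right (hk₁ k) (sq_nonneg _)
      linarith
    rw [← Finset.sum_mul] at h2
    have h3 : (∑ k, lam k) * B₁ ≤ c₀ * B₁ := mul_le_mul_of_nonneg_right hc.le hB₁0.le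
    have h4 : c₀ * B₁ = c₁ / 2 := by rw [hc₀]; field_simp
    have h5 : min (c₀ * τ k₀) (c₁ / 2 / B ^ 2) * ‖xbar l - x l‖ ^ 2 ≤ c₁ / 2 / B ^ 2 * B ^ 2 :=
      mul_le_mul (min_le_right _ _) hdB (sq_nonneg _) (by positivity)
    have h6 : c₁ / 2 / B ^ 2 * B ^ 2 = c₁ / 2 := by field_simp
    simp only [zero_mul, Finset.sum_const_zero, add_zero]
    linarith

end SurrogateRun
end PathAnalysis

/-! ### One-step estimate for the penalized objective. -/

section Lyapunov

variable {ι F J : Type*} [Fintype ι] [MeasurableSpace F] [Fintype J]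

/-- The martingale part of the change of the sample mean when a new sample arrives. -/
def penaltyNoise (ν : Measure F) (ψ : EuclideanSpace ℝ ι → F → ℝ) (h : ℕ → F)
    (x : ℕ → EuclideanSpace ℝ ι) (l : ℕ) : ℝ :=
  ((l : ℝ) + 2)⁻¹ * (ψ (x (l + 1)) (h (l + 1)) - ∫ s, ψ (x (l + 1)) s ∂ν)

/-- The slope of the smoothed penalty after the step. -/
def penaltySlope (ψ : EuclideanSpace ℝ ι → F → ℝ) (h : ℕ → F) (x : ℕ → EuclideanSpace ℝ ι)
    (l : ℕ) : ℝ :=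
  clampUnit (sampleMean ψ h l (x (l + 1)) / smoothWidth l)

/-- Bound for the change of a penalty term that is not compensated by the decrease of the
objective. -/
def penaltyExcess (ν : Measure F) (ψ : EuclideanSpace ℝ ι → F → ℝ)
    (g : EuclideanSpace ℝ ι → F → EuclideanSpace ℝ ι) (τ : ℝ) (α β : ℕ → ℝ) (h : ℕ → F)
    (x : ℕ → EuclideanSpace ℝ ι) (B C : ℝ) (l : ℕ) : ℝ :=
  α l * smoothWidth l + 5 * B ^ 3 * α l ^ 2
    + α l * (‖sampleMean g h l (x l) - gradTrack g β h x l‖ ^ 2 / (4 * τ))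
    + penaltySlope ψ h x l * penaltyNoise ν ψ h x l
    + penaltyNoise ν ψ h x l ^ 2 / (2 * smoothWidth l)
    + ((l : ℝ) + 2)⁻¹ * (C * ((l : ℝ) + 1) ^ (-(3 / 8) : ℝ))
    + (smoothWidth l - smoothWidth (l + 1)) / 2

theorem smoothWidth_succ_le (l : ℕ) : smoothWidth (l + 1) ≤ smoothWidth l := by
  unfold smoothWidth
  refine Real.rpow_le_rpow_of_nonpos (by positivity) ?_ (by norm_num)
  push_cast; linarith

omit [Fintype ι] in
-- The expansion is made at the old average taken at the new iterate, so that the slope multiplying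
-- the noise is known before the sample arrives. Noise is treated to second order, the movement of
-- the iterate by convexity, and the drift and the change of width by their absolute size.
theorem smoothPos_sampleMean_succ_le (ν : Measure F) (ψ : EuclideanSpace ℝ ι → F → ℝ) (h : ℕ → F)
    (x : ℕ → EuclideanSpace ℝ ι) {C : ℝ} (l : ℕ)
    (hC : |sampleMean ψ h l (x (l + 1)) - ∫ s, ψ (x (l + 1)) s ∂ν|
      ≤ C * ((l : ℝ) + 1) ^ (-(3 / 8) : ℝ)) :
    smoothPos (smoothWidth (l + 1)) (sampleMean ψ h (l + 1) (x (l + 1)))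
      ≤ smoothPos (smoothWidth l) (sampleMean ψ h l (x l))
        + penaltySlope ψ h x l * (sampleMean ψ h l (x (l + 1)) - sampleMean ψ h l (x l))
        + penaltySlope ψ h x l * penaltyNoise ν ψ h x l
        + penaltyNoise ν ψ h x l ^ 2 / (2 * smoothWidth l)
        + ((l : ℝ) + 2)⁻¹ * (C * ((l : ℝ) + 1) ^ (-(3 / 8) : ℝ))
        + (smoothWidth l - smoothWidth (l + 1)) / 2 := by
  have hs := smoothWidth_pos l
  have h1 := smoothPos_le_of_width (smoothWidth_pos (l + 1)) (smoothWidth_succ_le l)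
    (sampleMean ψ h (l + 1) (x (l + 1)))
  have h2 := smoothPos_le_add hs (sampleMean ψ h l (x (l + 1)) + penaltyNoise ν ψ h x l)
    (sampleMean ψ h (l + 1) (x (l + 1)))
  have e : sampleMean ψ h (l + 1) (x (l + 1))
      - (sampleMean ψ h l (x (l + 1)) + penaltyNoise ν ψ h x l)
      = -(((l : ℝ) + 2)⁻¹ * (sampleMean ψ h l (x (l + 1)) - ∫ s, ψ (x (l + 1)) s ∂ν)) := by
    rw [sampleMean_succ, penaltyNoise]; ring
  have hl : (0 : ℝ) ≤ ((l : ℝ) + 2)⁻¹ := by positivity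
  rw [e, abs_neg, abs_mul, abs_of_nonneg hl] at h2
  have h3 := mul_le_mul_of_nonneg_left hC hl
  have h4 := smoothPos_add_le hs (sampleMean ψ h l (x (l + 1))) (penaltyNoise ν ψ h x l)
  have h5 := smoothPos_sub_le hs (sampleMean ψ h l (x l)) (sampleMean ψ h l (x (l + 1)))
  unfold penaltySlope
  linarith

namespace SurrogateRun

variable {ν : Measure F} {X χ : Set (EuclideanSpace ℝ ι)} {o : EuclideanSpace ℝ ι →L[ℝ] ℝ}
  {ψ : J → EuclideanSpace ℝ ι → F → ℝ} {g : J → EuclideanSpace ℝ ι → F → EuclideanSpace ℝ ι}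
  {L : J → F → ℝ} {τ : J → ℝ} {α β : ℕ → ℝ} {h : ℕ → F} {x xbar : ℕ → EuclideanSpace ℝ ι}

variable (r : SurrogateRun ν X χ o ψ g L τ α β h x xbar)
include r

omit [Fintype J] in
-- The step lowers the penalty by about `α * t * a'`, with `a'` the old sample average at the new
-- iterate and `t` the slope there. After scaling by `Λ ≥ lam`, this pays for the Lagrange term up
-- to the width. The gradient error appears only squared, since Young's inequality charges its
-- product with the step to the curvature of the surrogate.
theorem lagrange_add_penalty_le {B C Λ lam : ℝ} (hB1 : 1 ≤ B) {k : J} {l : ℕ}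
    (hgB : ‖sampleMean (g k) h l (x l)‖ ≤ B)
    (hLB : ∀ n : ℕ, ∑ i ∈ Finset.range (n + 1), L k (h i) ≤ B * ((n : ℝ) + 1))
    (hd : ‖xbar l - x l‖ ≤ B)
    (hC : |sampleMean (ψ k) h l (x (l + 1)) - ∫ s, ψ k (x (l + 1)) s ∂ν|
      ≤ C * ((l : ℝ) + 1) ^ (-(3 / 8) : ℝ))
    (hfeas : stepModel (ψ k) (g k) (τ k) β h x l (xbar l) ≤ 0) (h0 : 0 ≤ lam) (h1 : lam ≤ Λ) :
    α l * (lam * sampleMean (ψ k) h l (x l))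
        + Λ * smoothPos (smoothWidth (l + 1)) (sampleMean (ψ k) h (l + 1) (x (l + 1)))
      ≤ Λ * smoothPos (smoothWidth l) (sampleMean (ψ k) h l (x l))
        + Λ * penaltyExcess ν (ψ k) (g k) (τ k) α β h x B C l := by
  have hs := smoothWidth_pos l
  obtain ⟨ha0, ha1⟩ := r.step_mem l
  have hτ := r.curv_pos k
  have hΛ : 0 ≤ Λ := h0.trans h1
  have hmain := smoothPos_sampleMean_succ_le ν (ψ k) h x l hC
  have htay := sampleMean_taylor (r.sample k) hLB (r.mem_reg l) (r.mem_reg (l + 1)) l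
  rw [r.norm_step, r.step_sub, inner_smul_right] at htay
  have hpen := mul_le_penalty hs (sampleMean (ψ k) h l (x (l + 1))) h0 h1
  change _ ≤ Λ * (penaltySlope (ψ k) h x l * _) + _ at hpen
  have ht0 : 0 ≤ penaltySlope (ψ k) h x l := clampUnit_nonneg _
  have ht1 : penaltySlope (ψ k) h x l ≤ 1 := clampUnit_le_one _
  unfold stepModel quadModel at hfeas
  unfold penaltyExcess
  set a := sampleMean (ψ k) h l (x l)
  set a' := sampleMean (ψ k) h l (x (l + 1))
  set t := penaltySlope (ψ k) h x l
  set G := sampleMean (g k) h l (x l)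
  set κ := gradTrack (g k) β h x l
  set D := xbar l - x l
  set e := ‖G - κ‖ with he
  have hD0 := norm_nonneg D
  -- the change of the sample mean along the step
  have hin : inner ℝ G D ≤ -a + e ^ 2 / (4 * τ k) := by
    have e1 : inner ℝ G D = inner ℝ κ D + inner ℝ (G - κ) D := by rw [inner_sub_left]; ring
    have e2 : inner ℝ (G - κ) D ≤ e * ‖D‖ := real_inner_le_norm _ _
    have e3 : e * ‖D‖ ≤ e ^ 2 / (4 * τ k) + τ k * ‖D‖ ^ 2 := by
      rw [div_add' _ _ _ (by positivity), le_div_iff₀ (by positivity)]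
      nlinarith [sq_nonneg (e - 2 * τ k * ‖D‖)]
    linarith
  have hB3 : B * (α l * ‖D‖) ^ 2 ≤ B ^ 3 * α l ^ 2 := by
    calc B * (α l * ‖D‖) ^ 2 ≤ B * (α l * B) ^ 2 := by gcongr
      _ = B ^ 3 * α l ^ 2 := by ring
  obtain ⟨ht_lo, ht_up⟩ := abs_le.1 htay
  have hup : a' - a ≤ α l * (-a + e ^ 2 / (4 * τ k)) + B ^ 3 * α l ^ 2 := by
    have := mul_le_mul_of_nonneg_left hin ha0.le
    linarith
  have habs : |a' - a| ≤ 2 * B ^ 3 * α l := by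
    have e1 : |inner ℝ G D| ≤ B ^ 3 := by
      calc |inner ℝ G D| ≤ ‖G‖ * ‖D‖ := abs_real_inner_le_norm _ _
        _ ≤ B * B := by gcongr
        _ ≤ B * B * B := le_mul_of_one_le_right (by positivity) hB1
        _ = B ^ 3 := by ring
    have e2 : B ^ 3 * α l ^ 2 ≤ B ^ 3 * α l :=
      mul_le_mul_of_nonneg_left (by nlinarith) (by positivity)
    have e3 := (abs_le.1 e1)
    have e4 := mul_le_mul_of_nonneg_left e3.1 ha0.le
    have e5 := mul_le_mul_of_nonneg_left e3.2 ha0.le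
    rw [abs_le]
    constructor <;> linarith
  have hB0 : 0 ≤ B ^ 3 := by positivity
  have hq0 : 0 ≤ e ^ 2 / (4 * τ k) := by positivity
  -- Replacing `t * a` by `t * a'` costs `2 * B ^ 3 * α ^ 2`; together with the Taylor remainder
  -- this makes the coefficient 3.
  have h2 : t * (a' - a) ≤ -(α l * (t * a')) + α l * (e ^ 2 / (4 * τ k)) + 3 * B ^ 3 * α l ^ 2 := by
    have f1 := mul_le_mul_of_nonneg_left hup ht0
    have f2 : t * (a' - a) ≤ |a' - a| :=
      (le_abs_self _).trans (by
        rw [abs_mul, abs_of_nonneg ht0]; exact mul_le_of_le_one_left (abs_nonneg _) ht1)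
    have f3 := mul_le_mul_of_nonneg_left (f2.trans habs) ha0.le
    have f4 : t * (α l * (e ^ 2 / (4 * τ k))) ≤ α l * (e ^ 2 / (4 * τ k)) :=
      mul_le_of_le_one_left (by positivity) ht1
    have f5 : t * (B ^ 3 * α l ^ 2) ≤ B ^ 3 * α l ^ 2 := mul_le_of_le_one_left (by positivity) ht1
    linarith
  -- The same replacement in the Lagrange term costs another 2, whence the coefficient 5 in
  -- `penaltyExcess`.
  have h3 : lam * a ≤ lam * a' + Λ * (2 * B ^ 3 * α l) := by
    have f1 : lam * (a - a') ≤ Λ * (2 * B ^ 3 * α l) :=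
      (mul_le_mul_of_nonneg_left (abs_sub_comm a' a ▸ le_abs_self (a - a')) h0).trans
        (mul_le_mul h1 habs (abs_nonneg _) hΛ)
    linarith
  have h4 := mul_le_mul_of_nonneg_left (h3.trans (add_le_add_left hpen _)) ha0.le
  have h5 := mul_le_mul_of_nonneg_left hmain hΛ
  have h6 := mul_le_mul_of_nonneg_left h2 hΛ
  linarith

end SurrogateRun
end Lyapunov

/-! ### Summability of the squared distances. -/

section SquareSummability

variable {ι F J : Type*} [Fintype ι] [MeasurableSpace F] [Fintype J]

theorem summable_smoothWidth_sq : Summable fun l : ℕ => smoothWidth l ^ 2 := by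
  have hs : Summable fun l : ℕ => ((l + 1 : ℕ) : ℝ) ^ (-(3 / 2) : ℝ) :=
    (summable_nat_add_iff 1 (f := fun l : ℕ => (l : ℝ) ^ (-(3 / 2) : ℝ))).2
      (Real.summable_nat_rpow.2 (by norm_num))
  refine hs.congr fun l => ?_
  rw [smoothWidth, ← Real.rpow_natCast, ← Real.rpow_mul (by positivity)]
  push_cast
  norm_num

theorem rate_sq (l : ℕ) : (((l : ℝ) + 1) ^ (-(3 / 8) : ℝ)) ^ 2 = smoothWidth l := by
  rw [smoothWidth, ← Real.rpow_natCast, ← Real.rpow_mul (by positivity)]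
  norm_num

theorem summable_inv_mul_rate :
    Summable fun l : ℕ => ((l : ℝ) + 2)⁻¹ * ((l : ℝ) + 1) ^ (-(3 / 8) : ℝ) := by
  have hs : Summable fun l : ℕ => ((l + 1 : ℕ) : ℝ) ^ (-(11 / 8) : ℝ) :=
    (summable_nat_add_iff 1 (f := fun l : ℕ => (l : ℝ) ^ (-(11 / 8) : ℝ))).2
      (Real.summable_nat_rpow.2 (by norm_num))
  refine Summable.of_nonneg_of_le (fun l => by positivity) (fun l => ?_) hs
  have hl : (0 : ℝ) < (l : ℝ) + 1 := by positivity
  have e : ((l + 1 : ℕ) : ℝ) ^ (-(11 / 8) : ℝ)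
      = ((l : ℝ) + 1)⁻¹ * ((l : ℝ) + 1) ^ (-(3 / 8) : ℝ) := by
    rw [← Real.rpow_neg_one, ← Real.rpow_add hl]
    push_cast
    norm_num
  rw [e]
  gcongr
  linarith

namespace SurrogateRun

variable {ν : Measure F} {X χ : Set (EuclideanSpace ℝ ι)} {o : EuclideanSpace ℝ ι →L[ℝ] ℝ}
  {ψ : J → EuclideanSpace ℝ ι → F → ℝ} {g : J → EuclideanSpace ℝ ι → F → EuclideanSpace ℝ ι}
  {L : J → F → ℝ} {τ : J → ℝ} {α β : ℕ → ℝ} {h : ℕ → F} {x xbar : ℕ → EuclideanSpace ℝ ι}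

omit [Fintype J] in
-- Three sources of gradient error: the sample average, the averaged noise and the lag of the
-- recursive average. The square of the uniform rate is exactly the smoothing width.
theorem norm_sampleGrad_sub_sq_le {C : ℝ} {k : J} {l : ℕ}
    (hC : ‖sampleMean (g k) h l (x l) - ∫ s, g k (x l) s ∂ν‖
      ≤ C * ((l : ℝ) + 1) ^ (-(3 / 8) : ℝ)) :
    ‖sampleMean (g k) h l (x l) - gradTrack (g k) β h x l‖ ^ 2
      ≤ 3 * (C ^ 2 * smoothWidth l
        + ‖recAverage β (fun l => g k (x l) (h l) - ∫ s, g k (x l) s ∂ν) l‖ ^ 2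
        + ‖recAverage β (fun l => ∫ s, g k (x l) s ∂ν) l - ∫ s, g k (x l) s ∂ν‖ ^ 2) := by
  rw [← rate_sq, ← mul_pow, gradTrack_eq ν]
  set u := recAverage β (fun l => g k (x l) (h l) - ∫ s, g k (x l) s ∂ν) l
  set b := recAverage β (fun l => ∫ s, g k (x l) s ∂ν) l
  set m := ∫ s, g k (x l) s ∂ν
  have e : sampleMean (g k) h l (x l) - (u + b) = sampleMean (g k) h l (x l) - m - u - (b - m) := by
    abel
  have h1 := norm_sub_le (sampleMean (g k) h l (x l) - m - u) (b - m)
  have h2 := norm_sub_le (sampleMean (g k) h l (x l) - m) u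
  set q := C * ((l : ℝ) + 1) ^ (-(3 / 8) : ℝ)
  calc ‖sampleMean (g k) h l (x l) - (u + b)‖ ^ 2 ≤ (q + ‖u‖ + ‖b - m‖) ^ 2 := by
        rw [e]; gcongr; linarith
    _ ≤ 3 * (q ^ 2 + ‖u‖ ^ 2 + ‖b - m‖ ^ 2) := by
        nlinarith [sq_nonneg (q - ‖u‖), sq_nonneg (q - ‖b - m‖), sq_nonneg (‖u‖ - ‖b - m‖)]

variable (r : SurrogateRun ν X χ o ψ g L τ α β h x xbar)
include r

omit [Fintype J] in
theorem bddSumsFrom_step_mul_width (M : ℕ) : BddSumsFrom M fun l => α l * smoothWidth l :=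
  ((r.step_sq.bddSumsFrom fun l => sq_nonneg _).add
    (summable_smoothWidth_sq.bddSumsFrom fun l => sq_nonneg _)).mono fun l _ => by
      nlinarith [sq_nonneg (α l - smoothWidth l), sq_nonneg (α l), sq_nonneg (smoothWidth l)]

/-- Every contribution has partial sums bounded above, except the lag of the gradient estimate,
which is charged to the squared distances with a small factor. -/
theorem eventually_sum_penaltyExcess_le [Nonempty J] {B C : ℝ} (hB : 0 ≤ B) (hC : 0 ≤ C) (k : J)
    {ε : ℝ} (hε : 0 < ε) :
    ∀ᶠ M in atTop, ∃ D : ℝ, ∀ n, M ≤ n →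
      ∑ l ∈ Finset.Ico M n, penaltyExcess ν (ψ k) (g k) (τ k) α β h x B C l
        ≤ D + ε * ∑ l ∈ Finset.Ico M n, α l * ‖xbar l - x l‖ ^ 2 := by
  obtain ⟨C', -, hC'⟩ := (r.typical k).rate_grad
  have hτ := r.curv_pos k
  -- The noise is square summable with the weights `β`; eventually these dominate `α`.
  have hle : ∀ᶠ l in atTop, α l ≤ β l := by
    filter_upwards [r.ratio_tendsto.eventually_le_const zero_lt_one] with l hl
    rwa [div_le_one (r.weight_mem l).1] at hl
  have hrec := eventually_sum_recAverage_sub_le (v := fun l => ∫ s, g k (x l) s ∂ν)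
    r.step_mem r.weight_mem r.ratio_tendsto (r.mean_grad_step k)
    (ε := ε / (3 / (4 * τ k))) (by positivity)
  filter_upwards [hrec, eventually_forall_ge_atTop.2 hle] with M hM hleM
  obtain ⟨D₁, hD₁⟩ := hM
  have h2 : BddSumsFrom M fun l => α l * smoothWidth l := r.bddSumsFrom_step_mul_width M
  have h3 : BddSumsFrom M fun l => α l ^ 2 := r.step_sq.bddSumsFrom fun l => sq_nonneg _
  have h4 : BddSumsFrom M fun l => α l
      * ‖recAverage β (fun l => g k (x l) (h l) - ∫ s, g k (x l) s ∂ν) l‖ ^ 2 :=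
    ((r.typical k).noise_summable.bddSumsFrom fun l =>
      mul_nonneg (r.weight_mem l).1.le (sq_nonneg _)).mono fun l hl =>
        mul_le_mul_of_nonneg_right (hleM l hl) (sq_nonneg _)
  obtain ⟨a, ha⟩ := (r.typical k).penalty_tendsto
  have h5 : BddSumsFrom M fun l => penaltySlope (ψ k) h x l * penaltyNoise ν (ψ k) h x l :=
    bddSumsFrom_of_tendsto ha
  have h6 : BddSumsFrom M fun l => penaltyNoise ν (ψ k) h x l ^ 2 / smoothWidth l :=
    (r.typical k).penalty_summable.bddSumsFrom fun l =>
      div_nonneg (sq_nonneg _) (smoothWidth_pos l).le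
  have h7 : BddSumsFrom M fun l : ℕ => ((l : ℝ) + 2)⁻¹ * ((l : ℝ) + 1) ^ (-(3 / 8) : ℝ) :=
    summable_inv_mul_rate.bddSumsFrom fun l => by positivity
  have h8 : BddSumsFrom M fun l => smoothWidth l - smoothWidth (l + 1) :=
    bddSumsFrom_telescope fun l => (smoothWidth_pos l).le
  have hq : 0 ≤ 3 / (4 * τ k) := by positivity
  obtain ⟨D₂, hD₂⟩ := ((((((h2.const_mul (c := 1 + 3 / (4 * τ k) * C' ^ 2) (by positivity)).add
    (h3.const_mul (c := 5 * B ^ 3) (by positivity))).add (h4.const_mul hq)).add h5).add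
    (h6.const_mul (c := 1 / 2) (by norm_num))).add (h7.const_mul hC)).add
    (h8.const_mul (c := 1 / 2) (by norm_num))
  refine ⟨D₂ + 3 / (4 * τ k) * D₁, fun n hn => ?_⟩
  have hD₁' := mul_le_mul_of_nonneg_left (hD₁ n hn) hq
  have e : 3 / (4 * τ k) * (D₁ + ε / (3 / (4 * τ k))
      * ∑ l ∈ Finset.Ico M n, α l * ‖xbar l - x l‖ ^ 2)
      = 3 / (4 * τ k) * D₁ + ε * ∑ l ∈ Finset.Ico M n, α l * ‖xbar l - x l‖ ^ 2 := by
    field_simp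
  rw [e, Finset.mul_sum] at hD₁'
  have hD₂' := hD₂ n hn
  have hsum : ∑ l ∈ Finset.Ico M n, penaltyExcess ν (ψ k) (g k) (τ k) α β h x B C l ≤ _ :=
    (Finset.sum_le_sum fun l hl => ?_).trans
      (Finset.sum_add_distrib.le.trans (add_le_add hD₂' hD₁'))
  · linarith
  · have hsq := norm_sampleGrad_sub_sq_le (β := β) (hC' l (x l) (r.mem_reg l))
    have h9 : α l * (‖sampleMean (g k) h l (x l) - gradTrack (g k) β h x l‖ ^ 2 / (4 * τ k))
        ≤ α l * (3 * (C' ^ 2 * smoothWidth l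
          + ‖recAverage β (fun l => g k (x l) (h l) - ∫ s, g k (x l) s ∂ν) l‖ ^ 2
          + ‖recAverage β (fun l => ∫ s, g k (x l) s ∂ν) l - ∫ s, g k (x l) s ∂ν‖ ^ 2)
          / (4 * τ k)) := by
      have := (r.step_mem l).1
      gcongr
    have e1 : penaltyNoise ν (ψ k) h x l ^ 2 / (2 * smoothWidth l)
        = 1 / 2 * (penaltyNoise ν (ψ k) h x l ^ 2 / smoothWidth l) := by
      have := (smoothWidth_pos l).ne'
      field_simp
    unfold penaltyExcess
    rw [e1]
    refine (add_le_add_left (add_le_add_left (add_le_add_left (add_le_add_left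
      (add_le_add_right h9 _) _) _) _) _).trans (le_of_eq ?_)
    ring

/-- The squared distances to the surrogate solutions are summable along the run. -/
theorem summable_step_mul_sq [Nonempty J] : Summable fun l => α l * ‖xbar l - x l‖ ^ 2 := by
  obtain ⟨B, hB1, -, hgB, hLB, -, hd, -⟩ := r.exists_bounds
  obtain ⟨Λ, c, hΛ, hc, hdec⟩ := r.eventually_exists_multipliers
  choose C hC0 hC using fun k => (r.typical k).rate_fun
  -- The excesses of all constraints, multiplied by `Λ`, together return `c / 2` times the sum of
  -- squared distances. This is absorbed on the left.
  set ε : ℝ := c / (2 * (Λ * (Fintype.card J : ℝ))) with hε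
  have hcard : (0 : ℝ) < Fintype.card J := by exact_mod_cast Fintype.card_pos
  have hε0 : 0 < ε := by positivity
  obtain ⟨M, hM, hdecM⟩ := ((eventually_all.2 fun k =>
    r.eventually_sum_penaltyExcess_le (zero_le_one.trans hB1) (hC0 k) k hε0).and
    (eventually_forall_ge_atTop.2 hdec)).exists
  choose D hD using hM
  set Φ : ℕ → ℝ := fun l => o (x l)
    + ∑ k, Λ * smoothPos (smoothWidth l) (sampleMean (ψ k) h l (x l)) with hΦ
  set S : ℕ → ℝ := fun n => ∑ l ∈ Finset.Ico M n, α l * ‖xbar l - x l‖ ^ 2 with hS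
  have hΦ0 : ∀ l, 0 ≤ Φ l := fun l => add_nonneg (r.obj_nonneg _ (r.mem l))
    (Finset.sum_nonneg fun k _ => mul_nonneg hΛ.le (smoothPos_nonneg (smoothWidth_pos l) _))
  have hstep : ∀ l, M ≤ l → c * (α l * ‖xbar l - x l‖ ^ 2) ≤ -(Φ (l + 1) - Φ l)
      + Λ * ∑ k, penaltyExcess ν (ψ k) (g k) (τ k) α β h x B (C k) l := by
    intro l hl
    obtain ⟨hfeas, lam, hlam, hle⟩ := hdecM l hl
    have h1 := Finset.sum_le_sum fun k (_ : k ∈ Finset.univ) => r.lagrange_add_penalty_le hB1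
      (hgB k l _ (r.mem_reg l)) (hLB k) (hd l) (hC k l _ (r.mem_reg (l + 1))) (hfeas k)
      (hlam k).1 (hlam k).2
    rw [Finset.sum_add_distrib, Finset.sum_add_distrib, ← Finset.mul_sum, ← Finset.mul_sum _ _ Λ,
      ← Finset.mul_sum _ _ Λ, ← Finset.mul_sum _ _ Λ] at h1
    have h2 := mul_le_mul_of_nonneg_left hle (r.step_mem l).1.le
    have h3 : o (x (l + 1)) = o (x l) + α l * (o (xbar l) - o (x l)) := by
      rw [r.step, map_add, map_smul, map_smul, smul_eq_mul, smul_eq_mul]; ring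
    simp only [hΦ, ← Finset.mul_sum]
    linarith
  have hbound : ∀ n, M ≤ n → S n ≤ 2 / c * (Φ M + Λ * ∑ k, D k) := by
    intro n hn
    have h1 := Finset.sum_le_sum fun l (hl : l ∈ Finset.Ico M n) =>
      hstep l (Finset.mem_Ico.1 hl).1
    rw [← Finset.mul_sum, Finset.sum_add_distrib, Finset.sum_neg_distrib, Finset.sum_Ico_sub _ hn,
      ← Finset.mul_sum, Finset.sum_comm] at h1
    have h2 := Finset.sum_le_sum fun k (_ : k ∈ Finset.univ) => hD k n hn
    rw [Finset.sum_add_distrib, Finset.sum_const, Finset.card_univ, nsmul_eq_mul] at h2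
    have h3 := mul_le_mul_of_nonneg_left h2 hΛ.le
    have h4 : Λ * (∑ k, D k + Fintype.card J * (ε * S n)) = Λ * ∑ k, D k + c / 2 * S n := by
      rw [hε]; field_simp
    change _ ≤ Λ * (∑ k, D k + Fintype.card J * (ε * S n)) at h3
    rw [h4] at h3
    change c * S n ≤ _ at h1
    have h5 : c / 2 * S n ≤ Φ M + Λ * ∑ k, D k := by linarith [hΦ0 n]
    calc S n = 2 / c * (c / 2 * S n) := by field_simp
      _ ≤ _ := mul_le_mul_of_nonneg_left h5 (by positivity)
  have h0 : ∀ l, 0 ≤ α l * ‖xbar l - x l‖ ^ 2 := fun l =>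
    mul_nonneg (r.step_mem l).1.le (sq_nonneg _)
  refine summable_of_sum_range_le (c := ∑ l ∈ Finset.range M, α l * ‖xbar l - x l‖ ^ 2
    + 2 / c * (Φ M + Λ * ∑ k, D k)) h0 fun n => ?_
  have h6 := hbound (max n M) (le_max_right _ _)
  have h7 : ∑ l ∈ Finset.range n, α l * ‖xbar l - x l‖ ^ 2
      ≤ ∑ l ∈ Finset.range (max n M), α l * ‖xbar l - x l‖ ^ 2 :=
    Finset.sum_le_sum_of_subset_of_nonneg (Finset.range_mono (le_max_left _ _)) fun l _ _ => h0 l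
  have h8 := Finset.sum_range_add_sum_Ico (fun l => α l * ‖xbar l - x l‖ ^ 2) (le_max_right n M)
  change _ + S (max n M) = _ at h8
  linarith

end SurrogateRun
end SquareSummability

/-! ### Optimality of limit points. -/

section LimitPoints

/-- A sequence moving with speed at most `B` that is driven away from `z` near `z` at finite total
cost does not accumulate at `z`. -/
theorem not_tendsto_of_summable_step_mul_sq {E : Type*} [NormedAddCommGroup E] {x : ℕ → E}
    {α d : ℕ → ℝ} {B c : ℝ} {N : ℕ} (hα : ∀ l, 0 ≤ α l) (hB : 0 < B) (hc : 0 < c)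
    (hα_sum : Tendsto (fun n => ∑ l ∈ Finset.range n, α l) atTop atTop)
    (hstep : ∀ l, ‖x (l + 1) - x l‖ ≤ B * α l) (hsum : Summable fun l => α l * d l ^ 2) {z : E}
    (hd : ∀ l, N ≤ l → ‖x l - z‖ < c → c ≤ d l) {φ : ℕ → ℕ} (hφ : StrictMono φ) :
    ¬ Tendsto (fun j => x (φ j)) atTop (𝓝 z) := by
  intro hz
  have hw0 : ∀ l, 0 ≤ α l * d l ^ 2 := fun l => mul_nonneg (hα l) (sq_nonneg _)
  have htail := (tendsto_sum_nat_add fun l => α l * d l ^ 2).eventually_lt_const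
    (show 0 < c ^ 3 / (2 * B) by positivity)
  have hclose := (tendsto_iff_norm_sub_tendsto_zero.1 hz).eventually_lt_const (half_pos hc)
  obtain ⟨j, hj1, hj2, hj3⟩ := (hclose.and ((hφ.tendsto_atTop.eventually htail).and
    (hφ.tendsto_atTop.eventually_ge_atTop N))).exists
  set m := φ j
  -- Inside the `c`-ball each unit of step costs at least `c ^ 2`, and the remaining cost is below
  -- `c ^ 3 / (2 * B)`. The total displacement is thus at most `c / 2`; starting within `c / 2` of
  -- `z`, the path never leaves, against the divergent step sum.
  have hpart : ∀ n, m ≤ n → (∀ l, m ≤ l → l < n → ‖x l - z‖ < c) →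
      ∑ l ∈ Finset.Ico m n, α l ≤ c / (2 * B) := by
    intro n hn hl
    have h1 : ∑ l ∈ Finset.Ico m n, α l * c ^ 2 ≤ ∑ l ∈ Finset.Ico m n, α l * d l ^ 2 := by
      refine Finset.sum_le_sum fun l hlm => ?_
      obtain ⟨h2, h3⟩ := Finset.mem_Ico.1 hlm
      have := hd l (hj3.trans h2) (hl l h2 h3)
      have := hα l
      gcongr
    have h2 : ∑ l ∈ Finset.Ico m n, α l * d l ^ 2 ≤ ∑' l, α (l + m) * d (l + m) ^ 2 := by
      rw [Finset.sum_Ico_eq_sum_range]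
      simp only [add_comm m]
      exact ((summable_nat_add_iff m).2 hsum).sum_le_tsum _ fun l _ => hw0 _
    rw [← Finset.sum_mul] at h1
    have h3 : (∑ l ∈ Finset.Ico m n, α l) * c ^ 2 ≤ c / (2 * B) * c ^ 2 :=
      (h1.trans (h2.trans hj2.le)).trans_eq (by ring)
    exact le_of_mul_le_mul_right h3 (by positivity)
  have hmove : ∀ n, m ≤ n → ‖x n - x m‖ ≤ B * ∑ l ∈ Finset.Ico m n, α l := by
    intro n hn
    rw [← Finset.sum_Ico_sub x hn, Finset.mul_sum]
    exact (norm_sum_le _ _).trans (Finset.sum_le_sum fun l _ => hstep l)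
  have hstay : ∀ n, m ≤ n → ‖x n - z‖ < c := by
    intro n
    induction n using Nat.strong_induction_on with
    | _ n ih =>
      intro hn
      have h1 := hpart n hn fun l hl hln => ih l hln hl
      have h2 := (hmove n hn).trans (mul_le_mul_of_nonneg_left h1 hB.le)
      have h3 : B * (c / (2 * B)) = c / 2 := by field_simp
      have h4 := norm_sub_le_norm_sub_add_norm_sub (x n) (x m) z
      linarith
  obtain ⟨n, hn1, hn2⟩ := ((hα_sum.eventually_gt_atTop
    (∑ l ∈ Finset.range m, α l + c / (2 * B))).and (eventually_ge_atTop m)).exists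
  have h1 := hpart n hn2 fun l hl _ => hstay l hl
  have h2 := Finset.sum_range_add_sum_Ico α hn2
  linarith

variable {ι F J : Type*} [Fintype ι] [MeasurableSpace F] [Fintype J]

namespace SurrogateRun

variable {ν : Measure F} {X χ : Set (EuclideanSpace ℝ ι)} {o : EuclideanSpace ℝ ι →L[ℝ] ℝ}
  {ψ : J → EuclideanSpace ℝ ι → F → ℝ} {g : J → EuclideanSpace ℝ ι → F → EuclideanSpace ℝ ι}
  {L : J → F → ℝ} {τ : J → ℝ} {α β : ℕ → ℝ} {h : ℕ → F} {x xbar : ℕ → EuclideanSpace ℝ ι}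

variable (r : SurrogateRun ν X χ o ψ g L τ α β h x xbar)
include r

/-- If `xbar - x` became small along some sequence of iterates tending to `z`, then `xbar` would
tend to `z` too. As `y` is eventually feasible for the surrogates, `o z ≤ o y` would follow in the
limit. Otherwise `xbar - x` is bounded below near `z`, which summability excludes at a limit point.
-/
theorem objective_le_of_limitModel_lt [Nonempty J] {φ : ℕ → ℕ} {z : EuclideanSpace ℝ ι}
    (hφ : StrictMono φ) (hz : Tendsto (fun j => x (φ j)) atTop (𝓝 z)) {y : EuclideanSpace ℝ ι}
    (hy : y ∈ χ) (hlt : ∀ k, limitModel ν (ψ k) (g k) (τ k) z y < 0) : o z ≤ o y := by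
  by_contra hcon
  have key : ∃ c : ℝ, 0 < c ∧ ∃ N, ∀ l, N ≤ l → ‖x l - z‖ < c → c ≤ ‖xbar l - x l‖ := by
    by_contra hno
    push Not at hno
    obtain ⟨θ, hθ, hp⟩ := extraction_forall_of_frequently
      (P := fun n l => ‖x l - z‖ < ((n : ℝ) + 1)⁻¹ ∧ ‖xbar l - x l‖ < ((n : ℝ) + 1)⁻¹)
      fun n => frequently_atTop.2 fun N => by
        obtain ⟨l, h1, h2, h3⟩ := hno (((n : ℝ) + 1)⁻¹) (by positivity) N
        exact ⟨l, h1, h2, h3⟩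
    have hinv : Tendsto (fun n : ℕ => ((n : ℝ) + 1)⁻¹) atTop (𝓝 0) := by
      simpa only [one_div] using tendsto_one_div_add_atTop_nhds_zero_nat (𝕜 := ℝ)
    have h1 : Tendsto (fun n => x (θ n)) atTop (𝓝 z) := tendsto_iff_norm_sub_tendsto_zero.2
      (squeeze_zero (fun _ => norm_nonneg _) (fun n => (hp n).1.le) hinv)
    have h2 : Tendsto (fun n => xbar (θ n) - x (θ n)) atTop (𝓝 0) :=
      squeeze_zero_norm (fun n => (hp n).2.le) hinv
    have h3 : Tendsto (fun n => xbar (θ n)) atTop (𝓝 z) := by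
      simpa using h2.add h1
    have h4 : ∀ᶠ n in atTop, ∀ k, stepModel (ψ k) (g k) (τ k) β h x (θ n) y ≤ 0 :=
      eventually_all.2 fun k =>
        (r.tendsto_stepModel k hθ.tendsto_atTop h1 y).eventually_le_const (hlt k)
    exact hcon (le_of_tendsto ((o.continuous.tendsto z).comp h3)
      (h4.mono fun n hn => (r.solves (θ n) ⟨y, hy, hn⟩).2 y hy hn))
  obtain ⟨c, hc, N, hN⟩ := key
  obtain ⟨B, hB1, -, -, -, -, hd, -⟩ := r.exists_bounds
  refine not_tendsto_of_summable_step_mul_sq (fun l => (r.step_mem l).1.le) (zero_lt_one.trans_le hB1)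
    hc r.step_sum (fun l => ?_) r.summable_step_mul_sq hN hφ hz
  rw [r.norm_step, mul_comm]
  exact mul_le_mul_of_nonneg_right (hd l) (r.step_mem l).1.le

/-- Mixing `y` with a little of the Slater point makes its constraints strict; the fraction then
tends to zero. -/
theorem objective_le_of_limitModel_le [Nonempty J] {φ : ℕ → ℕ} {z : EuclideanSpace ℝ ι}
    (hφ : StrictMono φ) (hz : Tendsto (fun j => x (φ j)) atTop (𝓝 z)) {y : EuclideanSpace ℝ ι}
    (hy : y ∈ χ) (hle : ∀ k, limitModel ν (ψ k) (g k) (τ k) z y ≤ 0) : o z ≤ o y := by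
  obtain ⟨w, hw, hwlt⟩ := r.slater φ z hφ hz
  have key : ∀ t : ℝ, 0 < t → t ≤ 1 → o z ≤ (1 - t) * o y + t * o w := by
    intro t ht ht1
    have h1 := r.objective_le_of_limitModel_lt hφ hz
      (r.convex hy hw (sub_nonneg.2 ht1) ht.le (by ring)) fun k => ?_
    · simpa using h1
    · have h2 := (convexOn_quadModel r.convex (∫ s, ψ k z s ∂ν) (∫ s, g k z s ∂ν)
        (r.curv_pos k).le z).2 hy hw (sub_nonneg.2 ht1) ht.le (by ring)
      refine h2.trans_lt ?_
      have h3 := mul_nonpos_of_nonneg_of_nonpos (sub_nonneg.2 ht1) (hle k)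
      have h4 := mul_neg_of_pos_of_neg ht (hwlt k)
      simp only [limitModel] at h3 h4
      simp only [smul_eq_mul]
      linarith
  have hlim : Tendsto (fun t : ℝ => (1 - t) * o y + t * o w) (𝓝[>] 0)
      (𝓝 ((1 - 0) * o y + 0 * o w)) := by
    refine Tendsto.mono_left (Continuous.tendsto ?_ 0) nhdsWithin_le_nhds
    fun_prop
  rw [sub_zero, one_mul, zero_mul, add_zero] at hlim
  refine ge_of_tendsto hlim ?_
  filter_upwards [Ioc_mem_nhdsGT (zero_lt_one' ℝ)] with t ht
  exact key t ht.1 ht.2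

/-- The limit points are Karush-Kuhn-Tucker points of the averaged problem. -/
theorem exists_multipliers_of_tendsto [Nonempty J] {φ : ℕ → ℕ} {z : EuclideanSpace ℝ ι}
    (hφ : StrictMono φ) (hz : Tendsto (fun j => x (φ j)) atTop (𝓝 z)) :
    ∃ lam : J → ℝ, (∀ k, 0 ≤ lam k) ∧ (∀ k, lam k * ∫ s, ψ k z s ∂ν = 0) ∧
      ∀ y ∈ χ, 0 ≤ o (y - z) + ∑ k, lam k * inner ℝ (∫ s, g k z s ∂ν) (y - z) := by
  have hzχ : z ∈ χ := r.isClosed.mem_of_tendsto hz (Eventually.of_forall fun j => r.mem _)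
  obtain ⟨w, hw, hwlt⟩ := r.slater φ z hφ hz
  obtain ⟨lam, hlam0, hcomp, hlag⟩ := exists_multipliers_of_slater (χ := χ) (o := o)
    (o.toLinearMap.convexOn r.convex)
    (fun k => convexOn_quadModel r.convex (∫ s, ψ k z s ∂ν) (∫ s, g k z s ∂ν)
      (r.curv_pos k).le z) hzχ
    (fun k => (quadModel_self _ _ _ _).trans_le (r.mean_le_zero_of_tendsto k hφ.tendsto_atTop hz))
    (fun y hy hle => r.objective_le_of_limitModel_le hφ hz hy hle) hw hwlt
  simp only [quadModel_self] at hcomp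
  refine ⟨lam, hlam0, hcomp, fun y hy => ?_⟩
  -- Along the segment from `z` towards `y` the curvature of the surrogates is of second order in
  -- `t`. Division by `t` and `t → 0` leave the first order condition.
  have key : ∀ t : ℝ, 0 < t → t ≤ 1 →
      0 ≤ o (y - z) + ∑ k, lam k * inner ℝ (∫ s, g k z s ∂ν) (y - z)
        + t * ∑ k, lam k * (τ k * ‖y - z‖ ^ 2) := by
    intro t ht ht1
    have h1 := hlag (z + t • (y - z)) (r.convex.add_smul_sub_mem hzχ hy ⟨ht.le, ht1⟩)
    have e : ∀ k, lam k * quadModel (∫ s, ψ k z s ∂ν) (∫ s, g k z s ∂ν) (τ k) z (z + t • (y - z))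
        = t * (lam k * inner ℝ (∫ s, g k z s ∂ν) (y - z)
          + t * (lam k * (τ k * ‖y - z‖ ^ 2))) := fun k => by
      rw [quadModel, add_sub_cancel_left, inner_smul_right, norm_smul, mul_pow, Real.norm_eq_abs,
        sq_abs]
      linear_combination hcomp k
    simp only [e, ← Finset.mul_sum, Finset.sum_add_distrib, map_add, map_smul, smul_eq_mul] at h1
    have h2 : t * 0 ≤ t * (o (y - z) + ∑ k, lam k * inner ℝ (∫ s, g k z s ∂ν) (y - z)
        + t * ∑ k, lam k * (τ k * ‖y - z‖ ^ 2)) := by linarith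
    exact le_of_mul_le_mul_left h2 ht
  have hlim : Tendsto (fun t : ℝ => o (y - z) + ∑ k, lam k * inner ℝ (∫ s, g k z s ∂ν) (y - z)
      + t * ∑ k, lam k * (τ k * ‖y - z‖ ^ 2)) (𝓝[>] 0)
      (𝓝 (o (y - z) + ∑ k, lam k * inner ℝ (∫ s, g k z s ∂ν) (y - z)
        + 0 * ∑ k, lam k * (τ k * ‖y - z‖ ^ 2))) := by
    refine Tendsto.mono_left (Continuous.tendsto ?_ 0) nhdsWithin_le_nhds
    fun_prop
  rw [zero_mul, add_zero] at hlim
  refine ge_of_tendsto hlim ?_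
  filter_upwards [Ioc_mem_nhdsGT (zero_lt_one' ℝ)] with t ht
  exact key t ht.1 ht.2

end SurrogateRun
end LimitPoints

/-! ### The uplink problem -/

theorem memLp_const_mul_one_add_norm_pow {M K : ℕ} {ν : Measure (RSSCA.Channel M K)}
    [IsProbabilityMeasure ν]
    (hmom : ∀ (q : ℕ) (m : Fin M) (k : Fin K), Integrable (fun h => ‖h m k‖ ^ q) ν)
    (B : ℝ) (j p : ℕ) : MemLp (fun h : RSSCA.Channel M K => B * (1 + ‖h‖) ^ j) p ν := by
  have hmeas : ∀ q : ℕ, AEStronglyMeasurable (fun h : RSSCA.Channel M K => (1 + ‖h‖) ^ q) ν :=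
    fun q => ((continuous_const.add continuous_norm).pow q).aestronglyMeasurable
  have hnorm : ∀ (q : ℕ) (h : RSSCA.Channel M K), q ≠ 0 →
      ‖h‖ ^ q ≤ ∑ m, ∑ k, ‖h m k‖ ^ q := by
    intro q h hq
    have h0 : (0 : ℝ) ≤ ∑ m, ∑ k, ‖h m k‖ ^ q :=
      Finset.sum_nonneg fun m _ => Finset.sum_nonneg fun k _ => by positivity
    have h1 : ‖h‖ ≤ (∑ m, ∑ k, ‖h m k‖ ^ q) ^ ((q : ℝ)⁻¹) := by
      refine (pi_norm_le_iff_of_nonneg (by positivity)).2 fun m =>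
        (pi_norm_le_iff_of_nonneg (by positivity)).2 fun k => ?_
      rw [Real.le_rpow_inv_iff_of_pos (norm_nonneg _) h0 (by positivity), Real.rpow_natCast]
      refine le_trans ?_ (Finset.single_le_sum (f := fun m => ∑ k, ‖h m k‖ ^ q)
        (fun m _ => Finset.sum_nonneg fun k _ => by positivity) (Finset.mem_univ m))
      exact Finset.single_le_sum (f := fun k => ‖h m k‖ ^ q) (fun k _ => by positivity)
        (Finset.mem_univ k)
    rwa [Real.le_rpow_inv_iff_of_pos (norm_nonneg _) h0 (by positivity), Real.rpow_natCast] at h1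
  have hint : ∀ q : ℕ, Integrable (fun h : RSSCA.Channel M K => (1 + ‖h‖) ^ q) ν := by
    intro q
    rcases eq_or_ne q 0 with rfl | hq
    · simp
    refine Integrable.mono' (g := fun h => 2 ^ (q - 1) * (1 + ∑ m, ∑ k, ‖h m k‖ ^ q))
      (((integrable_const 1).add (integrable_finsetSum _ fun m _ =>
        integrable_finsetSum _ fun k _ => hmom q m k)).const_mul _) (hmeas q)
      (Eventually.of_forall fun h => ?_)
    rw [Real.norm_of_nonneg (by positivity)]
    refine (add_pow_le zero_le_one (norm_nonneg h) q).trans ?_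
    rw [one_pow]
    gcongr
    exact hnorm q h hq
  refine MemLp.const_mul ?_ B
  rcases eq_or_ne p 0 with rfl | hp
  · simpa using hmeas j
  rw [← integrable_norm_rpow_iff (hmeas j) (by exact_mod_cast hp) (by simp)]
  refine (hint (j * p)).congr (Eventually.of_forall fun h => ?_)
  simp only [ENNReal.toReal_natCast, Real.rpow_natCast]
  rw [Real.norm_of_nonneg (by positivity), pow_mul]

namespace RSSCA

variable {M K S N : ℕ}

/-- The objective as a continuous linear functional. -/
def totalPowerCLM (K S N : ℕ) : Var K S N →L[ℝ] ℝ :=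
  ∑ k : Fin K, (EuclideanSpace.proj (𝕜 := ℝ) (Sum.inl k) : Var K S N →L[ℝ] ℝ)

theorem totalPowerCLM_apply (x : Var K S N) : totalPowerCLM K S N x = totalPower x := by
  simp [totalPowerCLM, totalPower, power]

theorem inner_gradient_totalPower (z v : Var K S N) :
    inner ℝ (gradient totalPower z) v = totalPowerCLM K S N v := by
  have e : (totalPower : Var K S N → ℝ) = totalPowerCLM K S N :=
    funext fun x => (totalPowerCLM_apply x).symm
  rw [inner_gradient_left, e, ContinuousLinearMap.fderiv]

theorem convex_physical : Convex ℝ (physical K S N) := fun x hx y hy a b ha hb _ k => by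
  have h1 : power (a • x + b • y) k = a * power x k + b * power y k := by simp [power]
  rw [h1]
  exact add_nonneg (mul_nonneg ha (hx k)) (mul_nonneg hb (hy k))

/-- A convex set with nonempty interior determines derivatives, so one-sided gradients are well
defined on the boundary. -/
theorem uniqueDiffOn_physical : UniqueDiffOn ℝ (physical K S N) := by
  refine uniqueDiffOn_convex convex_physical ⟨WithLp.toLp 2 fun _ => 1, ?_⟩
  have hopen : IsOpen {x : Var K S N | ∀ k, 0 < power x k} := by
    have : {x : Var K S N | ∀ k, 0 < power x k} = ⋂ k, {x | 0 < power x k} := by ext x; simp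
    rw [this]
    exact isOpen_iInter_of_finite fun k => isOpen_lt continuous_const
      (EuclideanSpace.proj (𝕜 := ℝ) (Sum.inl k) : Var K S N →L[ℝ] ℝ).continuous
  exact interior_maximal (fun x hx k => (hx k).le) hopen fun k => by simp [power]

namespace Uplink

variable (sys : Uplink M K S N)

theorem convex_chi : Convex ℝ sys.chi := by
  rintro x ⟨hx1, hx2, hx3, hx4⟩ y ⟨hy1, hy2, hy3, hy4⟩ a b ha hb hab
  have hp : ∀ k, power (a • x + b • y) k = a * power x k + b * power y k := fun k => by
    simp [power]
  have hc : ∀ i j, sel (a • x + b • y) i j = a * sel x i j + b * sel y i j := fun i j => by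
    simp [sel]
  have hcomb : ∀ {u v w : ℝ}, u ≤ w → v ≤ w → a * u + b * v ≤ w := fun {u v w} hu hv => by
    calc a * u + b * v ≤ a * w + b * w := by gcongr
      _ = w := by rw [← add_mul, hab, one_mul]
  refine ⟨fun k => ?_, fun j => ?_, fun i => ?_, fun i j => ?_⟩
  · rw [hp]
    exact ⟨add_nonneg (mul_nonneg ha (hx1 k).1) (mul_nonneg hb (hy1 k).1),
      hcomb (hx1 k).2 (hy1 k).2⟩
  · simp only [hc, Finset.sum_add_distrib, ← Finset.mul_sum, hx2, hy2, mul_one, hab]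
  · simp only [hc, Finset.sum_add_distrib, ← Finset.mul_sum]
    exact hcomb (hx3 i) (hy3 i)
  · rw [hc]
    exact ⟨add_nonneg (mul_nonneg ha (hx4 i j).1) (mul_nonneg hb (hy4 i j).1),
      hcomb (hx4 i j).2 (hy4 i j).2⟩

theorem isClosed_chi : IsClosed sys.chi := by
  have hp : ∀ k, Continuous fun x : Var K S N => power x k := fun k =>
    (EuclideanSpace.proj (𝕜 := ℝ) (Sum.inl k) : Var K S N →L[ℝ] ℝ).continuous
  have hc : ∀ i j, Continuous fun x : Var K S N => sel x i j := fun i j =>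
    (EuclideanSpace.proj (𝕜 := ℝ) (Sum.inr (Sum.inl (i, j))) : Var K S N →L[ℝ] ℝ).continuous
  have e : sys.chi = (⋂ k, {x : Var K S N | 0 ≤ power x k} ∩ {x | power x k ≤ sys.maxPower k}) ∩
      ((⋂ j, {x | ∑ i, sel x i j = 1}) ∩ ((⋂ i, {x | ∑ j, sel x i j ≤ 1}) ∩
        ⋂ i, ⋂ j, {x | 0 ≤ sel x i j} ∩ {x | sel x i j ≤ 1})) := by
    ext x
    simp only [chi, Set.mem_ofPred_eq, Set.mem_inter_iff, Set.mem_iInter]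
  rw [e]
  exact (isClosed_iInter fun k => (isClosed_le continuous_const (hp k)).inter
    (isClosed_le (hp k) continuous_const)).inter
    ((isClosed_iInter fun j => isClosed_eq (continuous_finsetSum _ fun i _ => hc i j)
      continuous_const).inter ((isClosed_iInter fun i => isClosed_le
        (continuous_finsetSum _ fun j _ => hc i j) continuous_const).inter
      (isClosed_iInter fun i => isClosed_iInter fun j =>
        (isClosed_le continuous_const (hc i j)).inter (isClosed_le (hc i j) continuous_const))))

theorem chi_subset_physical : sys.chi ⊆ physical K S N := fun _ hx k => (hx.1 k).1

/-- Switching off all users and keeping the other coordinates stays admissible. -/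
theorem exists_mem_chi_totalPower_eq_zero {x : Var K S N} (hx : x ∈ sys.chi) :
    ∃ y ∈ sys.chi, totalPower y = 0 ∧ ‖y - x‖ ≤ ‖x‖ := by
  obtain ⟨h1, h2, h3, h4⟩ := hx
  set y : Var K S N := WithLp.toLp 2 (Sum.elim 0 fun c => x (Sum.inr c)) with hy
  have hp : ∀ k, power y k = 0 := fun k => rfl
  refine ⟨y, ⟨fun k => ?_, h2, h3, h4⟩, by simp [totalPower, hp], ?_⟩
  · rw [hp]; exact ⟨le_rfl, (h1 k).1.trans (h1 k).2⟩
  · rw [EuclideanSpace.norm_eq, EuclideanSpace.norm_eq]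
    refine Real.sqrt_le_sqrt (Finset.sum_le_sum fun c _ => ?_)
    rcases c with k | c
    · simp [hy]
    · simpa [hy] using sq_nonneg _

theorem isCompact_regularPart (n : ℕ) : IsCompact (sys.regularPart n) :=
  Metric.isCompact_of_isClosed_isBounded (sys.isClosed_regularPart n)
    ((Metric.isBounded_closedBall (x := (0 : Var K S N)) (r := n)).subset fun x hx => by
      simpa using hx.2.1)

/-- Compact sets of regular points are exhausted by the sets `regularPart n`. -/
theorem exists_subset_regularPart {C : Set (Var K S N)} (hC : IsCompact C)
    (hreg : C ⊆ sys.regular) : ∃ n, C ∩ physical K S N ⊆ sys.regularPart n := by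
  have h1 : ∀ k, ∃ δ : ℝ, 0 < δ ∧ ∀ x ∈ C, δ ≤ sys.impairment k x 0 := fun k => by
    rcases C.eq_empty_or_nonempty with rfl | hne
    · exact ⟨1, one_pos, by simp⟩
    · obtain ⟨x₀, hx₀, hmin⟩ :=
        hC.exists_isMinOn hne (sys.continuous_impairment_zero k).continuousOn
      exact ⟨_, hreg hx₀ k, fun x hx => hmin hx⟩
  choose δ hδ hδC using h1
  obtain ⟨R, hR⟩ := hC.isBounded.exists_norm_le
  have h2 : ∀ᶠ n : ℕ in atTop, ∀ k, ((n : ℝ) + 1)⁻¹ ≤ δ k := eventually_all.2 fun k => by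
    have := tendsto_one_div_add_atTop_nhds_zero_nat (𝕜 := ℝ)
    simp only [one_div] at this
    exact this.eventually_le_const (hδ k)
  obtain ⟨n, hn1, hn2⟩ := (h2.and (tendsto_natCast_atTop_atTop.eventually_ge_atTop R)).exists
  exact ⟨n, fun x hx => ⟨hx.2, (hR x hx.1).trans hn2, fun k => (hn1 k).trans (hδC k x hx.1)⟩⟩

theorem eventually_mem_regularPart {z : Var K S N} (hr : z ∈ sys.regular) :
    ∃ n, ∀ᶠ y in 𝓝[physical K S N] z, y ∈ sys.regularPart n := by
  have hopen : IsOpen sys.regular := by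
    have : sys.regular = ⋂ k, {x | 0 < sys.impairment k x 0} := by ext x; simp [regular]
    rw [this]
    exact isOpen_iInter_of_finite fun k =>
      isOpen_lt continuous_const (sys.continuous_impairment_zero k)
  obtain ⟨C, hCz, hCr, hC⟩ := local_compact_nhds (hopen.mem_nhds hr)
  obtain ⟨n, hn⟩ := sys.exists_subset_regularPart hC hCr
  refine ⟨n, ?_⟩
  filter_upwards [mem_nhdsWithin_of_mem_nhds hCz, self_mem_nhdsWithin] with y h1 h2
  exact hn ⟨h1, h2⟩

/-! ### Average rates and their one-sided gradients. -/

section Law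

variable {ν : Measure (Channel M K)} [IsProbabilityMeasure ν]

theorem exists_regularSample_memLp
    (hmom : ∀ (q : ℕ) (m : Fin M) (k : Fin K), Integrable (fun h => ‖h m k‖ ^ q) ν) (k : Fin K)
    (n : ℕ) : ∃ L : Channel M K → ℝ, (∀ h, 0 ≤ L h) ∧ (∀ p : ℕ, MemLp L p ν) ∧ Integrable L ν ∧
      RegularSample (sys.regularPart n) (sys.sampleConstr k) (sys.rateGrad k) L := by
  obtain ⟨B, hB, hS⟩ := sys.exists_regularSample k n
  have hL := memLp_const_mul_one_add_norm_pow hmom B 4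
  exact ⟨_, fun h => by positivity, hL, by simpa using (hL 1).integrable (by simp), hS⟩

theorem constr_eq
    (hmom : ∀ (q : ℕ) (m : Fin M) (k : Fin K), Integrable (fun h => ‖h m k‖ ^ q) ν) (k : Fin K)
    {n : ℕ} {x : Var K S N} (hx : x ∈ sys.regularPart n) :
    sys.constr ν k x = ∫ h, sys.sampleConstr k x h ∂ν := by
  obtain ⟨L, -, -, hLi, hS⟩ := sys.exists_regularSample_memLp hmom k n
  have hi := hS.integrable_fun hLi hx
  have e : (fun h => sys.rate k x h) = fun h => sys.targetRate k - sys.sampleConstr k x h :=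
    funext fun h => by
      rw [sys.sampleConstr_eq hx.1 (sys.regularPart_subset_regular n hx)]; ring
  rw [constr, avgRate, e, integral_sub (integrable_const _) hi]
  simp

/-- Integrating the Taylor estimate leaves a quadratic remainder. It is available only relative to
nonnegative powers, where the impairment is bounded below uniformly in the channel. -/
theorem hasGradientWithinAt_constr
    (hmom : ∀ (q : ℕ) (m : Fin M) (k : Fin K), Integrable (fun h => ‖h m k‖ ^ q) ν) (k : Fin K)
    {z : Var K S N} (hz : z ∈ physical K S N) (hr : z ∈ sys.regular) :
    HasGradientWithinAt (sys.constr ν k) (∫ h, sys.rateGrad k z h ∂ν) (physical K S N) z := by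
  obtain ⟨n, hn⟩ := sys.eventually_mem_regularPart hr
  obtain ⟨L, -, -, hLi, hS⟩ := sys.exists_regularSample_memLp hmom k n
  have hzn := hn.self_of_nhdsWithin hz
  rw [hasGradientWithinAt_iff_isLittleO]
  refine (Asymptotics.IsBigO.of_bound (∫ h, L h ∂ν) (g := fun y => ‖y - z‖ ^ 2) ?_).trans_isLittleO ?_
  · filter_upwards [hn] with y hy
    rw [sys.constr_eq hmom k hy, sys.constr_eq hmom k hzn, Real.norm_eq_abs, norm_pow, norm_norm]
    exact hS.mean_taylor hLi hzn hy
  · have h1 : (fun y => ‖y - z‖ ^ 2) =o[𝓝 z] fun y => y - z := by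
      have := (Asymptotics.isLittleO_norm_pow_id (E' := Var K S N) one_lt_two).comp_tendsto
        (tendsto_sub_nhds_zero_iff.2 (tendsto_id (x := 𝓝 z)))
      exact this
    exact h1.mono nhdsWithin_le_nhds

theorem constrGrad_eq
    (hmom : ∀ (q : ℕ) (m : Fin M) (k : Fin K), Integrable (fun h => ‖h m k‖ ^ q) ν) (k : Fin K)
    {z : Var K S N} (hz : z ∈ physical K S N) (hr : z ∈ sys.regular) :
    sys.constrGrad ν k z = ∫ h, sys.rateGrad k z h ∂ν := by
  have h := (sys.hasGradientWithinAt_constr hmom k hz hr).hasFDerivWithinAt.fderivWithin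
    (uniqueDiffOn_physical z hz)
  rw [constrGrad, gradientWithin, h, LinearIsometryEquiv.symm_apply_apply]

theorem limitSurrogate_eq
    (hmom : ∀ (q : ℕ) (m : Fin M) (k : Fin K), Integrable (fun h => ‖h m k‖ ^ q) ν) (k : Fin K)
    {n : ℕ} {z : Var K S N} (hz : z ∈ sys.regularPart n) (τ : Fin K → ℝ) :
    sys.limitSurrogate ν τ z k
      = limitModel ν (sys.sampleConstr k) (sys.rateGrad k) (τ k) z := by
  funext y
  have := sys.constr_eq hmom k hz
  rw [constr] at this
  rw [limitSurrogate, limitModel, quadModel, this,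
    sys.constrGrad_eq hmom k hz.1 (sys.regularPart_subset_regular n hz)]

theorem mean_pos_of_totalPower_eq_zero {x : Var K S N} (hx : x ∈ sys.chi) (hr : x ∈ sys.regular)
    (h0 : totalPower x = 0) (k : Fin K) : 0 < ∫ h, sys.sampleConstr k x h ∂ν := by
  have hp : power x k = 0 :=
    (Finset.sum_eq_zero_iff_of_nonneg fun k _ => (hx.1 k).1).1 h0 k (Finset.mem_univ k)
  have e : ∀ h, sys.sampleConstr k x h = sys.targetRate k := fun h => by
    rw [sys.sampleConstr_eq (sys.chi_subset_physical hx) hr, rate, sinr, hp]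
    simp
  simpa [e] using sys.targetRate_pos k

end Law

/-! ### Runs of the algorithm as surrogate runs. -/

section Run

variable {sys} {τ : Fin K → ℝ} {α β : ℕ → ℝ} {h : ℕ → Channel M K} {x : ℕ → Var K S N}

theorem gradEst_eq (hx : ∀ l, x l ∈ physical K S N) (hr : ∀ l, x l ∈ sys.regular) (k : Fin K)
    (l : ℕ) : sys.gradEst β h x k l = gradTrack (sys.rateGrad k) β h x l := by
  have hg : ∀ l, sys.sampleGrad h x k l = sys.rateGrad k (x l) (h l) := fun l =>
    sys.gradient_sample (hx l) (hr l) (h l)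
  induction l with
  | zero => rw [gradEst, smul_zero, zero_add, hg]; rfl
  | succ l ih => rw [gradEst, ih, hg]; rfl

theorem surrogate_eq (hx : ∀ l, x l ∈ physical K S N) (hr : ∀ l, x l ∈ sys.regular) (k : Fin K)
    (l : ℕ) : sys.surrogate τ β h x l k
      = stepModel (sys.sampleConstr k) (sys.rateGrad k) (τ k) β h x l := by
  funext y
  have e : sys.targetRate k - sys.sampleRate h x k l = sampleMean (sys.sampleConstr k) h l (x l) := by
    have hl : (l : ℝ) + 1 ≠ 0 := by positivity
    simp only [sampleMean, sampleRate, sys.sampleConstr_eq (hx l) (hr l), Finset.sum_sub_distrib,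
      Finset.sum_const, Finset.card_range, smul_eq_mul, nsmul_eq_mul]
    push_cast
    field_simp
  rw [surrogate, e, gradEst_eq hx hr]
  rfl

variable (hrun : sys.IsRun τ α β h x)
include hrun

theorem IsRun.mem_chi (hα : ∀ l, 0 < α l ∧ α l ≤ 1) (l : ℕ) : x l ∈ sys.chi := by
  induction l with
  | zero => exact hrun.init
  | succ l ih =>
    obtain ⟨xhat, ξ, xbar, hfeas, hle, hgt, hstep⟩ := hrun.step l
    have hbar : xbar ∈ sys.chi := by
      rcases le_or_gt ξ 0 with hξ | hξ
      · exact (hle hξ).1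
      · rw [hgt hξ]; exact hfeas.1
    rw [hstep]
    exact sys.convex_chi ih hbar (sub_nonneg.2 (hα l).2) (hα l).1.le (by ring)

/-- Without users the feasibility problem would leave `ξ` unconstrained and have no minimizer, so
there would be no run. -/
theorem IsRun.nonempty : Nonempty (Fin K) := by
  by_contra hK
  rw [not_nonempty_iff] at hK
  obtain ⟨xhat, ξ, -, hfeas, -⟩ := hrun.step 0
  linarith [hfeas.2.2 xhat hfeas.1 (ξ - 1) fun k => isEmptyElim k]

theorem IsRun.exists_surrogateRun {ν : Measure (Channel M K)} [IsProbabilityMeasure ν]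
    (hmom : ∀ (q : ℕ) (m : Fin M) (k : Fin K), Integrable (fun h => ‖h m k‖ ^ q) ν)
    (hτ : ∀ k, 0 < τ k) (hα : ∀ l, 0 < α l ∧ α l ≤ 1) (hβ : ∀ l, 0 < β l ∧ β l ≤ 1)
    (hα_zero : Tendsto α atTop (𝓝 0))
    (hα_sum : Tendsto (fun n => ∑ l ∈ Finset.range n, α l) atTop atTop)
    (hα_sq : Summable fun l => α l ^ 2)
    (hβ_sum : Tendsto (fun n => ∑ l ∈ Finset.range n, β l) atTop atTop)
    (hαβ : Tendsto (fun l => α l / β l) atTop (𝓝 0)) {n : ℕ} (hn : ∀ l, x l ∈ sys.regularPart n)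
    {L : Fin K → Channel M K → ℝ} (hL : ∀ k, Integrable (L k) ν)
    (hS : ∀ k, RegularSample (sys.regularPart n) (sys.sampleConstr k) (sys.rateGrad k) (L k))
    (htyp : ∀ k, TypicalPath ν (sys.regularPart n) (sys.sampleConstr k) (sys.rateGrad k) (L k) β h x)
    (hslater : ∀ (φ : ℕ → ℕ) (z : Var K S N), StrictMono φ →
      Tendsto (fun j => x (φ j)) atTop (𝓝 z) → sys.SlaterAt ν τ z) :
    ∃ xbar, SurrogateRun ν (sys.regularPart n) sys.chi (totalPowerCLM K S N) sys.sampleConstr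
      sys.rateGrad L τ α β h x xbar := by
  have hx := hrun.mem_chi hα
  have hmodel := fun k l => surrogate_eq (τ := τ) (β := β) (h := h) (fun l => (hn l).1)
    (fun l => sys.regularPart_subset_regular n (hn l)) k l
  choose xhat ξ xbar hfeas hle hgt hstep using hrun.step
  have hself : ∀ k l, stepModel (sys.sampleConstr k) (sys.rateGrad k) (τ k) β h x l (x l)
      = sampleMean (sys.sampleConstr k) h l (x l) := fun k l => quadModel_self _ _ _ _
  simp only [SolvesFeasibility, SolvesObjective, hmodel] at hfeas hle
  obtain ⟨k₀⟩ := hrun.nonempty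
  refine ⟨xbar, ?_⟩
  constructor
  case isCompact => exact sys.isCompact_regularPart n
  case isClosed => exact sys.isClosed_chi
  case convex => exact sys.convex_chi
  case obj_nonneg =>
    intro y hy
    rw [totalPowerCLM_apply]
    exact Finset.sum_nonneg fun k _ => (hy.1 k).1
  case obj_le =>
    refine ⟨∑ k, sys.maxPower k, fun y hy => ?_⟩
    rw [totalPowerCLM_apply]
    exact Finset.sum_le_sum fun k _ => (hy.1 k).2
  case exists_zero =>
    refine ⟨n, n.cast_nonneg, fun l => ?_⟩
    obtain ⟨y, hy, hy0, hyx⟩ := sys.exists_mem_chi_totalPower_eq_zero (hx l)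
    exact ⟨y, hy, by rw [totalPowerCLM_apply, hy0], hyx.trans (hn l).2.1⟩
  case pos_of_zero =>
    intro y hy hy0 hyχ
    rw [totalPowerCLM_apply] at hy0
    exact ⟨k₀, sys.mean_pos_of_totalPower_eq_zero hyχ (sys.regularPart_subset_regular n hy) hy0 k₀⟩
  case bar_mem =>
    intro l
    rcases le_or_gt (ξ l) 0 with hξ | hξ
    · exact (hle l hξ).1
    · rw [hgt l hξ]; exact (hfeas l).1
  case model_le =>
    intro l A hA hA' k
    rcases le_or_gt (ξ l) 0 with hξ | hξ
    · exact ((hle l hξ).2.1 k).trans hA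
    · rw [hgt l hξ]
      -- The current iterate competes in the feasibility problem, its surrogate values being the
      -- sample values.
      exact ((hfeas l).2.1 k).trans
        ((hfeas l).2.2 (x l) (hx l) A fun k => (hself k l).trans_le (hA' k))
  case solves =>
    rintro l ⟨y, hy, hyl⟩
    -- A feasible point forces the optimal `ξ` to be nonpositive, so the objective update was
    -- carried out.
    have hopt := hle l ((hfeas l).2.2 y hy 0 hyl)
    refine ⟨hopt.2.1, fun y hy hyl => ?_⟩
    rw [totalPowerCLM_apply, totalPowerCLM_apply]
    exact hopt.2.2 y hy hyl
  case slater =>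
    intro φ z hφ hz
    have hzn := (sys.isClosed_regularPart n).mem_of_tendsto hz (Eventually.of_forall fun j => hn _)
    obtain ⟨y, hy, hlt⟩ := hslater φ z hφ hz
    exact ⟨y, hy, fun k => by simpa only [sys.limitSurrogate_eq hmom k hzn] using hlt k⟩
  all_goals assumption

theorem IsRun.isStationary {ν : Measure (Channel M K)} [IsProbabilityMeasure ν]
    (hmom : ∀ (q : ℕ) (m : Fin M) (k : Fin K), Integrable (fun h => ‖h m k‖ ^ q) ν)
    {n : ℕ} {L : Fin K → Channel M K → ℝ} {xbar : ℕ → Var K S N}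
    (r : SurrogateRun ν (sys.regularPart n) sys.chi (totalPowerCLM K S N) sys.sampleConstr
      sys.rateGrad L τ α β h x xbar) {φ : ℕ → ℕ} {z : Var K S N} (hφ : StrictMono φ)
    (hz : Tendsto (fun j => x (φ j)) atTop (𝓝 z)) : sys.IsStationary ν z := by
  have hK := hrun.nonempty
  have hzn := (sys.isClosed_regularPart n).mem_of_tendsto hz
    (Eventually.of_forall fun j => r.mem_reg _)
  have hzr := sys.regularPart_subset_regular n hzn
  obtain ⟨lam, hlam, hcomp, hmin⟩ := r.exists_multipliers_of_tendsto hφ hz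
  refine ⟨sys.isClosed_chi.mem_of_tendsto hz (Eventually.of_forall fun j => r.mem _), fun k => ?_,
    fun k => (sys.hasGradientWithinAt_constr hmom k hzn.1 hzr).differentiableWithinAt,
    lam, hlam, fun k => ?_, fun y hy => ?_⟩
  · rw [sys.constr_eq hmom k hzn]
    exact r.mean_le_zero_of_tendsto k hφ.tendsto_atTop hz
  · rw [sys.constr_eq hmom k hzn]
    exact hcomp k
  · simp only [inner_add_left, inner_gradient_totalPower, sum_inner, real_inner_smul_left,
      sys.constrGrad_eq hmom _ hzn.1 hzr]
    exact hmin y hy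

end Run

end Uplink
end RSSCA

/-! ### The convergence theorem. -/

theorem mainTheorem1 {M K S N : ℕ} (sys : RSSCA.Uplink M K S N)
    {Ω : Type*} [MeasurableSpace Ω] (μ : Measure Ω) [IsProbabilityMeasure μ]
    -- independent channel samples with common law `ν`, which has finite moments
    (ν : Measure (RSSCA.Channel M K)) (H : ℕ → Ω → RSSCA.Channel M K)
    (hH_meas : ∀ l, Measurable (H l)) (hH_law : ∀ l, μ.map (H l) = ν) (hH_indep : iIndepFun H μ)
    (hmom : ∀ (q : ℕ) (m : Fin M) (k : Fin K), Integrable (fun h => ‖h m k‖ ^ q) ν)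
    -- parameters of the algorithm
    (τ : Fin K → ℝ) (hτ : ∀ k, 0 < τ k)
    (α β : ℕ → ℝ) (hα : ∀ l, 0 < α l ∧ α l ≤ 1) (hβ : ∀ l, 0 < β l ∧ β l ≤ 1)
    (hα_zero : Tendsto α atTop (𝓝 0))
    (hα_sum : Tendsto (fun n => ∑ l ∈ Finset.range n, α l) atTop atTop)
    (hα_sq : Summable fun l => α l ^ 2)
    (hβ_zero : Tendsto β atTop (𝓝 0))
    (hβ_sum : Tendsto (fun n => ∑ l ∈ Finset.range n, β l) atTop atTop)
    (hβ_sq : Summable fun l => β l ^ 2)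
    (hαβ : Tendsto (fun l => α l / β l) atTop (𝓝 0))
    -- the iterates; the `l`-th one is computed from the samples obtained before frame `l`
    (x : ℕ → Ω → RSSCA.Var K S N)
    (hx_meas : ∀ l, Measurable[⨆ i : Fin l, MeasurableSpace.comap (H i) inferInstance] (x l))
    (hx_run : ∀ᵐ ω ∂μ, sys.IsRun τ α β (fun l => H l ω) (fun l => x l ω)) :
    ∀ᵐ ω ∂μ,
      -- the run stays in a compact set on which the rates are well defined
      (∃ C : Set (RSSCA.Var K S N), IsCompact C ∧ C ⊆ sys.regular ∧ ∀ l, x l ω ∈ C) →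
      -- the Slater condition
      (∀ (φ : ℕ → ℕ) (z : RSSCA.Var K S N), StrictMono φ →
        Tendsto (fun j => x (φ j) ω) atTop (𝓝 z) → sys.SlaterAt ν τ z) →
      ∀ (φ : ℕ → ℕ) (z : RSSCA.Var K S N), StrictMono φ →
        Tendsto (fun j => x (φ j) ω) atTop (𝓝 z) → sys.IsStationary ν z := by
  have hs : IsSampling μ ν H := ⟨hH_meas, hH_law, hH_indep⟩
  have hν := hs.isProbabilityMeasure
  choose L hL0 hLp hLi hS using fun k n => sys.exists_regularSample_memLp hmom k n
  -- The compact set may depend on the realization. Every such set, cut down to nonnegative powers,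
  -- lies in some `regularPart n`, and countably many of these give a single null set.
  have htyp : ∀ᵐ ω ∂μ, ∀ n k, (∀ l, x l ω ∈ sys.regularPart n) →
      TypicalPath ν (sys.regularPart n) (sys.sampleConstr k) (sys.rateGrad k) (L k n) β
        (fun l => H l ω) (fun l => x l ω) :=
    ae_all_iff.2 fun n => ae_all_iff.2 fun k =>
      hs.ae_typicalPath (hLp k n) (hL0 k n) (fun _ hy => hy.2.1)
        (sys.isClosed_regularPart n).measurableSet (hS k n) hβ hβ_sum hβ_sq hx_meas
  filter_upwards [hx_run, htyp] with ω hrun htypω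
  rintro ⟨C, hC, hCr, hxC⟩ hslater φ z hφ hz
  obtain ⟨n, hn⟩ := sys.exists_subset_regularPart hC hCr
  have hxn : ∀ l, x l ω ∈ sys.regularPart n := fun l =>
    hn ⟨hxC l, sys.chi_subset_physical (hrun.mem_chi hα l)⟩
  obtain ⟨xbar, r⟩ := hrun.exists_surrogateRun hmom hτ hα hβ hα_zero hα_sum hα_sq hβ_sum hαβ hxn
    (fun k => hLi k n) (fun k => hS k n) (fun k => htypω n k hxn) hslater
  exact hrun.isStationary hmom r hφ hz

end
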